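/- Let $G$ be a connected noncompact real Lie group with simple Lie algebra $\mathfrak g$, let $\theta$ be a Cartan involution of $\mathfrak g$ with Cartan decomposition $\mathfrak g=\mathfrak k\oplus\mathfrak p$, and let $\mathfrak a\subset\mathfrak p$ be a maximal abelian subspace, with restricted root system $\Sigma=\Sigma(\mathfrak g,\mathfrak a)$. Let $\iota:G\to G_{\mathbb C}$ be a complexification of $G$, i.e. a smooth homomorphism into a complex Lie group whose differential identifies the Lie algebra of $G_{\mathbb C}$ with $\mathfrak g_{\mathbb C}=\mathfrak g\oplus i\mathfrak g$ (for instance the universal complexification). Let $K_{\mathbb C}\subset G_{\mathbb C}$ be the analytic subgroup with Lie algebra $\mathfrak k_{\mathbb C}$ and $X_{\mathbb C}=G_{\mathbb C}/K_{\mathbb C}$, a complex manifold with base point $x_0=eK_{\mathbb C}$, on which $G$ acts through $\iota$. Fix a basis $\alpha_1,\dots,\alpha_n$ of $\Sigma$, let $\beta=k_1\alpha_1+\dots+k_n\alpha_n$ be the highest root, and let $\omega_1,\dots,\omega_n\in\mathfrak a$ be the dual basis, $\alpha_j(\omega_i)=\delta_{ij}$. Call $\omega_j$ minuscule if $k_j=1$.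 For $1\le j\le n$ put $$z_j=\exp\bigl(i\pi\omega_j/(2k_j)\bigr),$$ and let $\mathfrak h_j\subset\mathfrak g$ be the Lie algebra of the stabilizer in $G$ of the point $z_j.x_0\in X_{\mathbb C}$. (These points lie on the boundary of the crown $\Xi=G\exp(i\pi\Omega/2).x_0$, $\Omega=\{Y\in\mathfrak a:|\alpha(Y)|<1\ \forall\alpha\in\Sigma\}$; up to the Weyl group they include all the distinguished boundary points, i.e. those for which $\omega_j/k_j$ is an extreme point of $\overline\Omega$.) Then for every $1\le j\le n$ the following are equivalent: 1. $\omega_j$ is minuscule. 2. $\dim\mathfrak h_j=\dim\mathfrak k$. 3. $\operatorname{Ad}(z_j^{-1})(\mathfrak h_j)_{\mathbb C}=\mathfrak k_{\mathbb C}$. 4. $\mathfrak h_j$ is a symmetric subalgebra of $\mathfrak g$, i.e. the fixed point algebra of an involutive automorphism of $\mathfrak g$. 5. The orbit $G.z_jx_0$ is a totally real submanifold of $X_{\mathbb C}$, i.e. a (smooth, embedded) real submanifold $S$ with $T_pS\cap i\,T_pS=0$ for all $p\in S$. 6. The orbit $G.z_jx_0$ is a totally real submanifold of $X_{\mathbb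 C}$ of maximal dimension, i.e. of real dimension $\dim_{\mathbb C}X_{\mathbb C}$. -/

import Mathlib

open scoped Manifold ContDiff

noncomputable section

/-! ### Real Lie algebras: Cartan involutions, symmetric subalgebras, restricted roots -/

section LieAlgebras

variable {L : Type*} [LieRing L] [LieAlgebra ℝ L]

/-- The subalgebra of fixed points of an automorphism of a real Lie algebra. -/
def fixedSubalgebra (τ : L ≃ₗ⁅ℝ⁆ L) : LieSubalgebra ℝ L where
  carrier := {Y | τ Y = Y}
  add_mem' := by
    intro X Y hX hY
    change τ X = X at hX
    change τ Y = Y at hY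
    change τ (X + Y) = X + Y
    rw [map_add, hX, hY]
  zero_mem' := map_zero τ
  smul_mem' := by
    intro c X hX
    change τ X = X at hX
    change τ (c • X) = c • X
    rw [map_smul, hX]
  lie_mem' := by
    intro X Y hX hY
    change τ X = X at hX
    change τ Y = Y at hY
    change τ ⁅X, Y⁆ = ⁅X, Y⁆
    rw [LieEquiv.map_lie, hX, hY]

/-- A subalgebra is symmetric if it is the fixed point algebra of an involutive automorphism. -/
def IsSymmetricSubalgebra (𝔥 : LieSubalgebra ℝ L) : Prop :=
  ∃ τ : L ≃ₗ⁅ℝ⁆ L, (∀ Y, τ (τ Y) = Y) ∧ 𝔥 = fixedSubalgebra τ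

/-- `θ` is a Cartan involution: an involutive automorphism such that the form
`(X, Y) ↦ -κ(X, θ Y)`, with `κ` the Killing form, is positive definite. -/
def IsCartanInvolution (θ : L ≃ₗ⁅ℝ⁆ L) : Prop :=
  (∀ Y, θ (θ Y) = Y) ∧ ∀ Y, Y ≠ 0 → 0 < -killingForm ℝ L Y (θ Y)

/-- The maximal compact subalgebra `𝔨` of the Cartan decomposition `𝔤 = 𝔨 ⊕ 𝔭`: the `+1`
eigenspace of the Cartan involution. -/
abbrev cartanK (θ : L ≃ₗ⁅ℝ⁆ L) : LieSubalgebra ℝ L := fixedSubalgebra θ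

/-- The space `𝔭` of the Cartan decomposition: the `-1` eigenspace of the Cartan involution. -/
def cartanP (θ : L ≃ₗ⁅ℝ⁆ L) : Submodule ℝ L where
  carrier := {Y | θ Y = -Y}
  add_mem' := by
    intro X Y hX hY
    change θ X = -X at hX
    change θ Y = -Y at hY
    change θ (X + Y) = -(X + Y)
    rw [map_add, hX, hY, neg_add]
  zero_mem' := by simp
  smul_mem' := by
    intro c X hX
    change θ X = -X at hX
    change θ (c • X) = -(c • X)
    rw [map_smul, hX, smul_neg]

/-- `𝔞` is a maximal abelian subspace of `𝔭`. -/
def IsMaximalAbelianIn (𝔭 𝔞 : Submodule ℝ L) : Prop :=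
  Maximal (fun 𝔟 : Submodule ℝ L => 𝔟 ≤ 𝔭 ∧ ∀ X ∈ 𝔟, ∀ Y ∈ 𝔟, ⁅X, Y⁆ = 0) 𝔞

/-- `α` belongs to the restricted root system `Σ(𝔤, 𝔞)`. -/
def IsRestrictedRoot (𝔞 : Submodule ℝ L) (α : Module.Dual ℝ 𝔞) : Prop :=
  α ≠ 0 ∧ ∃ Y : L, Y ≠ 0 ∧ ∀ H : 𝔞, ⁅(H : L), Y⁆ = α H • Y

/-- `α 0, …, α (n - 1)` is a basis (a system of simple roots) of the root system `Σ(𝔤, 𝔞)`. -/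
structure IsRootBasis (𝔞 : Submodule ℝ L) {n : ℕ} (α : Fin n → Module.Dual ℝ 𝔞) : Prop where
  isRoot : ∀ i, IsRestrictedRoot 𝔞 (α i)
  linearIndependent : LinearIndependent ℝ α
  nonneg_or_nonpos : ∀ γ, IsRestrictedRoot 𝔞 γ →
    ∃ c : Fin n → ℕ, γ = ∑ i, c i • α i ∨ γ = -∑ i, c i • α i

/-- `β = ∑ i, k i • α i` is the highest root of `Σ(𝔤, 𝔞)` with respect to the basis `α`: it is a
root, and `β - γ` is a sum of simple roots for every root `γ`. -/
structure IsHighestRootCoeff (𝔞 : Submodule ℝ L) {n : ℕ} (α : Fin n → Module.Dual ℝ 𝔞)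
    (k : Fin n → ℕ) : Prop where
  isRoot : IsRestrictedRoot 𝔞 (∑ i, k i • α i)
  highest : ∀ γ, IsRestrictedRoot 𝔞 γ →
    ∃ c : Fin n → ℕ, (∑ i, k i • α i) - γ = ∑ i, c i • α i

/-- The basis `w 0, …, w (n - 1)` of `𝔞` dual to the simple roots. -/
def IsDualBasis (𝔞 : Submodule ℝ L) {n : ℕ} (α : Fin n → Module.Dual ℝ 𝔞)
    (w : Fin n → 𝔞) : Prop :=
  ∀ i j, α j (w i) = if i = j then 1 else 0

end LieAlgebras

/-- Smooth real Lie groups are smooth enough to have a Lie algebra. -/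
instance instLEInftyMinSmoothness : ENat.LEInfty (minSmoothness ℝ 3) := by
  rw [minSmoothness_of_isRCLikeNormedField]
  infer_instance

/-! ### Exponential map and Lie algebras of subgroups -/

section Exponential

variable {E : Type*} [NormedAddCommGroup E] [NormedSpace ℝ E]
  {G : Type*} [TopologicalSpace G] [ChartedSpace E G] [Group G]

/-- `γ` is the one-parameter subgroup of the Lie group `G` with initial velocity `Y` (a
homomorphism which is differentiable at `0` is smooth). -/
def IsOneParameterSubgroup (γ : ℝ → G) (Y : GroupLieAlgebra 𝓘(ℝ, E) G) : Prop :=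
  (∀ s t, γ (s + t) = γ s * γ t) ∧
    HasMFDerivAt 𝓘(ℝ, ℝ) 𝓘(ℝ, E) γ 0
      (ContinuousLinearMap.toSpanSingleton ℝ (show E from Y) : ℝ →L[ℝ] E)

open Classical in
/-- The exponential map of a Lie group: `exp Y = γ 1`, where `γ` is the one-parameter subgroup
with initial velocity `Y`. -/
def lieExp (Y : GroupLieAlgebra 𝓘(ℝ, E) G) : G :=
  if h : ∃ γ : ℝ → G, IsOneParameterSubgroup γ Y then h.choose 1 else 1

/-- The Lie algebra of a closed subgroup `H` of `G`, which consists of all `Y` with `exp (t Y) ∈ H`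
for all real `t`. (These `Y` form a subalgebra; taking the generated subalgebra adds nothing.) -/
def lieAlgebraOfSubgroup [CompleteSpace E] [LieGroup 𝓘(ℝ, E) ∞ G]
    (H : Subgroup G) : LieSubalgebra ℝ (GroupLieAlgebra 𝓘(ℝ, E) G) :=
  LieSubalgebra.lieSpan ℝ _ {Y | ∀ t : ℝ, lieExp (t • Y) ∈ H}

end Exponential

/-! ### Complex Lie groups, complexifications and the complex symmetric space -/

section Complexification

variable {E : Type*} [NormedAddCommGroup E] [NormedSpace ℝ E]
  {G : Type*} [TopologicalSpace G] [ChartedSpace E G] [Group G]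
  {F : Type*} [NormedAddCommGroup F] [NormedSpace ℂ F]
  {GC : Type*} [TopologicalSpace GC] [ChartedSpace F GC] [Group GC]

/-- The exponential map of a complex Lie group, which is the one of the underlying real group. -/
def complexLieExp (Z : GroupLieAlgebra 𝓘(ℂ, F) GC) : GC :=
  lieExp (E := F) (G := GC) (show F from Z)

/-- The adjoint representation `Ad(g)` of a complex Lie group on its Lie algebra: the derivative
of `x ↦ g x g⁻¹` at `1`. -/
def complexAd (g : GC) : GroupLieAlgebra 𝓘(ℂ, F) GC →L[ℂ] GroupLieAlgebra 𝓘(ℂ, F) GC :=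
  (mfderiv 𝓘(ℂ, F) 𝓘(ℂ, F) (fun x : GC => g * x * g⁻¹) 1 : F →L[ℂ] F)

/-- The differential at `1` of a homomorphism from a real to a complex Lie group. -/
def lieDifferential (ι : G →* GC) :
    GroupLieAlgebra 𝓘(ℝ, E) G →ₗ[ℝ] GroupLieAlgebra 𝓘(ℂ, F) GC :=
  ContinuousLinearMap.toLinearMap (show E →L[ℝ] F from mfderiv 𝓘(ℝ, E) 𝓘(ℝ, F) ι 1)

/-- `ι : G → GC` is a complexification of the real Lie group `G`: a smooth homomorphism into a
complex Lie group whose differential identifies the Lie algebra of `GC` with `𝔤 ⊕ i 𝔤`. -/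
structure IsComplexification (ι : G →* GC) : Prop where
  contMDiff : ContMDiff 𝓘(ℝ, E) 𝓘(ℝ, F) ∞ ι
  bijective : Function.Bijective
    (fun Y : GroupLieAlgebra 𝓘(ℝ, E) G × GroupLieAlgebra 𝓘(ℝ, E) G =>
      (lieDifferential ι Y.1 : GroupLieAlgebra 𝓘(ℂ, F) GC)
        + Complex.I • lieDifferential ι Y.2)

/-- The complexification `V_ℂ = V ⊕ i V`, inside the Lie algebra of `GC`, of a subspace `V` of the
Lie algebra of `G`. -/
def complexSpan (ι : G →* GC) (V : Submodule ℝ (GroupLieAlgebra 𝓘(ℝ, E) G)) :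
    Submodule ℂ (GroupLieAlgebra 𝓘(ℂ, F) GC) :=
  Submodule.span ℂ (lieDifferential ι '' (V : Set (GroupLieAlgebra 𝓘(ℝ, E) G)))

/-- The analytic subgroup of a complex Lie group that corresponds to the subspace (in practice, the
subalgebra) `V` of its Lie algebra: the subgroup generated by `exp V`. -/
def analyticSubgroup (V : Submodule ℂ (GroupLieAlgebra 𝓘(ℂ, F) GC)) : Subgroup GC :=
  Subgroup.closure (complexLieExp '' (V : Set (GroupLieAlgebra 𝓘(ℂ, F) GC)))

/-- The analytic subgroup `K_ℂ` of `GC` with Lie algebra `𝔨_ℂ`. -/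
def complexK [CompleteSpace E] [LieGroup 𝓘(ℝ, E) ∞ G]
    (ι : G →* GC) (θ : GroupLieAlgebra 𝓘(ℝ, E) G ≃ₗ⁅ℝ⁆ GroupLieAlgebra 𝓘(ℝ, E) G) :
    Subgroup GC :=
  analyticSubgroup (F := F) (complexSpan (F := F) ι (cartanK θ).toSubmodule)

/-- The charts on `GC ⧸ H` define its quotient complex manifold structure: the unique
structure of complex manifold, on the quotient topological space, for which the projection
`GC → GC ⧸ H` is a holomorphic submersion. -/
structure IsQuotientManifold (H : Subgroup GC) (M : Type*) [NormedAddCommGroup M]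
    [NormedSpace ℂ M] [ChartedSpace M (GC ⧸ H)] : Prop where
  isManifold : IsManifold 𝓘(ℂ, M) ω (GC ⧸ H)
  contMDiff : ContMDiff 𝓘(ℂ, F) 𝓘(ℂ, M) ω (fun g : GC => (g : GC ⧸ H))
  submersion : ∀ g : GC, Function.Surjective
    (mfderiv 𝓘(ℂ, F) 𝓘(ℂ, M) (fun g : GC => (g : GC ⧸ H)) g)

end Complexification

/-! ### Totally real submanifolds -/

section TotallyReal

variable {M : Type*} [NormedAddCommGroup M] [NormedSpace ℂ M]
  {X : Type*} [TopologicalSpace X] [ChartedSpace M X]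

/-- `S` is a totally real submanifold, of real dimension `d`, of the complex manifold `X`: near each
of its points `p` it is the zero set of a smooth function `f` with `codim S` real components and
with surjective differential at `p` (so that `S` is a smooth embedded real submanifold, with
`T_p S = ker df_p`), and `T_p S ∩ i T_p S = 0`. -/
def IsTotallyRealSubmanifold (S : Set X) (d : ℕ) : Prop :=
  ∀ p ∈ S, ∃ (c : ℕ) (U : Set X) (f : X → EuclideanSpace ℝ (Fin c)),
    d + c = Module.finrank ℝ M ∧ IsOpen U ∧ p ∈ U ∧
    ContMDiffOn 𝓘(ℝ, M) 𝓘(ℝ, EuclideanSpace ℝ (Fin c)) ∞ f U ∧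
    (∀ q ∈ U, q ∈ S ↔ f q = 0) ∧
    Function.Surjective (mfderiv 𝓘(ℝ, M) 𝓘(ℝ, EuclideanSpace ℝ (Fin c)) f p) ∧
    ∀ v : TangentSpace 𝓘(ℂ, M) p,
      mfderiv 𝓘(ℝ, M) 𝓘(ℝ, EuclideanSpace ℝ (Fin c)) f p v = 0 →
      mfderiv 𝓘(ℝ, M) 𝓘(ℝ, EuclideanSpace ℝ (Fin c)) f p (Complex.I • v) = 0 → v = 0

end TotallyReal

/-- The point `exp (i π W / (2 k))` of `GC`, for `W` in the Lie algebra of `G`. -/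
def boundaryElement {E : Type*} [NormedAddCommGroup E] [NormedSpace ℝ E]
    {G : Type*} [TopologicalSpace G] [ChartedSpace E G] [Group G]
    {F : Type*} [NormedAddCommGroup F] [NormedSpace ℂ F]
    {GC : Type*} [TopologicalSpace GC] [ChartedSpace F GC] [Group GC]
    (ι : G →* GC) (W : GroupLieAlgebra 𝓘(ℝ, E) G) (k : ℕ) : GC :=
  complexLieExp (F := F) ((Complex.I * (Real.pi / (2 * k) : ℝ)) • lieDifferential ι W)

/-- The Lie algebra `𝔥` of the stabilizer in `G` of a point `z` of `GC ⧸ H`. -/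
def stabilizerAlgebra {E : Type*} [NormedAddCommGroup E] [NormedSpace ℝ E] [CompleteSpace E]
    {G : Type*} [TopologicalSpace G] [ChartedSpace E G] [Group G]
    [LieGroup 𝓘(ℝ, E) ∞ G] {GC : Type*} [Group GC]
    (ι : G →* GC) {H : Subgroup GC} (z : GC ⧸ H) :
    LieSubalgebra ℝ (GroupLieAlgebra 𝓘(ℝ, E) G) :=
  lieAlgebraOfSubgroup ((MulAction.stabilizer GC z).comap ι)

end

/-! Write `A = Ad(z)` on `𝔤_ℂ`, `σ` for the conjugation fixing `𝔤`, and `θ` also for the complex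
linear extension of the Cartan involution. Since `z = exp(iH)` with `H` a multiple of `ω_j` in `𝔭`,
both `θ` and `σ` send `iH` to `-iH`, so `θA = A⁻¹θ` and `σA = A⁻¹σ`. The symmetry of `X_ℂ` at `z x₀`
acts on `𝔤_ℂ` by `S = AθA⁻¹ = A²θ`, and `𝔥_j` is the set of its fixed points in `𝔤`. As `σS =
A⁻²θσ`, the map `S` commutes with `σ`, that is, preserves `𝔤`, exactly when `A⁴ = 1`. On the
`m`-eigenspace of `ad ω_j` the operator `A⁴` is `exp(2πi m / k_j)`; the eigenvalues are integers and
`1` is among them, so `A⁴ = 1` if and only if `k_j = 1` (`fourthPower_boundaryElement_iff`). Every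
condition is compared with `A⁴ = 1`.

If `A⁴ = 1`, then `S` restricts to an involution of `𝔤` with fixed algebra `𝔥_j`, and `A⁻¹(𝔥_j)_ℂ =
𝔨_ℂ`. In general only `A⁻¹(𝔥_j)_ℂ ⊆ 𝔨_ℂ` holds, so equality is a matter of dimension, and `A⁴` fixes
`𝔥_j` pointwise. If equality holds, `A⁴` fixes `𝔨`; it also fixes `ω_j`, and bracketing `X + θX`
with `ω_j` recovers a root vector `X` with `[ω_j, X] = X`, hence `k_j = 1`
(`fourthPower_eq_of_span_le`). If `𝔥_j` is symmetric, the fixed algebra of `A⁴` in `𝔤` is `θ`-stable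
and contains both `𝔥_j` and `ω_j ∉ 𝔥_j`; simplicity of `𝔤` makes it everything
(`eq_top_of_fixedSubalgebra_le`).

For the orbits, `q ↦ S_q` is a holomorphic map from `X_ℂ` to `End(𝔤_ℂ)` with injective differential.
If `S_z` commutes with `σ`, so does `S_q` along the whole orbit, and near each of its points the
orbit is cut out by `S_q = σ S_q σ` (`isTotallyRealSubmanifold_orbit`). Conversely, for a totally
real orbit a relation `T(Y) + iT(Y') = 0` between velocities of real generators forces `T(Y) = T(Y')
= 0`, which gives `A 𝔨_ℂ ⊆ (𝔥_j)_ℂ` (`apply_mem_span_of_isTotallyReal`). -/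

noncomputable section

/-! ### Complex manifolds and Lie groups regarded as real ones. -/

section RestrictScalars

variable {A : Type*} [NormedAddCommGroup A] [NormedSpace ℂ A]
  {HA : Type*} [TopologicalSpace HA] {I : ModelWithCorners ℂ A HA} {I' : ModelWithCorners ℝ A HA}
  {X : Type*} [TopologicalSpace X] [ChartedSpace HA X]
  {B : Type*} [NormedAddCommGroup B] [NormedSpace ℂ B]
  {Y : Type*} [TopologicalSpace Y] [ChartedSpace B Y]
  {f : X → Y} {x : X}

theorem HasMFDerivAt.complexToReal (hI : (I : HA → A) = I') (hI' : (I.symm : A → HA) = I'.symm)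
    {f' : A →L[ℂ] B} (h : HasMFDerivAt I 𝓘(ℂ, B) f x f') :
    HasMFDerivAt I' 𝓘(ℝ, B) f x (f'.restrictScalars ℝ : A →L[ℝ] B) := by
  refine ⟨h.1, ?_⟩
  have h2 := h.2
  have e1 : extChartAt I x x = extChartAt I' x x := by
    simp [extChartAt, hI]
  have e2 : Set.range I = Set.range I' := by rw [hI]
  have e3 : writtenInExtChartAt I 𝓘(ℂ, B) x f = writtenInExtChartAt I' 𝓘(ℝ, B) x f := by
    funext u
    simp [writtenInExtChartAt, extChartAt, hI']
  rw [e1, e2, e3] at h2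
  exact HasFDerivWithinAt.restrictScalars ℝ h2

theorem ContMDiffAt.complexToReal (hI : (I : HA → A) = I') (hI' : (I.symm : A → HA) = I'.symm)
    {n : WithTop ℕ∞} (h : ContMDiffAt I 𝓘(ℂ, B) n f x) :
    ContMDiffAt I' 𝓘(ℝ, B) n f x := by
  rw [contMDiffAt_iff] at h ⊢
  refine ⟨h.1, ?_⟩
  have h2 := h.2.restrict_scalars ℝ
  have e1 : extChartAt I x x = extChartAt I' x x := by
    simp [extChartAt, hI]
  have e2 : Set.range I = Set.range I' := by rw [hI]
  have e3 : (extChartAt 𝓘(ℂ, B) (f x)) ∘ f ∘ (extChartAt I x).symm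
      = (extChartAt 𝓘(ℝ, B) (f x)) ∘ f ∘ (extChartAt I' x).symm := by
    funext u
    simp [extChartAt, hI']
  rw [e1, e2, e3] at h2
  exact h2

end RestrictScalars

section RestrictLieGroup

variable {F : Type*} [NormedAddCommGroup F] [NormedSpace ℂ F]
  {GC : Type*} [TopologicalSpace GC] [ChartedSpace F GC]

theorem IsManifold.complexToReal {n : WithTop ℕ∞} [IsManifold 𝓘(ℂ, F) n GC] :
    IsManifold 𝓘(ℝ, F) n GC := by
  apply isManifold_of_contDiffOn
  intro e e' he he'
  have := (contDiffGroupoid n 𝓘(ℂ, F)).compatible he he'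
  rw [contDiffGroupoid, mem_groupoid_of_pregroupoid, contDiffPregroupoid] at this
  simpa using (this.1).restrict_scalars ℝ

variable [Group GC]

theorem LieGroup.complexToReal {n m : WithTop ℕ∞} (h : m ≤ n) [LieGroup 𝓘(ℂ, F) n GC] :
    LieGroup 𝓘(ℝ, F) m GC := by
  have : LieGroup 𝓘(ℂ, F) m GC := LieGroup.of_le h
  have : IsManifold 𝓘(ℝ, F) m GC := IsManifold.complexToReal
  refine { contMDiff_mul := fun x => ?_, contMDiff_inv := fun x => ?_ }
  · exact (contMDiff_mul 𝓘(ℂ, F) m (G := GC) x).complexToReal (I' := 𝓘(ℝ, F).prod 𝓘(ℝ, F)) rfl rfl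
  · exact (_root_.contMDiff_inv 𝓘(ℂ, F) m (G := GC) x).complexToReal rfl rfl

end RestrictLieGroup

/-! ### Existence and uniqueness of one-parameter subgroups. -/

section OneParameterSubgroups

variable {E : Type*} [NormedAddCommGroup E] [NormedSpace ℝ E]
  {G : Type*} [TopologicalSpace G] [ChartedSpace E G] [Group G]

namespace IsOneParameterSubgroup

variable {γ γ' : ℝ → G} {Y : GroupLieAlgebra 𝓘(ℝ, E) G}

theorem map_zero (h : IsOneParameterSubgroup γ Y) : γ 0 = 1 := by
  have := h.1 0 0
  simpa using this

theorem map_neg (h : IsOneParameterSubgroup γ Y) (t : ℝ) : γ (-t) = (γ t)⁻¹ := by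
  have := h.1 (-t) t
  rw [neg_add_cancel, h.map_zero] at this
  exact eq_inv_of_mul_eq_one_left this.symm

theorem comp_mul (h : IsOneParameterSubgroup γ Y) (t : ℝ) :
    IsOneParameterSubgroup (fun s => γ (s * t)) (t • Y) := by
  refine ⟨fun a b => by simp only [add_mul, h.1], ?_⟩
  have h1 : HasMFDerivAt 𝓘(ℝ, ℝ) 𝓘(ℝ, ℝ) (fun s : ℝ => s * t) 0
      (ContinuousLinearMap.toSpanSingleton ℝ t : ℝ →L[ℝ] ℝ) := by
    have : HasDerivAt (fun s : ℝ => s * t) t 0 := by simpa using (hasDerivAt_id (0 : ℝ)).mul_const t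
    exact this.hasFDerivAt.hasMFDerivAt
  have h2 : HasMFDerivAt 𝓘(ℝ, ℝ) 𝓘(ℝ, E) γ (0 * t)
      (ContinuousLinearMap.toSpanSingleton ℝ (show E from Y) : ℝ →L[ℝ] E) := by
    rw [zero_mul]; exact h.2
  have h3 := HasMFDerivAt.comp (0 : ℝ) (g := γ) (f := fun s : ℝ => s * t) h2 h1
  refine h3.congr_mfderiv (ContinuousLinearMap.ext fun (r : ℝ) => ?_)
  change (r * t) • (show E from Y) = r • (t • (show E from Y))
  rw [mul_smul]

variable [LieGroup 𝓘(ℝ, E) ∞ G]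

/-- Near `t` the curve is the left translate by `γ t` of its germ at `0`. This reduces uniqueness of
one-parameter subgroups to uniqueness of integral curves. -/
theorem isMIntegralCurve (h : IsOneParameterSubgroup γ Y) :
    IsMIntegralCurve γ (mulInvariantVectorField (I := 𝓘(ℝ, E)) Y) := by
  intro t
  have e : γ = (fun x => γ t * x) ∘ γ ∘ fun s => s - t := by
    funext s
    simp [← h.1]
  have h1 : HasMFDerivAt 𝓘(ℝ, ℝ) 𝓘(ℝ, ℝ) (fun s : ℝ => s - t) t
      (ContinuousLinearMap.id ℝ ℝ) :=
    ((hasFDerivAt_id t).sub_const t).hasMFDerivAt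
  have h2 : HasMFDerivAt 𝓘(ℝ, ℝ) 𝓘(ℝ, E) γ (t - t)
      (ContinuousLinearMap.toSpanSingleton ℝ (show E from Y) : ℝ →L[ℝ] E) := by
    rw [sub_self]; exact h.2
  have h3 := HasMFDerivAt.comp t (g := γ) (f := fun s : ℝ => s - t) h2 h1
  have h4 : HasMFDerivAt 𝓘(ℝ, E) 𝓘(ℝ, E) (fun x => γ t * x) ((γ ∘ fun s => s - t) t)
      (mfderiv 𝓘(ℝ, E) 𝓘(ℝ, E) (fun x => γ t * x) 1) := by
    have e2 : (γ ∘ fun s => s - t) t = 1 := by simp [h.map_zero]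
    rw [e2]
    exact (contMDiff_mul_left (I := 𝓘(ℝ, E)) (n := ∞)).mdifferentiableAt (by simp) |>.hasMFDerivAt
  have h5 := HasMFDerivAt.comp t h4 h3
  rw [← e] at h5
  refine h5.congr_mfderiv (ContinuousLinearMap.ext fun (r : ℝ) => ?_)
  exact ContinuousLinearMap.map_smul (mfderiv 𝓘(ℝ, E) 𝓘(ℝ, E) (fun x => γ t * x) 1) r Y

end IsOneParameterSubgroup

variable [LieGroup 𝓘(ℝ, E) ∞ G]

theorem contMDiff_one_mulInvariantVectorField (Y : GroupLieAlgebra 𝓘(ℝ, E) G) :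
    ContMDiff 𝓘(ℝ, E) 𝓘(ℝ, E).tangent 1 (fun g : G =>
      (⟨g, mulInvariantVectorField Y g⟩ : TangentBundle 𝓘(ℝ, E) G)) :=
  (contMDiff_mulInvariantVectorField Y).of_le (by
    rw [minSmoothness_of_isRCLikeNormedField]; norm_num)

theorem mfderiv_mul_left_mulInvariantVectorField (Y : GroupLieAlgebra 𝓘(ℝ, E) G) (g x : G) :
    mfderiv 𝓘(ℝ, E) 𝓘(ℝ, E) (fun y => g * y) x (mulInvariantVectorField Y x)
      = mulInvariantVectorField Y (g * x) := by
  have hd : ∀ a b : G, MDifferentiableAt 𝓘(ℝ, E) 𝓘(ℝ, E) (fun y => a * y) b := fun a b =>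
    (contMDiff_mul_left (I := 𝓘(ℝ, E)) (n := ∞)).mdifferentiableAt (by simp)
  have e : (fun y => g * x * y) = (fun y => g * y) ∘ fun y => x * y := by
    funext y; simp [mul_assoc]
  have e1 : HasMFDerivAt 𝓘(ℝ, E) 𝓘(ℝ, E) (fun y => g * y) (x * 1)
      (mfderiv 𝓘(ℝ, E) 𝓘(ℝ, E) (fun y => g * y) x) := by
    rw [mul_one]; exact (hd g x).hasMFDerivAt
  have e2 := (HasMFDerivAt.comp (1 : G) (f := fun y => x * y) e1 (hd x 1).hasMFDerivAt).mfderiv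
  rw [← e] at e2
  exact (DFunLike.congr_fun e2 Y).symm

theorem IsMIntegralCurveOn.mul_left {γ : ℝ → G} {Y : GroupLieAlgebra 𝓘(ℝ, E) G} {s : Set ℝ}
    (h : IsMIntegralCurveOn γ (mulInvariantVectorField (I := 𝓘(ℝ, E)) Y) s) (g : G) :
    IsMIntegralCurveOn (fun t => g * γ t) (mulInvariantVectorField (I := 𝓘(ℝ, E)) Y) s := by
  intro t ht
  have h1 : HasMFDerivAt 𝓘(ℝ, E) 𝓘(ℝ, E) (fun y => g * y) (γ t) _ :=
    ((contMDiff_mul_left (I := 𝓘(ℝ, E)) (n := ∞)).mdifferentiableAt (by simp)).hasMFDerivAt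
  have h2 := h1.comp_hasMFDerivWithinAt t (h t ht)
  refine h2.congr_mfderiv (ContinuousLinearMap.ext fun (r : ℝ) => ?_)
  refine (ContinuousLinearMap.map_smul (mfderiv 𝓘(ℝ, E) 𝓘(ℝ, E) (fun x => g * x) (γ t)) r
    (mulInvariantVectorField (I := 𝓘(ℝ, E)) Y (γ t))).trans ?_
  rw [mfderiv_mul_left_mulInvariantVectorField]
  rfl

variable [T2Space G]

theorem IsOneParameterSubgroup.unique {γ γ' : ℝ → G} {Y : GroupLieAlgebra 𝓘(ℝ, E) G}
    (h : IsOneParameterSubgroup γ Y) (h' : IsOneParameterSubgroup γ' Y) : γ = γ' := by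
  have := LieGroup.of_le (I := 𝓘(ℝ, E)) (G := G) (m := 1) (n := ∞) (by simp)
  exact isMIntegralCurve_Ioo_eq_of_contMDiff_boundaryless (t₀ := 0)
    (contMDiff_one_mulInvariantVectorField Y) h.isMIntegralCurve h'.isMIntegralCurve
    (by rw [h.map_zero, h'.map_zero])

theorem exists_isOneParameterSubgroup [CompleteSpace E] (Y : GroupLieAlgebra 𝓘(ℝ, E) G) :
    ∃ γ : ℝ → G, IsOneParameterSubgroup γ Y := by
  have := LieGroup.of_le (I := 𝓘(ℝ, E)) (G := G) (m := 1) (n := ∞) (by simp)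
  have hv := contMDiff_one_mulInvariantVectorField (G := G) Y
  obtain ⟨γ₀, h0, h1⟩ := exists_isMIntegralCurveAt_of_contMDiffAt_boundaryless (t₀ := 0)
    (hv.contMDiffAt (x := 1))
  rw [isMIntegralCurveAt_iff'] at h1
  obtain ⟨ε, hε, h1⟩ := h1
  rw [Real.ball_eq_Ioo, zero_sub, zero_add] at h1
  -- Left translation carries the local solution at `1` to a solution through any point on the same
  -- interval. This uniform lifetime makes the invariant field complete.
  obtain ⟨γ, hγ0, hγ⟩ := exists_isMIntegralCurve_of_isMIntegralCurveOn hv hε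
    (fun x => ⟨fun t => x * γ₀ t, by simp [h0], h1.mul_left x⟩) 1
  refine ⟨γ, fun s t => ?_, ?_⟩
  -- The homomorphism property: `t ↦ γ (s + t)` and `t ↦ γ s * γ t` are integral curves with the
  -- same value at `0`.
  · have h2 : IsMIntegralCurve (fun t => γ s * γ t) (mulInvariantVectorField (I := 𝓘(ℝ, E)) Y) := by
      rw [isMIntegralCurve_iff_isMIntegralCurveOn] at hγ ⊢
      exact hγ.mul_left _
    have h3 := hγ.comp_add s
    have h4 := isMIntegralCurve_Ioo_eq_of_contMDiff_boundaryless (t₀ := 0) hv h3 h2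
      (by simp [hγ0])
    have h5 := congrFun h4 t
    simpa [add_comm] using h5
  · have h2 := hγ 0
    refine h2.congr_mfderiv (ContinuousLinearMap.ext fun (r : ℝ) => ?_)
    change r • (show E from mulInvariantVectorField (I := 𝓘(ℝ, E)) Y (γ 0)) = r • (show E from Y)
    congr 1
    rw [hγ0]
    have : (fun x : G => 1 * x) = id := by funext x; simp
    change mfderiv 𝓘(ℝ, E) 𝓘(ℝ, E) (fun x : G => 1 * x) 1 Y = Y
    rw [this, mfderiv_id]
    rfl

theorem IsOneParameterSubgroup.lieExp_smul {γ : ℝ → G} {Y : GroupLieAlgebra 𝓘(ℝ, E) G}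
    (h : IsOneParameterSubgroup γ Y) (t : ℝ) : lieExp (t • Y) = γ t := by
  have h1 := h.comp_mul t
  have h2 : ∃ γ : ℝ → G, IsOneParameterSubgroup γ (t • Y) := ⟨_, h1⟩
  rw [lieExp, dif_pos h2, h2.choose_spec.unique h1]
  simp only [one_mul]

end OneParameterSubgroups

/-! ### The adjoint representation over an arbitrary field, and its smoothness. -/

section AdjointRepresentation

variable {𝕜 : Type*} [NontriviallyNormedField 𝕜]
  {E : Type*} [NormedAddCommGroup E] [NormedSpace 𝕜 E]
  {G : Type*} [TopologicalSpace G] [ChartedSpace E G] [Group G]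

/-- General smoothness of `mfderiv` in parameters is stated up to changes of tangent coordinates.
Conjugation fixes `1`, so for `groupAd` base point and target do not move and these changes are
trivial. -/
theorem inTangentCoordinates_of_eq {N X X' : Type*} {E' : Type*} [NormedAddCommGroup E']
    [NormedSpace 𝕜 E'] [TopologicalSpace X] [ChartedSpace E X] [IsManifold 𝓘(𝕜, E) 1 X]
    [TopologicalSpace X'] [ChartedSpace E' X'] [IsManifold 𝓘(𝕜, E') 1 X']
    {f : N → X} {g : N → X'} (φ : N → E →L[𝕜] E') (x₀ x : N) (hf : f x = f x₀) (hg : g x = g x₀) :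
    inTangentCoordinates 𝓘(𝕜, E) 𝓘(𝕜, E') f g φ x₀ x = φ x := by
  rw [inTangentCoordinates_eq (x₀ := x₀) (x := x) f g φ (by rw [hf]; exact mem_chart_source _ _)
    (by rw [hg]; exact mem_chart_source _ _), hf, hg]
  ext v
  have h1 := (tangentBundleCore 𝓘(𝕜, E) X).coordChange_self (achart E (f x₀)) (f x₀)
    (mem_chart_source _ _) v
  have h2 := (tangentBundleCore 𝓘(𝕜, E') X').coordChange_self (achart E' (g x₀)) (g x₀)
    (mem_chart_source _ _) (φ x v)
  simp only [ContinuousLinearMap.comp_apply]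
  rw [h1, h2]

variable (𝕜 E) in
/-- The adjoint representation of a Lie group on its tangent space at `1`. -/
def groupAd (g : G) : E →L[𝕜] E :=
  mfderiv 𝓘(𝕜, E) 𝓘(𝕜, E) (fun x : G => g * x * g⁻¹) 1

variable (𝕜 E G) in
/-- The differential at `1` of the adjoint representation. -/
def groupAdDeriv : E →L[𝕜] E →L[𝕜] E :=
  mfderiv 𝓘(𝕜, E) 𝓘(𝕜, E →L[𝕜] E) (groupAd 𝕜 E : G → E →L[𝕜] E) 1

variable {n m : WithTop ℕ∞} [LieGroup 𝓘(𝕜, E) n G]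

theorem contMDiff_conj (g : G) :
    ContMDiff 𝓘(𝕜, E) 𝓘(𝕜, E) n (fun x : G => g * x * g⁻¹) :=
  (contMDiff_mul_right (I := 𝓘(𝕜, E)) (a := g⁻¹)).comp (contMDiff_mul_left (I := 𝓘(𝕜, E)) (a := g))

omit [LieGroup 𝓘(𝕜, E) n G] in
variable (n) in
theorem hasMFDerivAt_conj [LieGroup 𝓘(𝕜, E) n G] (hn : n ≠ 0) (g : G) :
    HasMFDerivAt 𝓘(𝕜, E) 𝓘(𝕜, E) (fun x : G => g * x * g⁻¹) 1 (groupAd 𝕜 E g) :=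
  ((contMDiff_conj (n := n) g).mdifferentiableAt hn).hasMFDerivAt

omit [LieGroup 𝓘(𝕜, E) n G] in
variable (n) in
theorem contMDiff_groupAd [LieGroup 𝓘(𝕜, E) n G] (hmn : m + 1 ≤ n) :
    ContMDiff 𝓘(𝕜, E) 𝓘(𝕜, E →L[𝕜] E) m (groupAd 𝕜 E : G → E →L[𝕜] E) := by
  have : LieGroup 𝓘(𝕜, E) 1 G := LieGroup.of_le (le_trans (by simp) hmn)
  intro g₀
  have h1 : ContMDiffAt (𝓘(𝕜, E).prod 𝓘(𝕜, E)) 𝓘(𝕜, E) n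
      (Function.uncurry fun (g : G) (x : G) => g * x * g⁻¹) (g₀, 1) := by
    have := ((contMDiff_fst (I := 𝓘(𝕜, E)) (J := 𝓘(𝕜, E)) (M := G) (N := G) (n := n)).mul
      contMDiff_snd).mul (contMDiff_fst (I := 𝓘(𝕜, E)) (J := 𝓘(𝕜, E)) (M := G) (N := G)).inv
    exact this.contMDiffAt
  have h2 := ContMDiffAt.mfderiv (fun (g : G) (x : G) => g * x * g⁻¹) (fun _ => 1) h1
    (contMDiffAt_const (n := m)) hmn
  refine h2.congr_of_eventuallyEq (Filter.Eventually.of_forall fun g => ?_)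
  have e : ∀ g : G, g * 1 * g⁻¹ = 1 := fun g => by simp
  exact (inTangentCoordinates_of_eq (N := G) (f := fun _ => (1 : G)) (g := fun g => g * 1 * g⁻¹)
    (groupAd 𝕜 E) g₀ g rfl ((e g).trans (e g₀).symm)).symm

omit [LieGroup 𝓘(𝕜, E) n G] in
variable (n) in
theorem groupAd_mul [LieGroup 𝓘(𝕜, E) n G] (hn : n ≠ 0) (g h : G) :
    groupAd 𝕜 E (g * h) = (groupAd 𝕜 E g).comp (groupAd 𝕜 E h) := by
  have h1 : HasMFDerivAt 𝓘(𝕜, E) 𝓘(𝕜, E) (fun x : G => g * x * g⁻¹) (h * 1 * h⁻¹)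
      (groupAd 𝕜 E g) := by
    have e : h * 1 * h⁻¹ = 1 := by simp
    rw [e]; exact hasMFDerivAt_conj n hn g
  have h2 := HasMFDerivAt.comp (1 : G) (f := fun x : G => h * x * h⁻¹) h1
    (hasMFDerivAt_conj n hn h)
  have e : (fun x : G => g * x * g⁻¹) ∘ (fun x : G => h * x * h⁻¹)
      = fun x : G => g * h * x * (g * h)⁻¹ := by
    funext x; simp [mul_assoc]
  rw [e] at h2
  exact h2.mfderiv

omit [LieGroup 𝓘(𝕜, E) n G] in
theorem groupAd_one : groupAd 𝕜 E (1 : G) = ContinuousLinearMap.id 𝕜 E := by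
  have e : (fun x : G => 1 * x * 1⁻¹) = id := by funext x; simp
  rw [groupAd, e, mfderiv_id]
  rfl

end AdjointRepresentation

/-! ### `Ad ∘ exp = exp ∘ ad` for the complex group. -/

section ComplexAdjoint

variable {F : Type*} [NormedAddCommGroup F] [NormedSpace ℂ F]
  {GC : Type*} [TopologicalSpace GC] [ChartedSpace F GC] [Group GC] [LieGroup 𝓘(ℂ, F) ω GC]

theorem hasMFDerivAt_groupAd_one :
    HasMFDerivAt 𝓘(ℂ, F) 𝓘(ℂ, F →L[ℂ] F) (groupAd ℂ F : GC → F →L[ℂ] F) 1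
      (groupAdDeriv ℂ F GC) :=
  ((contMDiff_groupAd (m := 1) ω le_top).mdifferentiableAt (by simp)).hasMFDerivAt

theorem groupAd_inv_mul_cancel (g : GC) :
    (groupAd ℂ F g⁻¹).comp (groupAd ℂ F g) = ContinuousLinearMap.id ℂ F := by
  rw [← groupAd_mul ω (by simp), inv_mul_cancel, groupAd_one]

theorem groupAd_mul_inv_cancel (g : GC) :
    (groupAd ℂ F g).comp (groupAd ℂ F g⁻¹) = ContinuousLinearMap.id ℂ F := by
  rw [← groupAd_mul ω (by simp), mul_inv_cancel, groupAd_one]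

variable {γ : ℝ → GC} {Z : F}

theorem IsOneParameterSubgroup.hasDerivAt_groupAd_zero
    (h : IsOneParameterSubgroup (E := F) γ Z) :
    HasDerivAt (fun t => groupAd ℂ F (γ t)) (groupAdDeriv ℂ F GC Z) 0 := by
  have h1 := (hasMFDerivAt_groupAd_one (F := F) (GC := GC)).complexToReal (I' := 𝓘(ℝ, F)) rfl rfl
  rw [← h.map_zero] at h1
  have h2 : HasFDerivAt (fun t => groupAd ℂ F (γ t))
      (((groupAdDeriv ℂ F GC).restrictScalars ℝ).comp (ContinuousLinearMap.toSpanSingleton ℝ Z)) 0 :=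
    (HasMFDerivAt.comp (0 : ℝ) h1 h.2).hasFDerivAt
  simpa using h2.hasDerivAt

/-- Along `γ` the operator satisfies the linear equation `A' = A D`, so its product with `exp(-tD)`
is constant. -/
theorem IsOneParameterSubgroup.groupAd_eq_exp [CompleteSpace F]
    (h : IsOneParameterSubgroup (E := F) γ Z) (t : ℝ) :
    groupAd ℂ F (γ t) = NormedSpace.exp (t • groupAdDeriv ℂ F GC Z) := by
  set D := groupAdDeriv ℂ F GC Z with hD
  have hA : ∀ s, HasDerivAt (fun t => groupAd ℂ F (γ t)) (groupAd ℂ F (γ s) * D) s := by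
    intro s
    have e : (fun t => groupAd ℂ F (γ t)) = fun t => groupAd ℂ F (γ s) * groupAd ℂ F (γ (t - s)) := by
      funext t
      have : γ t = γ s * γ (t - s) := by rw [← h.1]; simp
      rw [this, groupAd_mul ω (by simp)]
      rfl
    rw [e]
    have h1 : HasDerivAt (fun t => groupAd ℂ F (γ (t - s))) D s := by
      have := h.hasDerivAt_groupAd_zero
      rw [← sub_self s] at this
      exact this.comp_sub_const s s
    exact h1.const_mul _
  have hE : ∀ s : ℝ, HasDerivAt (fun t : ℝ => NormedSpace.exp (t • (-D)))
      (-D * NormedSpace.exp (s • (-D))) s := fun s => hasDerivAt_exp_smul_const' (𝕂 := ℝ) (-D) s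
  have hc : ∀ s, groupAd ℂ F (γ s) * NormedSpace.exp (s • (-D)) = 1 := by
    intro s
    have h0 : groupAd ℂ F (γ 0) * NormedSpace.exp ((0 : ℝ) • (-D)) = 1 := by
      rw [h.map_zero, groupAd_one, zero_smul, NormedSpace.exp_zero, mul_one]; rfl
    rw [← h0]
    refine is_const_of_deriv_eq_zero (f := fun s => groupAd ℂ F (γ s) * NormedSpace.exp (s • (-D)))
      (fun s => ((hA s).mul (hE s)).differentiableAt) (fun s => ?_) s 0
    refine ((hA s).mul (hE s)).deriv.trans ?_
    simp [mul_assoc]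
  have h3 := hc t
  have h4 : NormedSpace.exp (t • (-D)) * NormedSpace.exp (t • D) = 1 := by
    let _ : NormedAlgebra ℚ (F →L[ℂ] F) := NormedAlgebra.restrictScalars ℚ ℂ _
    rw [← NormedSpace.exp_add_of_commute, smul_neg, neg_add_cancel, NormedSpace.exp_zero]
    exact (((Commute.refl D).neg_left).smul_left t).smul_right t
  calc groupAd ℂ F (γ t) = groupAd ℂ F (γ t) * (NormedSpace.exp (t • (-D)) * NormedSpace.exp (t • D)) := by
        rw [h4, mul_one]
    _ = _ := by rw [← mul_assoc, h3, one_mul]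

theorem IsOneParameterSubgroup.conj (h : IsOneParameterSubgroup (E := F) γ Z) (g : GC) :
    IsOneParameterSubgroup (E := F) (fun t => g * γ t * g⁻¹) (groupAd ℂ F g Z) := by
  refine ⟨fun s t => by simp [h.1, mul_assoc], ?_⟩
  have h1 := (hasMFDerivAt_conj (𝕜 := ℂ) (E := F) ω (by simp) g).complexToReal
    (I' := 𝓘(ℝ, F)) rfl rfl
  rw [← h.map_zero] at h1
  refine (HasMFDerivAt.comp (0 : ℝ) h1 h.2).congr_mfderiv (ContinuousLinearMap.ext fun (r : ℝ) => ?_)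
  exact ((groupAd ℂ F g).restrictScalars ℝ).map_smul r Z

variable [T2Space GC]

theorem exists_isOneParameterSubgroup_complex [CompleteSpace F] (Z : F) :
    ∃ γ : ℝ → GC, IsOneParameterSubgroup (E := F) γ Z := by
  have := LieGroup.complexToReal (F := F) (GC := GC) (n := ω) (m := ∞) le_top
  exact exists_isOneParameterSubgroup (G := GC) Z

theorem IsOneParameterSubgroup.complexLieExp_smul (h : IsOneParameterSubgroup (E := F) γ Z) (t : ℝ) :
    complexLieExp (F := F) (GC := GC) (t • Z : F) = γ t := by
  have := LieGroup.complexToReal (F := F) (GC := GC) (n := ω) (m := ∞) le_top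
  exact h.lieExp_smul t

theorem IsOneParameterSubgroup.complexLieExp_eq (h : IsOneParameterSubgroup (E := F) γ Z) :
    complexLieExp (F := F) (GC := GC) Z = γ 1 := by
  have := h.complexLieExp_smul 1
  rwa [one_smul] at this

variable [CompleteSpace F]

theorem groupAd_complexLieExp (Z : F) :
    groupAd ℂ F (complexLieExp (F := F) (GC := GC) Z) = NormedSpace.exp (groupAdDeriv ℂ F GC Z) := by
  obtain ⟨γ, h⟩ := exists_isOneParameterSubgroup_complex (GC := GC) Z
  rw [h.complexLieExp_eq, h.groupAd_eq_exp, one_smul]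

theorem groupAdDeriv_groupAd (g : GC) (Z : F) :
    groupAdDeriv ℂ F GC (groupAd ℂ F g Z)
      = (groupAd ℂ F g).comp ((groupAdDeriv ℂ F GC Z).comp (groupAd ℂ F g⁻¹)) := by
  obtain ⟨γ, h⟩ := exists_isOneParameterSubgroup_complex (GC := GC) Z
  have h1 := (h.conj g).hasDerivAt_groupAd_zero
  have h2 : HasDerivAt (fun t => groupAd ℂ F g * (groupAd ℂ F (γ t) * groupAd ℂ F g⁻¹)) _ 0 :=
    (h.hasDerivAt_groupAd_zero.mul_const (groupAd ℂ F g⁻¹)).const_mul (groupAd ℂ F g)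
  refine (h1.unique (h2.congr_of_eventuallyEq (Filter.Eventually.of_forall fun t => ?_)))
  change groupAd ℂ F (g * γ t * g⁻¹) = _
  rw [mul_assoc, groupAd_mul ω (by simp), groupAd_mul ω (by simp)]
  rfl

/-- `Ad(g)` is an automorphism of the bracket `groupAdDeriv`; this follows by differentiating `Ad(g
γ(t) g⁻¹)`. -/
theorem groupAd_groupAdDeriv_apply (g : GC) (Z W : F) :
    groupAd ℂ F g (groupAdDeriv ℂ F GC Z W)
      = groupAdDeriv ℂ F GC (groupAd ℂ F g Z) (groupAd ℂ F g W) := by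
  rw [groupAdDeriv_groupAd]
  have := DFunLike.congr_fun (groupAd_inv_mul_cancel (F := F) g) W
  simp only [ContinuousLinearMap.comp_apply, ContinuousLinearMap.id_apply] at this ⊢
  rw [this]

end ComplexAdjoint

/-! ### Naturality of `Ad` and `ad` under a homomorphism. -/

section Naturality

variable {E : Type*} [NormedAddCommGroup E] [NormedSpace ℝ E]
  {G : Type*} [TopologicalSpace G] [ChartedSpace E G] [Group G] [LieGroup 𝓘(ℝ, E) ∞ G]
  {F : Type*} [NormedAddCommGroup F] [NormedSpace ℂ F]
  {GC : Type*} [TopologicalSpace GC] [ChartedSpace F GC] [Group GC] [LieGroup 𝓘(ℂ, F) ω GC]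
  {ι : G →* GC}

variable (E F) in
/-- The differential at `1` of a homomorphism, as a continuous linear map. -/
def homDeriv (ι : G →* GC) : E →L[ℝ] F := mfderiv 𝓘(ℝ, E) 𝓘(ℝ, F) ι 1

omit [LieGroup 𝓘(ℝ, E) ∞ G] [LieGroup 𝓘(ℂ, F) ω GC] in
theorem hasMFDerivAt_homDeriv (hι : ContMDiff 𝓘(ℝ, E) 𝓘(ℝ, F) ∞ ι) :
    HasMFDerivAt 𝓘(ℝ, E) 𝓘(ℝ, F) ι 1 (homDeriv E F ι) :=
  (hι.mdifferentiableAt (by simp)).hasMFDerivAt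

theorem homDeriv_groupAd (hι : ContMDiff 𝓘(ℝ, E) 𝓘(ℝ, F) ∞ ι) (g : G) (X : E) :
    homDeriv E F ι (groupAd ℝ E g X) = groupAd ℂ F (ι g) (homDeriv E F ι X) := by
  have h1 := hasMFDerivAt_conj (𝕜 := ℝ) (E := E) ∞ (by simp) g
  have h2 := (hasMFDerivAt_conj (𝕜 := ℂ) (E := F) ω (by simp) (ι g)).complexToReal
    (I' := 𝓘(ℝ, F)) rfl rfl
  have h3 := hasMFDerivAt_homDeriv (E := E) (F := F) hι
  have h4 : HasMFDerivAt 𝓘(ℝ, E) 𝓘(ℝ, F) ι (g * 1 * g⁻¹) (homDeriv E F ι) := by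
    have e : g * 1 * g⁻¹ = 1 := by simp
    rw [e]; exact h3
  rw [← map_one ι] at h2
  have h5 := HasMFDerivAt.comp (1 : G) (f := fun x : G => g * x * g⁻¹) h4 h1
  have h6 := HasMFDerivAt.comp (1 : G) h2 h3
  have e : (ι : G → GC) ∘ (fun x => g * x * g⁻¹) = (fun x => ι g * x * (ι g)⁻¹) ∘ ι := by
    funext x; simp
  rw [e] at h5
  exact DFunLike.congr_fun (hasMFDerivAt_unique h5 h6) X

/-- Differentiating `dι(Ad(g) X) = Ad(ι g) dι(X)` at `g = 1`. Once `groupAdDeriv` is known to be the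
bracket, `dι` becomes a Lie algebra homomorphism. -/
theorem homDeriv_groupAdDeriv (hι : ContMDiff 𝓘(ℝ, E) 𝓘(ℝ, F) ∞ ι) (Y X : E) :
    homDeriv E F ι (groupAdDeriv ℝ E G Y X)
      = groupAdDeriv ℂ F GC (homDeriv E F ι Y) (homDeriv E F ι X) := by
  have h1 : HasMFDerivAt 𝓘(ℝ, E) 𝓘(ℝ, E →L[ℝ] E) (groupAd ℝ E : G → E →L[ℝ] E) 1
      (groupAdDeriv ℝ E G) :=
    ((contMDiff_groupAd (m := 1) ∞ (by norm_num; exact ENat.LEInfty.out)).mdifferentiableAt (by simp)).hasMFDerivAt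
  have h2 := (hasMFDerivAt_groupAd_one (F := F) (GC := GC)).complexToReal (I' := 𝓘(ℝ, F)) rfl rfl
  rw [← map_one ι] at h2
  have h3 := HasMFDerivAt.comp (1 : G) h2 (hasMFDerivAt_homDeriv (E := E) (F := F) hι)
  let e1 : (E →L[ℝ] E) →L[ℝ] F :=
    (homDeriv E F ι).comp (ContinuousLinearMap.apply ℝ E X)
  let e2 : (F →L[ℂ] F) →L[ℝ] F :=
    (ContinuousLinearMap.apply ℂ F (homDeriv E F ι X)).restrictScalars ℝ
  have h4 := HasMFDerivAt.comp (1 : G) (e1.hasFDerivAt.hasMFDerivAt) h1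
  have h5 := HasMFDerivAt.comp (1 : G) (e2.hasFDerivAt.hasMFDerivAt) h3
  have e : e1 ∘ (groupAd ℝ E : G → E →L[ℝ] E) = e2 ∘ ((groupAd ℂ F : GC → F →L[ℂ] F) ∘ ι) := by
    funext g
    exact homDeriv_groupAd hι g X
  rw [e] at h4
  exact DFunLike.congr_fun (hasMFDerivAt_unique h4 h5) Y

omit [LieGroup 𝓘(ℝ, E) ∞ G] [LieGroup 𝓘(ℂ, F) ω GC] in
theorem IsOneParameterSubgroup.map {γ : ℝ → G} {Y : E} (h : IsOneParameterSubgroup (E := E) γ Y)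
    (hι : ContMDiff 𝓘(ℝ, E) 𝓘(ℝ, F) ∞ ι) :
    IsOneParameterSubgroup (E := F) (fun t => ι (γ t)) (homDeriv E F ι Y) := by
  refine ⟨fun s t => by simp [h.1], ?_⟩
  have h1 := hasMFDerivAt_homDeriv (E := E) (F := F) hι
  rw [← h.map_zero] at h1
  refine (HasMFDerivAt.comp (0 : ℝ) h1 h.2).congr_mfderiv (ContinuousLinearMap.ext fun (r : ℝ) => ?_)
  exact (homDeriv E F ι).map_smul r Y

end Naturality

/-! ### The bracket of left invariant fields is the differential of `Ad`. -/

section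
open scoped Topology

section BracketAdjoint

variable {E : Type*} [NormedAddCommGroup E] [NormedSpace ℝ E]
  {G : Type*} [TopologicalSpace G] [ChartedSpace E G] [Group G] [LieGroup 𝓘(ℝ, E) ∞ G]

variable (E G) in
/-- The multiplication of a Lie group, read in the preferred chart at `1`. -/
def mulInChart (p : E × E) : E :=
  extChartAt 𝓘(ℝ, E) (1 : G) ((extChartAt 𝓘(ℝ, E) (1 : G)).symm p.1 *
    (extChartAt 𝓘(ℝ, E) (1 : G)).symm p.2)

local notation "φ" => extChartAt 𝓘(ℝ, E) (1 : G)
local notation "u₀" => extChartAt 𝓘(ℝ, E) (1 : G) (1 : G)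

omit [Group G] [LieGroup 𝓘(ℝ, E) ∞ G] in
theorem hasMFDerivAt_extChartAt_symm_self [IsManifold 𝓘(ℝ, E) 1 G] (x : G) :
    HasMFDerivAt 𝓘(ℝ, E) 𝓘(ℝ, E) (extChartAt 𝓘(ℝ, E) x).symm (extChartAt 𝓘(ℝ, E) x x)
      (ContinuousLinearMap.id ℝ E) := by
  have h1 := mdifferentiableWithinAt_extChartAt_symm (I := 𝓘(ℝ, E)) (x := x)
    (mem_extChartAt_target x)
  have h2 := mfderivWithin_range_extChartAt_symm (I := 𝓘(ℝ, E)) (x := x)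
  have h3 := h1.hasMFDerivWithinAt
  rw [h2] at h3
  exact h3.hasMFDerivAt (by rw [ModelWithCorners.range_eq_univ]; exact Filter.univ_mem)

omit [LieGroup 𝓘(ℝ, E) ∞ G] in
theorem extChartAt_symm_chart_one : (φ).symm u₀ = 1 := extChartAt_to_inv 1

theorem contDiffAt_mulInChart {u v : E} (hu : u ∈ (φ).target) (hv : v ∈ (φ).target)
    (huv : (φ).symm u * (φ).symm v ∈ (φ).source) : ContDiffAt ℝ ∞ (mulInChart E G) (u, v) := by
  rw [← contMDiffAt_iff_contDiffAt]
  have h1 : ∀ w ∈ (φ).target, ContMDiffAt 𝓘(ℝ, E) 𝓘(ℝ, E) ∞ (φ).symm w := fun w hw =>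
    (contMDiffOn_extChartAt_symm (1 : G)).contMDiffAt
      ((isOpen_extChartAt_target (1 : G)).mem_nhds hw)
  have h2 : ContMDiffAt 𝓘(ℝ, E × E) 𝓘(ℝ, E) ∞
      (fun p : E × E => (φ).symm p.1 * (φ).symm p.2) (u, v) :=
    ((h1 u hu).comp (u, v) contDiff_fst.contMDiff.contMDiffAt).mul
      ((h1 v hv).comp (u, v) contDiff_snd.contMDiff.contMDiffAt)
  have h3 : ContMDiffAt 𝓘(ℝ, E) 𝓘(ℝ, E) ∞ φ ((φ).symm u * (φ).symm v) :=
    contMDiffAt_extChartAt' (by simpa using huv)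
  exact h3.comp (u, v) h2

theorem contDiffAt_mulInChart_one : ContDiffAt ℝ ∞ (mulInChart E G) (u₀, u₀) :=
  contDiffAt_mulInChart (mem_extChartAt_target _) (mem_extChartAt_target _)
    (by rw [extChartAt_symm_chart_one, one_mul]; exact mem_extChartAt_source _)

/-- In the chart the left invariant field is the partial derivative of the multiplication in its
second variable, at the unit. -/
theorem mpullbackWithin_mulInvariantVectorField_eq X {u : E}
    (hu : u ∈ (φ).target) :
    VectorField.mpullbackWithin 𝓘(ℝ, E) 𝓘(ℝ, E) (φ).symm
      (mulInvariantVectorField (I := 𝓘(ℝ, E)) (G := G) X)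
      (Set.range 𝓘(ℝ, E)) u = fderiv ℝ (mulInChart E G) (u, u₀) (0, X) := by
  have : LieGroup 𝓘(ℝ, E) 1 G := LieGroup.of_le (n := ∞) (by simp)
  have hg : (φ).symm u ∈ (φ).source := (φ).map_target hu
  rw [VectorField.mpullbackWithin_apply, ContinuousLinearMap.inverse_eq
    (mfderivWithin_extChartAt_symm_comp_mfderiv_extChartAt hu)
    (mfderiv_extChartAt_comp_mfderivWithin_extChartAt_symm hu)]
  have h1 : HasMFDerivAt 𝓘(ℝ, E) 𝓘(ℝ, E) (fun x => (φ).symm u * x) ((φ).symm u₀)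
      (mfderiv 𝓘(ℝ, E) 𝓘(ℝ, E) (fun x => (φ).symm u * x) (1 : G)) := by
    rw [extChartAt_symm_chart_one]
    exact ((contMDiff_mul_left (I := 𝓘(ℝ, E)) (n := ∞)).mdifferentiableAt (by simp)).hasMFDerivAt
  have h2 : HasMFDerivAt 𝓘(ℝ, E) 𝓘(ℝ, E) φ ((φ).symm u)
      (mfderiv 𝓘(ℝ, E) 𝓘(ℝ, E) φ ((φ).symm u)) :=
    (mdifferentiableAt_extChartAt (by simpa using hg)).hasMFDerivAt
  have e : (φ).symm u = (φ).symm u * (φ).symm u₀ := by rw [extChartAt_symm_chart_one, mul_one]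
  have h2' : HasMFDerivAt 𝓘(ℝ, E) 𝓘(ℝ, E) φ ((φ).symm u * (φ).symm u₀)
      (mfderiv 𝓘(ℝ, E) 𝓘(ℝ, E) φ ((φ).symm u)) := by
    rw [← e]; exact h2
  let A₁ : E →L[ℝ] E := mfderiv 𝓘(ℝ, E) 𝓘(ℝ, E) φ ((φ).symm u)
  let A₂ : E →L[ℝ] E := mfderiv 𝓘(ℝ, E) 𝓘(ℝ, E) (fun x => (φ).symm u * x) (1 : G)
  have h3 : HasFDerivAt (fun v => mulInChart E G (u, v))
      (A₁.comp (A₂.comp (ContinuousLinearMap.id ℝ E))) u₀ :=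
    (HasMFDerivAt.comp u₀ h2' (HasMFDerivAt.comp u₀ h1
      (hasMFDerivAt_extChartAt_symm_self (1 : G)))).hasFDerivAt
  have h4 : HasFDerivAt (fun v => mulInChart E G (u, v)) _ u₀ :=
    ((contDiffAt_mulInChart hu (mem_extChartAt_target (1 : G))
      (e ▸ hg)).differentiableAt (by simp)).hasFDerivAt.comp u₀ (hasFDerivAt_prodMk_right u u₀)
  exact DFunLike.congr_fun (h3.unique h4) X

/-- The identity `g x = (g x g⁻¹) g`, differentiated in `x` at `1`. -/
theorem fderiv_mulInChart_inr_eq X :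
    ∀ᶠ u in 𝓝 u₀, fderiv ℝ (mulInChart E G) (u, u₀) (0, X)
      = fderiv ℝ (mulInChart E G) (u₀, u) (groupAd ℝ E ((φ).symm u) X, 0) := by
  have : LieGroup 𝓘(ℝ, E) 1 G := LieGroup.of_le (n := ∞) (by simp)
  filter_upwards [(isOpen_extChartAt_target (I := 𝓘(ℝ, E)) (1 : G)).mem_nhds
    (mem_extChartAt_target (1 : G))] with u hu
  set g := (φ).symm u with hg
  have hgs : g ∈ (φ).source := (φ).map_target hu
  have h1 := hasMFDerivAt_conj (𝕜 := ℝ) (E := E) ∞ (by simp) g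
  have e1 : g * 1 * g⁻¹ = 1 := by simp
  have e0 : (φ).symm u₀ = 1 := extChartAt_symm_chart_one
  have h2 : HasMFDerivAt 𝓘(ℝ, E) 𝓘(ℝ, E) φ (g * (φ).symm u₀ * g⁻¹) (ContinuousLinearMap.id ℝ E) := by
    rw [e0, e1]
    exact (mdifferentiableAt_extChartAt (mem_chart_source _ _)).hasMFDerivAt.congr_mfderiv
      (mfderiv_extChartAt_self (I := 𝓘(ℝ, E)) (x := (1 : G)))
  have h1' : HasMFDerivAt 𝓘(ℝ, E) 𝓘(ℝ, E) (fun x : G => g * x * g⁻¹) ((φ).symm u₀)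
      (groupAd ℝ E g) := by rw [e0]; exact h1
  have h3 : HasFDerivAt (fun v => φ (g * (φ).symm v * g⁻¹)) (groupAd ℝ E g) u₀ :=
    (HasMFDerivAt.comp (f := fun v => g * (φ).symm v * g⁻¹) u₀ h2 (HasMFDerivAt.comp u₀ h1'
      (hasMFDerivAt_extChartAt_symm_self (1 : G)))).hasFDerivAt
  have e2 : φ (g * (φ).symm u₀ * g⁻¹) = u₀ := by rw [e0, e1]
  have h4 : HasFDerivAt (fun v => mulInChart E G (φ (g * (φ).symm v * g⁻¹), u))
      ((fderiv ℝ (mulInChart E G) (u₀, u)).comp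
        ((groupAd ℝ E g).prod (0 : E →L[ℝ] E))) u₀ := by
    have h5 := ((contDiffAt_mulInChart (mem_extChartAt_target (1 : G)) hu
      (by rw [e0, one_mul]; exact hgs)).differentiableAt (by simp)).hasFDerivAt
    have h5' : HasFDerivAt (mulInChart E G) (fderiv ℝ (mulInChart E G) (u₀, u))
        (φ (g * (φ).symm u₀ * g⁻¹), u) := by rw [e2]; exact h5
    exact HasFDerivAt.comp (f := fun v => (φ (g * (φ).symm v * g⁻¹), u)) u₀ h5'
      (h3.prodMk (hasFDerivAt_const u u₀))
  have h6 : HasFDerivAt (fun v => mulInChart E G (u, v)) _ u₀ :=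
    ((contDiffAt_mulInChart hu (mem_extChartAt_target (1 : G))
      (by rw [e0, mul_one]; exact hgs)).differentiableAt (by simp)).hasFDerivAt.comp u₀
        (hasFDerivAt_prodMk_right u u₀)
  have h7 : (fun v => mulInChart E G (φ (g * (φ).symm v * g⁻¹), u))
      =ᶠ[𝓝 u₀] fun v => mulInChart E G (u, v) := by
    have hc : ContinuousAt (fun v => g * (φ).symm v * g⁻¹) u₀ := by
      have := (continuousAt_extChartAt_symm (I := 𝓘(ℝ, E)) (1 : G))
      exact (ContinuousAt.comp (contMDiff_conj (𝕜 := ℝ) (E := E) (n := ∞) g).continuous.continuousAt this)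
    have := hc.preimage_mem_nhds (t := (φ).source) (by
      rw [e0, e1]; exact extChartAt_source_mem_nhds _)
    filter_upwards [this] with v hv
    simp only [mulInChart]
    rw [(φ).left_inv hv, ← hg]
    simp
  have h8 := DFunLike.congr_fun (h6.unique (h4.congr_of_eventuallyEq h7.symm)) X
  simpa using h8

/-- With `D` the second derivative of the multiplication at the unit, the bracket is `D (Y,0) (0,X)
- D (X,0) (0,Y)`. Differentiating `fderiv_mulInChart_inr_eq` along `Y` gives `D (Y,0) (0,X) = D
(0,Y) (X,0) + ad(Y) X`, and symmetry of `D` concludes. -/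
theorem lieBracket_mulInChart_eq_groupAdDeriv (Y X : E) :
    VectorField.lieBracket ℝ (fun u => fderiv ℝ (mulInChart E G) (u, u₀) (0, Y))
      (fun u => fderiv ℝ (mulInChart E G) (u, u₀) (0, X)) u₀ = groupAdDeriv ℝ E G Y X := by
  have : LieGroup 𝓘(ℝ, E) 1 G := LieGroup.of_le (n := ∞) (by simp)
  set m := mulInChart E G with hm
  have hmC : ContDiffAt ℝ ∞ m (u₀, u₀) := contDiffAt_mulInChart_one
  have hsymm : IsSymmSndFDerivAt ℝ m (u₀, u₀) := hmC.isSymmSndFDerivAt (by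
    rw [minSmoothness_of_isRCLikeNormedField]; exact ENat.LEInfty.out)
  have hd2 : HasFDerivAt (fderiv ℝ m) (fderiv ℝ (fderiv ℝ m) (u₀, u₀)) (u₀, u₀) :=
    ((hmC.fderiv_right (m := 1) (by norm_num; exact ENat.LEInfty.out)).differentiableAt
      (by simp)).hasFDerivAt
  set D := fderiv ℝ (fderiv ℝ m) (u₀, u₀) with hD
  -- derivative of the invariant vector fields in the chart
  have hV : ∀ Z : E, HasFDerivAt (fun u => fderiv ℝ m (u, u₀) (0, Z))
      ((ContinuousLinearMap.apply ℝ E ((0 : E), Z)).comp (D.comp (ContinuousLinearMap.inl ℝ E E)))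
      u₀ := fun Z =>
    (ContinuousLinearMap.apply ℝ E ((0 : E), Z)).hasFDerivAt.comp u₀
      (HasFDerivAt.comp (f := fun e => (e, u₀)) u₀ hd2 (hasFDerivAt_prodMk_left u₀ u₀))
  have hV0 : ∀ Z : E, fderiv ℝ m (u₀, u₀) (0, Z) = Z := by
    intro Z
    have h1 : HasFDerivAt (fun v => m (u₀, v)) _ u₀ :=
      (hmC.differentiableAt (by simp)).hasFDerivAt.comp u₀ (hasFDerivAt_prodMk_right u₀ u₀)
    have h2 : (fun v => m (u₀, v)) =ᶠ[𝓝 u₀] id := by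
      filter_upwards [(isOpen_extChartAt_target (I := 𝓘(ℝ, E)) (1 : G)).mem_nhds
        (mem_extChartAt_target (1 : G))] with v hv
      simp only [hm, mulInChart, extChartAt_symm_chart_one, one_mul, id]
      exact (φ).right_inv hv
    exact DFunLike.congr_fun (h1.unique ((hasFDerivAt_id u₀).congr_of_eventuallyEq h2)) Z
  have hR0 : ∀ Z : E, fderiv ℝ m (u₀, u₀) (Z, 0) = Z := by
    intro Z
    have h1 : HasFDerivAt (fun v => m (v, u₀)) _ u₀ :=
      HasFDerivAt.comp (f := fun e => (e, u₀)) u₀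
        (hmC.differentiableAt (by simp)).hasFDerivAt (hasFDerivAt_prodMk_left u₀ u₀)
    have h2 : (fun v => m (v, u₀)) =ᶠ[𝓝 u₀] id := by
      filter_upwards [(isOpen_extChartAt_target (I := 𝓘(ℝ, E)) (1 : G)).mem_nhds
        (mem_extChartAt_target (1 : G))] with v hv
      simp only [hm, mulInChart, extChartAt_symm_chart_one, mul_one, id]
      exact (φ).right_inv hv
    exact DFunLike.congr_fun (h1.unique ((hasFDerivAt_id u₀).congr_of_eventuallyEq h2)) Z
  have hbr : VectorField.lieBracket ℝ (fun u => fderiv ℝ m (u, u₀) (0, Y))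
      (fun u => fderiv ℝ m (u, u₀) (0, X)) u₀ = D (Y, 0) (0, X) - D (X, 0) (0, Y) := by
    rw [VectorField.lieBracket, (hV _).fderiv, (hV _).fderiv, hV0, hV0]
    rfl
  -- the derivative of the adjoint representation, in the chart
  have ha : HasFDerivAt (fun u => groupAd ℝ E ((φ).symm u)) (groupAdDeriv ℝ E G) u₀ := by
    have h1 : HasMFDerivAt 𝓘(ℝ, E) 𝓘(ℝ, E →L[ℝ] E) (groupAd ℝ E : G → E →L[ℝ] E) ((φ).symm u₀)
        (groupAdDeriv ℝ E G) := by
      rw [extChartAt_symm_chart_one]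
      exact ((contMDiff_groupAd (m := 1) ∞
        (by norm_num; exact ENat.LEInfty.out)).mdifferentiableAt (by simp)).hasMFDerivAt
    exact (HasMFDerivAt.comp u₀ h1 (hasMFDerivAt_extChartAt_symm_self (1 : G))).hasFDerivAt
  have hrhs := (hd2.comp u₀ (hasFDerivAt_prodMk_right u₀ u₀)).clm_apply
    (((ContinuousLinearMap.inl ℝ E E).comp (ContinuousLinearMap.apply ℝ E X)).hasFDerivAt.comp
      u₀ ha)
  have h9 := DFunLike.congr_fun ((hV X).unique
    (hrhs.congr_of_eventuallyEq (fderiv_mulInChart_inr_eq X))) Y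
  have e1 : groupAd ℝ E ((φ).symm u₀) = ContinuousLinearMap.id ℝ E := by
    rw [extChartAt_symm_chart_one, groupAd_one]
  simp only [ContinuousLinearMap.comp_apply, add_apply,
    ContinuousLinearMap.apply_apply, ContinuousLinearMap.inl_apply, ContinuousLinearMap.inr_apply,
    ContinuousLinearMap.flip_apply, Function.comp_apply, e1, hR0,
    ContinuousLinearMap.id_apply] at h9
  rw [hbr, hsymm.eq (X, 0) (0, Y), h9, hD, add_sub_cancel_right]

theorem bracket_eq_groupAdDeriv [CompleteSpace E] (Y X : GroupLieAlgebra 𝓘(ℝ, E) G) :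
    ⁅Y, X⁆ = groupAdDeriv ℝ E G Y X := by
  have : LieGroup 𝓘(ℝ, E) 1 G := LieGroup.of_le (n := ∞) (by simp)
  refine Eq.trans ?_ (lieBracket_mulInChart_eq_groupAdDeriv (E := E) (G := G) Y X)
  rw [GroupLieAlgebra.bracket_def, VectorField.mlieBracket,
    VectorField.mlieBracketWithin_apply, mfderiv_extChartAt_self]
  have hev : ∀ Z : E, VectorField.mpullbackWithin 𝓘(ℝ, E) 𝓘(ℝ, E) (φ).symm
      (mulInvariantVectorField (I := 𝓘(ℝ, E)) (G := G) Z) (Set.range 𝓘(ℝ, E))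
        =ᶠ[𝓝 u₀] fun u => fderiv ℝ (mulInChart E G) (u, u₀) (0, Z) := by
    intro Z
    filter_upwards [(isOpen_extChartAt_target (I := 𝓘(ℝ, E)) (1 : G)).mem_nhds
      (mem_extChartAt_target (1 : G))] with u hu
    exact mpullbackWithin_mulInvariantVectorField_eq Z hu
  have key : VectorField.lieBracketWithin ℝ (E := E)
      (VectorField.mpullbackWithin 𝓘(ℝ, E) 𝓘(ℝ, E) (φ).symm
        (mulInvariantVectorField (I := 𝓘(ℝ, E)) (G := G) Y) (Set.range 𝓘(ℝ, E)))
      (VectorField.mpullbackWithin 𝓘(ℝ, E) 𝓘(ℝ, E) (φ).symm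
        (mulInvariantVectorField (I := 𝓘(ℝ, E)) (G := G) X) (Set.range 𝓘(ℝ, E)))
      ((φ).symm ⁻¹' Set.univ ∩ Set.range 𝓘(ℝ, E)) u₀
      = VectorField.lieBracket ℝ (E := E) (fun u => fderiv ℝ (mulInChart E G) (u, u₀) ((0 : E), Y))
        (fun u => fderiv ℝ (mulInChart E G) (u, u₀) ((0 : E), X)) u₀ := by
    refine ((hev Y).lieBracketWithin_vectorField_eq_nhds (hev X)).trans ?_
    rw [ModelWithCorners.range_eq_univ, Set.preimage_univ, Set.univ_inter,
      VectorField.lieBracketWithin_univ]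
  exact (DFunLike.congr_fun (ContinuousLinearMap.inverse_id (R := ℝ) (M := E)) _).trans key

end BracketAdjoint

end

/-! ### Cartan involutions: diagonalization of `ad 𝔞`, and a criterion from simplicity. -/

section CartanInvolution

variable {L : Type*} [LieRing L] [LieAlgebra ℝ L]

theorem mem_fixedSubalgebra {τ : L ≃ₗ⁅ℝ⁆ L} {Y : L} : Y ∈ fixedSubalgebra τ ↔ τ Y = Y := Iff.rfl

theorem mem_cartanP {θ : L ≃ₗ⁅ℝ⁆ L} {Y : L} : Y ∈ cartanP θ ↔ θ Y = -Y := Iff.rfl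

theorem killingForm_lie_of_mem_cartanP {θ : L ≃ₗ⁅ℝ⁆ L} {H : L} (hH : H ∈ cartanP θ) (X Y : L) :
    -killingForm ℝ L ⁅H, X⁆ (θ Y) = -killingForm ℝ L X (θ ⁅H, Y⁆) := by
  rw [mem_cartanP] at hH
  rw [LieEquiv.map_lie, hH, neg_lie, map_neg, ← neg_eq_iff_eq_neg, neg_neg]
  exact (LieModule.traceForm_apply_lie_apply' ℝ L L H X (θ Y)).symm ▸ by simp [killingForm]

namespace IsCartanInvolution

variable {θ : L ≃ₗ⁅ℝ⁆ L}

theorem eq_zero_of_killingForm_eq_zero (hθ : IsCartanInvolution θ) {Y : L}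
    (h : ∀ X, killingForm ℝ L Y X = 0) : Y = 0 := by
  by_contra hY
  have := hθ.2 Y hY
  rw [h, neg_zero] at this
  exact lt_irrefl _ this

theorem eq_zero_of_forall_lie_eq_zero (hθ : IsCartanInvolution θ) {Y : L}
    (h : ∀ X : L, ⁅Y, X⁆ = 0) : Y = 0 := by
  apply hθ.eq_zero_of_killingForm_eq_zero
  intro X
  have : LieAlgebra.ad ℝ L Y = 0 := by ext X; simp [h]
  rw [killingForm_apply_apply, this]
  simp

/-- The inner product `-κ(X, θ Y)` attached to a Cartan involution. -/
abbrev innerCore (hθ : IsCartanInvolution θ) : InnerProductSpace.Core ℝ L where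
  inner X Y := -killingForm ℝ L X (θ Y)
  conj_inner_symm X Y := by
    have h := LieAlgebra.killingForm_of_equiv_apply (R := ℝ) θ Y (θ X)
    rw [hθ.1] at h
    simp only [conj_trivial]
    rw [← h]
    exact congrArg Neg.neg (LieModule.traceForm_comm ℝ L L _ _)
  re_inner_nonneg X := by
    by_cases h : X = 0
    · simp [h]
    · exact (hθ.2 X h).le
  add_left X Y Z := by simp [add_comm]
  smul_left X Y r := by simp
  definite X h := by
    by_contra hX
    exact (hθ.2 X hX).ne' h

/-- The operators `ad H`, for `H` in `𝔞`, commute and are symmetric for the inner product `-κ(X,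
θY)`, so they are simultaneously diagonalizable. -/
theorem iSup_iInf_eigenspace_ad [FiniteDimensional ℝ L] (hθ : IsCartanInvolution θ)
    {𝔞 : Submodule ℝ L} (h𝔞 : 𝔞 ≤ cartanP θ) (hab : ∀ X ∈ 𝔞, ∀ Y ∈ 𝔞, ⁅X, Y⁆ = 0) :
    ⨆ χ : 𝔞 → ℝ, ⨅ H : 𝔞, Module.End.eigenspace (LieAlgebra.ad ℝ L (H : L)) (χ H) = ⊤ := by
  have hcomm : ∀ H H' : 𝔞, ∀ X : L, ⁅(H : L), ⁅(H' : L), X⁆⁆ = ⁅(H' : L), ⁅(H : L), X⁆⁆ := by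
    intro H H' X
    rw [leibniz_lie, hab _ H.2 _ H'.2, zero_lie, zero_add]
  let : NormedAddCommGroup L := hθ.innerCore.toNormedAddCommGroup
  let : InnerProductSpace ℝ L := InnerProductSpace.ofCore hθ.innerCore.toCore
  refine LinearMap.IsSymmetric.iSup_iInf_eq_top_of_commute
    (T := fun H : 𝔞 => LieAlgebra.ad ℝ L (H : L)) (fun H X Y => ?_) (fun H H' _ => ?_)
  · exact killingForm_lie_of_mem_cartanP (h𝔞 H.2) X Y
  · exact LinearMap.ext fun X => hcomm H H' X

theorem iSup_eigenspace_ad_int [FiniteDimensional ℝ L] (hθ : IsCartanInvolution θ)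
    {𝔞 : Submodule ℝ L} (h𝔞 : 𝔞 ≤ cartanP θ) (hab : ∀ X ∈ 𝔞, ∀ Y ∈ 𝔞, ⁅X, Y⁆ = 0)
    {w : 𝔞} (hw : ∀ γ, IsRestrictedRoot 𝔞 γ → ∃ m : ℤ, γ w = m) :
    ⨆ m : ℤ, Module.End.eigenspace (LieAlgebra.ad ℝ L (w : L)) (m : ℝ) = ⊤ := by
  rw [eq_top_iff, ← hθ.iSup_iInf_eigenspace_ad h𝔞 hab, iSup_le_iff]
  intro χ
  by_cases hbot : (⨅ H : 𝔞, Module.End.eigenspace (LieAlgebra.ad ℝ L (H : L)) (χ H)) = ⊥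
  · rw [hbot]; exact bot_le
  obtain ⟨Y, hY, hY0⟩ := Submodule.exists_mem_ne_zero_of_ne_bot hbot
  simp only [Submodule.mem_iInf, Module.End.mem_eigenspace_iff, LieAlgebra.ad_apply] at hY
  -- The eigenvalue function `χ` is linear because a nonzero common eigenvector exists; it is
  -- therefore zero or a restricted root, and integral at `w` in both cases.
  let γ : Module.Dual ℝ 𝔞 :=
    { toFun := χ
      map_add' := fun H H' => smul_left_injective ℝ hY0 (by
        simp only [add_smul, ← hY]
        simp)
      map_smul' := fun r H => smul_left_injective ℝ hY0 (by
        simp only [RingHom.id_apply, smul_eq_mul, mul_smul, ← hY]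
        simp) }
  have hγ : ∃ m : ℤ, χ w = m := by
    by_cases h0 : γ = 0
    · exact ⟨0, by
        rw [Int.cast_zero]; exact DFunLike.congr_fun h0 w⟩
    · exact hw γ ⟨h0, Y, hY0, hY⟩
  obtain ⟨m, hm⟩ := hγ
  exact (iInf_le _ w).trans (hm ▸ le_iSup (fun m : ℤ =>
    Module.End.eigenspace (LieAlgebra.ad ℝ L (w : L)) (m : ℝ)) m)

/-- If a fixed point algebra lies in a `θ`-stable subalgebra which contains an element outside of
it, then this subalgebra is everything. -/
theorem eq_top_of_fixedSubalgebra_le [FiniteDimensional ℝ L] [LieAlgebra.IsSimple ℝ L]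
    (hθ : IsCartanInvolution θ)
    {τ : L ≃ₗ⁅ℝ⁆ L} (hτ : ∀ Y, τ (τ Y) = Y) {𝔩 : LieSubalgebra ℝ L}
    (hτ𝔩 : fixedSubalgebra τ ≤ 𝔩) (hθ𝔩 : ∀ Y ∈ 𝔩, θ Y ∈ 𝔩) {w : L} (hw : w ∈ 𝔩)
    (hwτ : τ w ≠ w) : 𝔩 = ⊤ := by
  have hinv : ∀ X Y Z : L, killingForm ℝ L ⁅X, Y⁆ Z = killingForm ℝ L X ⁅Y, Z⁆ :=
    LieModule.traceForm_apply_lie_apply ℝ L L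
  have hτκ : ∀ X Y : L, killingForm ℝ L (τ X) (τ Y) = killingForm ℝ L X Y :=
    LieAlgebra.killingForm_of_equiv_apply τ
  -- the orthogonal complement of `𝔩`
  let 𝔯 : Submodule ℝ L :=
    { carrier := {X | ∀ Y ∈ 𝔩, killingForm ℝ L X Y = 0}
      add_mem' := fun {a b} ha hb Y hY => by simp [ha Y hY, hb Y hY]
      zero_mem' := fun Y _ => by simp
      smul_mem' := fun c X hX Y hY => by simp [hX Y hY] }
  have hr : ∀ {X}, X ∈ 𝔯 ↔ ∀ Y ∈ 𝔩, killingForm ℝ L X Y = 0 := Iff.rfl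
  -- As `𝔩` is `θ`-stable, its Killing complement is also its orthogonal complement for the inner
  -- product, so it is a genuine complement.
  have hlr : ∀ X, ∃ A ∈ 𝔩, ∃ R ∈ 𝔯, X = A + R := by
    let : NormedAddCommGroup L := hθ.innerCore.toNormedAddCommGroup
    let : InnerProductSpace ℝ L := InnerProductSpace.ofCore hθ.innerCore.toCore
    intro X
    obtain ⟨A, hA, R, hR, h⟩ := Submodule.exists_add_mem_mem_orthogonal
      (K := 𝔩.toSubmodule) X
    refine ⟨A, hA, R, fun Y hY => ?_, h⟩
    rw [Submodule.mem_orthogonal'] at hR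
    have h1 : -killingForm ℝ L R (θ (θ Y)) = 0 := hR (θ Y) (hθ𝔩 Y hY)
    rwa [hθ.1, neg_eq_zero] at h1
  have hr0 : ∀ X ∈ 𝔯, X ∈ 𝔩 → X = 0 := by
    intro X hX hX'
    by_contra h0
    exact (hθ.2 X h0).ne' (by rw [hX _ (hθ𝔩 X hX'), neg_zero])
  have hlr_lie : ∀ A ∈ 𝔩, ∀ R ∈ 𝔯, ⁅A, R⁆ ∈ 𝔯 := by
    intro A hA R hR Y hY
    rw [← lie_skew, map_neg, LinearMap.neg_apply, hinv, hR _ (𝔩.lie_mem hA hY), neg_zero]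
  -- `τ = -1` on `𝔯`
  have hτr : ∀ R ∈ 𝔯, τ R = -R := by
    intro R hR
    have h1 : τ (R + τ R) = R + τ R := by rw [map_add, hτ, add_comm]
    -- By invariance `κ(R + τR, X) = κ(R, X + τX)`, and `X + τX` is fixed by `τ`, hence lies in `𝔩`.
    have h2 : R + τ R = 0 := by
      apply hθ.eq_zero_of_killingForm_eq_zero
      intro X
      have h3 : X + τ X ∈ 𝔩 := hτ𝔩 (by
        rw [mem_fixedSubalgebra, map_add, hτ, add_comm])
      have h4 : killingForm ℝ L (R + τ R) X = killingForm ℝ L R (X + τ X) := by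
        rw [map_add, LinearMap.add_apply, map_add]
        congr 1
        rw [← hτκ, hτ]
      rw [h4, hR _ h3]
    rw [← neg_eq_of_add_eq_zero_right h2]
  -- the centralizer of `𝔯` in `𝔩` is an ideal
  let N : LieIdeal ℝ L :=
    { carrier := {Y | Y ∈ 𝔩 ∧ ∀ R ∈ 𝔯, ⁅Y, R⁆ = 0}
      add_mem' := fun {a b} ha hb => ⟨𝔩.add_mem ha.1 hb.1, fun R hR => by
        rw [add_lie, ha.2 R hR, hb.2 R hR, add_zero]⟩
      zero_mem' := ⟨𝔩.zero_mem, fun R _ => zero_lie R⟩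
      smul_mem' := fun c X hX => ⟨𝔩.smul_mem c hX.1, fun R hR => by
        rw [smul_lie, hX.2 R hR, smul_zero]⟩
      lie_mem := by
        intro X Y hY
        obtain ⟨A, hA, R, hR, rfl⟩ := hlr X
        have h1 : ⁅R, Y⁆ = 0 := by rw [← lie_skew, hY.2 R hR, neg_zero]
        rw [add_lie, h1, add_zero]
        refine ⟨𝔩.lie_mem hA hY.1, fun R' hR' => ?_⟩
        rw [lie_lie, hY.2 R' hR', lie_zero, hY.2 _ (hlr_lie A hA R' hR'), sub_zero] }
  have hN : ∀ {Y}, Y ∈ N ↔ Y ∈ 𝔩 ∧ ∀ R ∈ 𝔯, ⁅Y, R⁆ = 0 := Iff.rfl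
  have hwN : w - τ w ∈ N := by
    have h1 : w - τ w ∈ 𝔩 := by
      have h2 : w + τ w ∈ 𝔩 := hτ𝔩 (by rw [mem_fixedSubalgebra, map_add, hτ, add_comm])
      have h3 : w - τ w = w + w - (w + τ w) := by abel
      rw [h3]
      exact 𝔩.sub_mem (𝔩.add_mem hw hw) h2
    refine ⟨h1, fun R hR => ?_⟩
    -- Both factors are negated by `τ`, so the bracket is fixed by `τ` and lies in `𝔩`; it also lies
    -- in `𝔯`, hence vanishes. So `w - τ w` is a nonzero element of the ideal `N`.
    have h2 : ⁅w - τ w, R⁆ ∈ 𝔩 := hτ𝔩 (by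
      rw [mem_fixedSubalgebra, LieEquiv.map_lie, hτr R hR, map_sub, hτ, ← neg_sub w, neg_lie, lie_neg,
        neg_neg])
    exact hr0 _ (hlr_lie _ h1 R hR) h2
  rcases LieAlgebra.IsSimple.eq_bot_or_eq_top (R := ℝ) N with h | h
  · rw [h, LieSubmodule.mem_bot, sub_eq_zero] at hwN
    exact absurd hwN.symm hwτ
  · rw [eq_top_iff]
    intro X _
    have : X ∈ N := by rw [h]; exact LieSubmodule.mem_top _
    exact this.1

end IsCartanInvolution

end CartanInvolution

/-! ### Real forms: complex linear extension, conjugation, complexified subspaces. -/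

section RealForms

variable {L : Type*} [AddCommGroup L] [Module ℝ L]
  {F : Type*} [NormedAddCommGroup F] [NormedSpace ℂ F]

/-- `j` exhibits the complex vector space `F` as the complexification of `L`. -/
def IsRealForm (j : L →ₗ[ℝ] F) : Prop :=
  Function.Bijective fun Y : L × L => j Y.1 + Complex.I • j Y.2

namespace IsRealForm

variable {j : L →ₗ[ℝ] F} (hj : IsRealForm j)
include hj

theorem exists_eq (Z : F) : ∃ U V, Z = j U + Complex.I • j V := by
  obtain ⟨Y, hY⟩ := hj.2 Z
  exact ⟨Y.1, Y.2, hY.symm⟩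

theorem eq_and_eq {U V U' V' : L} (h : j U + Complex.I • j V = j U' + Complex.I • j V') :
    U = U' ∧ V = V' := by
  have := hj.1 (a₁ := (U, V)) (a₂ := (U', V')) h
  exact ⟨congrArg Prod.fst this, congrArg Prod.snd this⟩

theorem injective : Function.Injective j := fun U V h =>
  (hj.eq_and_eq (U := U) (U' := V) (V := 0) (V' := 0) (by rw [h])).1

/-- The decomposition into real and imaginary part. -/
def equivProd : (L × L) ≃ₗ[ℝ] F :=
  LinearEquiv.ofBijective
    (j ∘ₗ LinearMap.fst ℝ L L + (DistribSMul.toLinearMap ℝ F Complex.I) ∘ₗ j ∘ₗ LinearMap.snd ℝ L L) hj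

theorem equivProd_apply (U V : L) : hj.equivProd (U, V) = j U + Complex.I • j V := rfl

theorem equivProd_symm_apply (U V : L) : hj.equivProd.symm (j U + Complex.I • j V) = (U, V) := by
  rw [← hj.equivProd_apply, LinearEquiv.symm_apply_apply]

theorem I_smul_equivProd (U V : L) :
    Complex.I • hj.equivProd (U, V) = hj.equivProd (-V, U) := by
  rw [equivProd_apply, equivProd_apply, smul_add, smul_smul, Complex.I_mul_I, map_neg, neg_one_smul,
    add_comm]

/-- Complex linear extension of a real linear map. -/
def extend {V : Type*} [AddCommGroup V] [Module ℂ V] (φ : L →ₗ[ℝ] V) : F →ₗ[ℂ] V where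
  toFun Z := φ (hj.equivProd.symm Z).1 + Complex.I • φ (hj.equivProd.symm Z).2
  map_add' Z W := by
    simp only [map_add, Prod.fst_add, Prod.snd_add, smul_add]
    abel
  map_smul' c Z := by
    obtain ⟨⟨U, V⟩, rfl⟩ := hj.equivProd.surjective Z
    have h : c • hj.equivProd (U, V)
        = hj.equivProd (c.re • U - c.im • V, c.re • V + c.im • U) := by
      conv_lhs => rw [← Complex.re_add_im c]
      rw [add_smul, mul_smul, I_smul_equivProd, Complex.coe_smul, Complex.coe_smul, ← map_smul,
        ← map_smul, ← map_add]
      congr 1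
      ext <;> simp [sub_eq_add_neg]
    rw [h]
    simp only [LinearEquiv.symm_apply_apply, map_add, map_sub, map_smul, RingHom.id_apply]
    conv_rhs => rw [← Complex.re_add_im c]
    simp only [add_smul, mul_smul, smul_add, Complex.coe_smul, smul_comm (Complex.I) (_ : ℝ),
      smul_smul Complex.I Complex.I, Complex.I_mul_I, neg_one_smul, smul_neg]
    abel

theorem extend_apply {V : Type*} [AddCommGroup V] [Module ℂ V] (φ : L →ₗ[ℝ] V) (U : L) :
    hj.extend φ (j U) = φ U := by
  have h := hj.equivProd_symm_apply U 0
  rw [map_zero, smul_zero, add_zero] at h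
  simp [extend, h]

theorem linearMap_ext {V : Type*} [AddCommGroup V] [Module ℂ V] {φ ψ : F →ₗ[ℂ] V}
    (h : ∀ U, φ (j U) = ψ (j U)) : φ = ψ := by
  ext Z
  obtain ⟨U, V, rfl⟩ := hj.exists_eq Z
  simp [h]

/-- Complex conjugation with respect to a real form. -/
def conj : F →ₗ[ℝ] F :=
  hj.equivProd.toLinearMap ∘ₗ (LinearMap.fst ℝ L L).prod (-LinearMap.snd ℝ L L) ∘ₗ
    hj.equivProd.symm.toLinearMap

theorem conj_apply (U V : L) : hj.conj (j U + Complex.I • j V) = j U - Complex.I • j V := by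
  simp [conj, equivProd_symm_apply, equivProd_apply, sub_eq_add_neg]

theorem conj_real (U : L) : hj.conj (j U) = j U := by
  simpa using hj.conj_apply U 0

theorem conj_conj (Z : F) : hj.conj (hj.conj Z) = Z := by
  obtain ⟨U, V, rfl⟩ := hj.exists_eq Z
  have := hj.conj_apply U (-V)
  simp only [map_neg, smul_neg, sub_neg_eq_add, ← sub_eq_add_neg] at this
  rw [conj_apply, this]

theorem conj_I_smul (Z : F) : hj.conj (Complex.I • Z) = -(Complex.I • hj.conj Z) := by
  obtain ⟨⟨U, V⟩, rfl⟩ := hj.equivProd.surjective Z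
  rw [I_smul_equivProd, equivProd_apply, equivProd_apply, conj_apply, conj_apply, smul_sub,
    smul_smul, Complex.I_mul_I]
  simp only [map_neg, neg_one_smul]
  abel

theorem exists_eq_of_conj_eq {Z : F} (h : hj.conj Z = Z) : ∃ U, Z = j U := by
  obtain ⟨U, V, rfl⟩ := hj.exists_eq Z
  rw [conj_apply] at h
  have h2 := (hj.eq_and_eq (U := U) (V := -V) (U' := U) (V' := V)
    (by rw [map_neg, smul_neg, ← sub_eq_add_neg, h])).2
  refine ⟨U, ?_⟩
  have : V = 0 := by
    have h3 : (2 : ℝ) • V = 0 := by rw [two_smul]; nth_rewrite 1 [← h2]; simp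
    simpa using h3
  simp [this]

omit hj in
theorem mem_span_iff (V : Submodule ℝ L) {Z : F} :
    Z ∈ Submodule.span ℂ (j '' (V : Set L)) ↔ ∃ U ∈ V, ∃ W ∈ V, Z = j U + Complex.I • j W := by
  constructor
  · intro h
    induction h using Submodule.span_induction with
    | mem x hx =>
      obtain ⟨U, hU, rfl⟩ := hx
      exact ⟨U, hU, 0, V.zero_mem, by simp⟩
    | zero => exact ⟨0, V.zero_mem, 0, V.zero_mem, by simp⟩
    | add x y _ _ hx hy =>
      obtain ⟨U, hU, W, hW, rfl⟩ := hx
      obtain ⟨U', hU', W', hW', rfl⟩ := hy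
      exact ⟨U + U', V.add_mem hU hU', W + W', V.add_mem hW hW', by
        simp only [map_add, smul_add]; abel⟩
    | smul c x _ hx =>
      obtain ⟨U, hU, W, hW, rfl⟩ := hx
      refine ⟨c.re • U - c.im • W, V.sub_mem (V.smul_mem _ hU) (V.smul_mem _ hW),
        c.re • W + c.im • U, V.add_mem (V.smul_mem _ hW) (V.smul_mem _ hU), ?_⟩
      conv_lhs => rw [← Complex.re_add_im c]
      simp only [map_add, map_sub, map_smul, add_smul, mul_smul, smul_add, Complex.coe_smul,
        smul_comm (Complex.I) (_ : ℝ),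
        smul_smul Complex.I Complex.I, Complex.I_mul_I, neg_one_smul, smul_neg]
      abel
  · rintro ⟨U, hU, W, hW, rfl⟩
    exact add_mem (Submodule.subset_span ⟨U, hU, rfl⟩)
      (Submodule.smul_mem _ _ (Submodule.subset_span ⟨W, hW, rfl⟩))

theorem finrank_span (V : Submodule ℝ L) [FiniteDimensional ℝ L] :
    Module.finrank ℂ (Submodule.span ℂ (j '' (V : Set L))) = Module.finrank ℝ V := by
  have h1 := finrank_real_of_complex (Submodule.span ℂ (j '' (V : Set L)))
  let f : (V × V) →ₗ[ℝ] (Submodule.span ℂ (j '' (V : Set L))) :=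
    { toFun := fun p => ⟨hj.equivProd (p.1, p.2), (mem_span_iff V).2
        ⟨p.1, p.1.2, p.2, p.2.2, rfl⟩⟩
      map_add' := fun p q => Subtype.ext (by
        simp only [Submodule.coe_add, Prod.fst_add, Prod.snd_add]
        rw [← map_add]; rfl)
      map_smul' := fun r p => Subtype.ext (by
        simp only [Prod.smul_fst, Prod.smul_snd, Submodule.coe_smul, RingHom.id_apply]
        change _ = r • hj.equivProd _
        rw [← map_smul]; rfl) }
  have hf : Function.Bijective f := by
    constructor
    · intro p q h
      have h2 := congrArg Subtype.val h
      have h3 := hj.equivProd.injective h2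
      ext
      · exact congrArg Prod.fst h3
      · exact congrArg Prod.snd h3
    · rintro ⟨Z, hZ⟩
      obtain ⟨U, hU, W, hW, rfl⟩ := (mem_span_iff V).1 hZ
      exact ⟨(⟨U, hU⟩, ⟨W, hW⟩), rfl⟩
  have h2 := (LinearEquiv.ofBijective f hf).finrank_eq
  rw [Module.finrank_prod] at h2
  omega

end IsRealForm

end RealForms

/-! ### The algebra of `A = Ad(exp(iH))`: how `A⁴` governs the fixed algebra. -/

section CrownRotation

variable {L : Type*} [LieRing L] [LieAlgebra ℝ L]
  {F : Type*} [NormedAddCommGroup F] [NormedSpace ℂ F]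
  {j : L →ₗ[ℝ] F} {B : F →L[ℂ] F →L[ℂ] F} {θ : L ≃ₗ⁅ℝ⁆ L} {A A' : F →L[ℂ] F}

/-- The complex linear extension of an endomorphism of a real form. -/
abbrev IsRealForm.extendAut (hj : IsRealForm j) (θ : L ≃ₗ⁅ℝ⁆ L) : F →ₗ[ℂ] F :=
  hj.extend (j ∘ₗ (θ : L →ₗ[ℝ] L))

theorem IsRealForm.extendAut_real (hj : IsRealForm j) (Y : L) : hj.extendAut θ (j Y) = j (θ Y) :=
  hj.extend_apply _ Y

theorem IsRealForm.extendAut_involutive (hj : IsRealForm j) (hθ : ∀ Y, θ (θ Y) = Y) (Z : F) :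
    hj.extendAut θ (hj.extendAut θ Z) = Z := by
  have : (hj.extendAut θ) ∘ₗ (hj.extendAut θ) = LinearMap.id := by
    apply hj.linearMap_ext
    intro U
    simp only [LinearMap.comp_apply, extendAut_real, hθ, LinearMap.id_apply]
  exact DFunLike.congr_fun this Z

/-- Two complex bilinear maps which agree on a real form are equal. -/
theorem IsRealForm.extendAut_bracket (hj : IsRealForm j) (hB : ∀ X Y, B (j X) (j Y) = j ⁅X, Y⁆)
    (Z W : F) : hj.extendAut θ (B Z W) = B (hj.extendAut θ Z) (hj.extendAut θ W) := by
  have h1 : ∀ X : L, (hj.extendAut θ) ∘ₗ (B (j X)).toLinearMap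
      = (B (j (θ X))).toLinearMap ∘ₗ (hj.extendAut θ) := by
    intro X
    apply hj.linearMap_ext
    intro U
    simp [extendAut_real, hB, LieEquiv.map_lie]
  have h2 : (hj.extendAut θ) ∘ₗ (B.flip W).toLinearMap
      = (B.flip (hj.extendAut θ W)).toLinearMap ∘ₗ (hj.extendAut θ) := by
    apply hj.linearMap_ext
    intro X
    have := DFunLike.congr_fun (h1 X) W
    simpa [extendAut_real] using this
  exact DFunLike.congr_fun h2 Z

theorem IsRealForm.conj_bracket (hj : IsRealForm j) (hB : ∀ X Y, B (j X) (j Y) = j ⁅X, Y⁆)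
    (Z W : F) : hj.conj (B Z W) = B (hj.conj Z) (hj.conj W) := by
  obtain ⟨U, V, rfl⟩ := hj.exists_eq Z
  obtain ⟨U', V', rfl⟩ := hj.exists_eq W
  have h : B (j U + Complex.I • j V) (j U' + Complex.I • j V')
      = j (⁅U, U'⁆ - ⁅V, V'⁆) + Complex.I • j (⁅U, V'⁆ + ⁅V, U'⁆) := by
    simp only [map_add, map_sub, map_smul, hB, add_apply, smul_apply, smul_add,
      smul_smul, Complex.I_mul_I, neg_one_smul]
    abel
  rw [h, hj.conj_apply, hj.conj_apply, hj.conj_apply]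
  simp only [map_add, map_sub, map_smul, hB, sub_apply, smul_apply, smul_add, smul_sub,
    smul_smul, Complex.I_mul_I, neg_one_smul]
  abel

theorem IsRealForm.extendAut_conj (hj : IsRealForm j) (Z : F) :
    hj.extendAut θ (hj.conj Z) = hj.conj (hj.extendAut θ Z) := by
  obtain ⟨U, V, rfl⟩ := hj.exists_eq Z
  rw [hj.conj_apply, map_add, map_sub, map_smul, extendAut_real, extendAut_real, hj.conj_apply]

theorem IsRealForm.mem_span_fixed_iff (hj : IsRealForm j) {Z : F} :
    Z ∈ Submodule.span ℂ (j '' (fixedSubalgebra θ : Set L)) ↔ hj.extendAut θ Z = Z := by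
  have := IsRealForm.mem_span_iff (j := j) (fixedSubalgebra θ).toSubmodule (Z := Z)
  refine this.trans ⟨?_, fun h => ?_⟩
  · rintro ⟨U, hU, W, hW, rfl⟩
    rw [map_add, map_smul, extendAut_real, extendAut_real, mem_fixedSubalgebra.1 hU,
      mem_fixedSubalgebra.1 hW]
  · obtain ⟨U, V, rfl⟩ := hj.exists_eq Z
    rw [map_add, map_smul, extendAut_real, extendAut_real] at h
    obtain ⟨h1, h2⟩ := hj.eq_and_eq h
    exact ⟨U, h1, V, h2, rfl⟩

/-- An element with trivial adjoint action vanishes. -/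
theorem IsRealForm.eq_zero_of_bracket_eq_zero (hj : IsRealForm j)
    (hB : ∀ X Y, B (j X) (j Y) = j ⁅X, Y⁆) (hθ : IsCartanInvolution θ) {Z : F} (h : B Z = 0) :
    Z = 0 := by
  obtain ⟨U, V, rfl⟩ := hj.exists_eq Z
  have h1 : ∀ X : L, ⁅U, X⁆ = 0 ∧ ⁅V, X⁆ = 0 := by
    intro X
    have h2 := DFunLike.congr_fun h (j X)
    simp only [map_add, map_smul, add_apply, smul_apply, hB, zero_apply] at h2
    exact hj.eq_and_eq (by rw [h2]; simp)
  rw [hθ.eq_zero_of_forall_lie_eq_zero fun X => (h1 X).1,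
    hθ.eq_zero_of_forall_lie_eq_zero fun X => (h1 X).2]
  simp

/-- The formal properties of `A = Ad(exp(i H))`, for `H` in the `-1` eigenspace of a Cartan
involution `θ`, with inverse `A'`. -/
structure IsCrownRotation (hj : IsRealForm j) (B : F →L[ℂ] F →L[ℂ] F) (θ : L ≃ₗ⁅ℝ⁆ L)
    (A A' : F →L[ℂ] F) : Prop where
  apply_inv : ∀ Z, A (A' Z) = Z
  inv_apply : ∀ Z, A' (A Z) = Z
  bracket : ∀ Z W, A (B Z W) = B (A Z) (A W)
  extendAut : ∀ Z, hj.extendAut θ (A Z) = A' (hj.extendAut θ Z)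
  conj : ∀ Z, hj.conj (A Z) = A' (hj.conj Z)

namespace IsCrownRotation

variable {hj : IsRealForm j} (hA : IsCrownRotation hj B θ A A')
include hA

theorem extendAut' (Z : F) : hj.extendAut θ (A' Z) = A (hj.extendAut θ Z) := by
  have := hA.extendAut (A' Z)
  rw [hA.apply_inv] at this
  rw [this, hA.apply_inv]

/-- `A⁻¹Z` is `θ`-fixed exactly when `Z` is fixed by `AθA⁻¹`, which equals `A²θ` because `θ` inverts
`A`. -/
theorem inv_mem_iff {Z : F} :
    A' Z ∈ Submodule.span ℂ (j '' (fixedSubalgebra θ : Set L)) ↔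
      A (A (hj.extendAut θ Z)) = Z := by
  rw [hj.mem_span_fixed_iff, hA.extendAut']
  constructor
  · intro h; rw [h, hA.apply_inv]
  · intro h
    rw [← hA.inv_apply (A (hj.extendAut θ Z)), h]

variable (hB : ∀ X Y, B (j X) (j Y) = j ⁅X, Y⁆)

/-- If `A ^ 4 = 1` then `A ^ 2 θ` restricts to an involution of the real form. -/
theorem exists_involution (hB : ∀ X Y, B (j X) (j Y) = j ⁅X, Y⁆) (hθ : ∀ Y, θ (θ Y) = Y)
    (h4 : ∀ Y, A (A (A (A (j Y)))) = j Y) :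
    ∃ τ : L ≃ₗ⁅ℝ⁆ L, (∀ Y, τ (τ Y) = Y) ∧ ∀ Y, A (A (j (θ Y))) = j (τ Y) := by
  have h2 : ∀ Y, A (A (j Y)) = A' (A' (j Y)) := by
    intro Y
    conv_rhs => rw [← h4 Y]
    rw [hA.inv_apply, hA.inv_apply]
  -- Conjugation turns `A²` into `A⁻²`, which equals `A²` on the real form; so `A²θY` is real.
  have h1 : ∀ Y, ∃ U, A (A (j (θ Y))) = j U := by
    intro Y
    apply hj.exists_eq_of_conj_eq
    rw [hA.conj, hA.conj, hj.conj_real, h2]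
  choose τ hτ using h1
  have hinj := hj.injective
  have hinv : ∀ Y, τ (τ Y) = Y := by
    intro Y
    apply hinj
    rw [← hτ, ← hj.extendAut_real, ← hτ, hA.extendAut, hA.extendAut, hj.extendAut_real, hθ,
      hA.apply_inv, hA.apply_inv]
  refine ⟨{ toFun := τ, map_add' := fun X Y => hinj ?_, map_smul' := fun c X => hinj ?_,
            map_lie' := fun {X Y} => hinj ?_, invFun := τ, left_inv := hinv,
            right_inv := hinv }, hinv, hτ⟩
  · rw [← hτ, map_add θ, map_add j, map_add A, map_add A, map_add j, hτ, hτ]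
  · have h := hτ X
    rw [← hτ, map_smul θ, map_smul j, RingHom.id_apply, map_smul j, ← h, ← Complex.coe_smul c,
      ← Complex.coe_smul c, map_smul, map_smul]
  · rw [← hτ, LieEquiv.map_lie, ← hB, ← hB, hA.bracket, hA.bracket, hτ, hτ]

variable {𝔥 : LieSubalgebra ℝ L}

theorem mem_iff
    (h𝔥 : ∀ Y, Y ∈ 𝔥 ↔ A' (j Y) ∈ Submodule.span ℂ (j '' (fixedSubalgebra θ : Set L))) {Y : L} :
    Y ∈ 𝔥 ↔ A (A (j (θ Y))) = j Y := by
  rw [h𝔥, hA.inv_mem_iff, hj.extendAut_real]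

theorem isSymmetricSubalgebra (hB : ∀ X Y, B (j X) (j Y) = j ⁅X, Y⁆) (hθ : ∀ Y, θ (θ Y) = Y)
    (h𝔥 : ∀ Y, Y ∈ 𝔥 ↔ A' (j Y) ∈ Submodule.span ℂ (j '' (fixedSubalgebra θ : Set L)))
    (h4 : ∀ Y, A (A (A (A (j Y)))) = j Y) : IsSymmetricSubalgebra 𝔥 := by
  obtain ⟨τ, hτ, h⟩ := hA.exists_involution hB hθ h4
  refine ⟨τ, hτ, ?_⟩
  ext Y
  rw [hA.mem_iff h𝔥, h, mem_fixedSubalgebra, hj.injective.eq_iff]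

theorem map_span_eq (hB : ∀ X Y, B (j X) (j Y) = j ⁅X, Y⁆) (hθ : ∀ Y, θ (θ Y) = Y)
    (h𝔥 : ∀ Y, Y ∈ 𝔥 ↔ A' (j Y) ∈ Submodule.span ℂ (j '' (fixedSubalgebra θ : Set L)))
    (h4 : ∀ Y, A (A (A (A (j Y)))) = j Y) :
    (Submodule.span ℂ (j '' (𝔥 : Set L))).map A'.toLinearMap
      = Submodule.span ℂ (j '' (fixedSubalgebra θ : Set L)) := by
  obtain ⟨τ, hτ, h⟩ := hA.exists_involution hB hθ h4
  apply le_antisymm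
  · rw [Submodule.map_span_le]
    rintro _ ⟨Y, hY, rfl⟩
    exact (h𝔥 Y).1 hY
  · intro Z hZ
    refine ⟨A Z, ?_, hA.inv_apply Z⟩
    rw [← hA.inv_apply Z, hA.inv_mem_iff] at hZ
    -- `A Z` is fixed by `A²θ`; this map preserves the real form, so the real and imaginary parts of
    -- `A Z` are fixed separately and lie in `𝔥`.
    obtain ⟨U, V, hUV⟩ := hj.exists_eq (A Z)
    rw [hUV] at hZ ⊢
    simp only [map_add, map_smul] at hZ
    rw [hj.extendAut_real, hj.extendAut_real, h, h] at hZ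
    obtain ⟨h1, h2⟩ := hj.eq_and_eq hZ
    refine (IsRealForm.mem_span_iff 𝔥.toSubmodule).2 ⟨U, ?_, V, ?_, rfl⟩
    · exact (hA.mem_iff h𝔥).2 (by rw [h, h1])
    · exact (hA.mem_iff h𝔥).2 (by rw [h, h2])

/-- The fixed points of `A ^ 4` in the real form. -/
def fourthPowerFixed (hB : ∀ X Y, B (j X) (j Y) = j ⁅X, Y⁆) :
    LieSubalgebra ℝ L where
  carrier := {Y | A (A (A (A (j Y)))) = j Y}
  add_mem' := fun {a b} (ha : _ = _) (hb : _ = _) => by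
    change A (A (A (A (j (a + b))))) = j (a + b)
    simp only [map_add, ha, hb]
  zero_mem' := by
    change A (A (A (A (j 0)))) = j 0
    simp
  smul_mem' := fun c X (hX : _ = _) => by
    change A (A (A (A (j (c • X))))) = j (c • X)
    rw [map_smul, ← Complex.coe_smul c]
    simp only [map_smul, hX]
  lie_mem' := fun {X Y} (hX : _ = _) (hY : _ = _) => by
    change A (A (A (A (j ⁅X, Y⁆)))) = j ⁅X, Y⁆
    simp only [← hB, hA.bracket, hX, hY]

theorem mem_fourthPowerFixed {Y : L} : Y ∈ hA.fourthPowerFixed hB ↔ A (A (A (A (j Y)))) = j Y :=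
  Iff.rfl

theorem theta_mem_fourthPowerFixed {Y : L} (hY : Y ∈ hA.fourthPowerFixed hB) :
    θ Y ∈ hA.fourthPowerFixed hB := by
  rw [mem_fourthPowerFixed] at hY ⊢
  have h := congrArg (hj.extendAut θ) hY
  simp only [hA.extendAut, hj.extendAut_real] at h
  conv_lhs => rw [← h]
  simp only [hA.apply_inv]

/-- For real `Y` with `A²θY = Y`, conjugation gives `A⁻²θY = Y`; hence `A⁴Y = A²θY = Y`. -/
theorem mem_fourthPowerFixed_of_mem
    (h𝔥 : ∀ Y, Y ∈ 𝔥 ↔ A' (j Y) ∈ Submodule.span ℂ (j '' (fixedSubalgebra θ : Set L)))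
    {Y : L} (hY : Y ∈ 𝔥) : Y ∈ hA.fourthPowerFixed hB := by
  rw [hA.mem_iff h𝔥] at hY
  have h1 := congrArg hj.conj hY
  simp only [hA.conj, hj.conj_real] at h1
  rw [mem_fourthPowerFixed]
  conv_lhs => rw [← h1]
  simp only [hA.apply_inv]
  exact hY

/-- The fixed algebra of `A⁴` is `θ`-stable and contains `𝔥` and `w`, whereas `A²θw = -w` keeps `w`
out of `𝔥`. `eq_top_of_fixedSubalgebra_le` applies. -/
theorem fourthPower_eq_of_isSymmetricSubalgebra [FiniteDimensional ℝ L] [LieAlgebra.IsSimple ℝ L]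
    (hθ : IsCartanInvolution θ) (hB : ∀ X Y, B (j X) (j Y) = j ⁅X, Y⁆)
    (h𝔥 : ∀ Y, Y ∈ 𝔥 ↔ A' (j Y) ∈ Submodule.span ℂ (j '' (fixedSubalgebra θ : Set L)))
    {w : L} (hw : θ w = -w) (hw0 : w ≠ 0) (hAw : A (j w) = j w) (hs : IsSymmetricSubalgebra 𝔥)
    (Y : L) : A (A (A (A (j Y)))) = j Y := by
  obtain ⟨τ, hτ, rfl⟩ := hs
  have htop : hA.fourthPowerFixed hB = ⊤ := by
    refine hθ.eq_top_of_fixedSubalgebra_le hτ (w := w)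
      (fun Y hY => hA.mem_fourthPowerFixed_of_mem hB h𝔥 hY)
      (fun Y hY => hA.theta_mem_fourthPowerFixed hB hY) ?_ ?_
    · simp only [mem_fourthPowerFixed, hAw]
    · intro h
      rw [← mem_fixedSubalgebra, hA.mem_iff h𝔥, hw, map_neg, map_neg, map_neg, hAw, hAw, ← map_neg]
        at h
      have h1 := hj.injective h
      have h2 : (2 : ℝ) • w = 0 := by rw [two_smul]; nth_rewrite 1 [← h1]; simp
      exact hw0 (by simpa using h2)
  have : Y ∈ hA.fourthPowerFixed hB := by rw [htop]; exact LieSubalgebra.mem_top Y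
  exact this

/-- If `A ^ {-1} 𝔥_ℂ = 𝔨_ℂ` then `A ^ 4` fixes every root vector. -/
theorem fourthPower_eq_of_span_le
    (hθ : ∀ Y, θ (θ Y) = Y) (hB : ∀ X Y, B (j X) (j Y) = j ⁅X, Y⁆)
    (h𝔥 : ∀ Y, Y ∈ 𝔥 ↔ A' (j Y) ∈ Submodule.span ℂ (j '' (fixedSubalgebra θ : Set L)))
    {w : L} (hw : θ w = -w) (hAw : A (j w) = j w)
    (hs : ∀ Z ∈ Submodule.span ℂ (j '' (fixedSubalgebra θ : Set L)),
      A Z ∈ Submodule.span ℂ (j '' (𝔥 : Set L)))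
    {X : L} (hX : ⁅w, X⁆ = X) : A (A (A (A (j X)))) = j X := by
  have hk : ∀ Y ∈ fixedSubalgebra θ, Y ∈ hA.fourthPowerFixed hB := by
    intro Y hY
    obtain ⟨U, hU, V, hV, h⟩ := (IsRealForm.mem_span_iff 𝔥.toSubmodule).1
      (hs (j Y) (Submodule.subset_span ⟨Y, hY, rfl⟩))
    have hU4 := hA.mem_fourthPowerFixed_of_mem hB h𝔥 hU
    have hV4 := hA.mem_fourthPowerFixed_of_mem hB h𝔥 hV
    rw [mem_fourthPowerFixed] at hU4 hV4 ⊢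
    -- `A Y` lies in `𝔥_ℂ`, where `A⁴` is the identity; cancelling one `A` gives the claim for `Y`.
    have h5 : A (A (A (A (A (j Y))))) = A (j Y) := by
      rw [h]; simp only [map_add, map_smul, hU4, hV4]
    rw [← hA.inv_apply (A (A (A (A (j Y))))), h5, hA.inv_apply]
  have hwl : w ∈ hA.fourthPowerFixed hB := by simp only [mem_fourthPowerFixed, hAw]
  have h1 : X + θ X ∈ hA.fourthPowerFixed hB :=
    hk _ (by rw [mem_fixedSubalgebra, map_add, hθ, add_comm])
  have h2 : ⁅w, θ X⁆ = - θ X := by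
    have := congrArg θ hX
    rw [LieEquiv.map_lie, hw, neg_lie] at this
    rw [← neg_eq_iff_eq_neg, this]
  -- `ad w` is `1` on `X` and `-1` on `θX`, so bracketing with `w` turns `X + θX` into `X - θX`.
  have h3 : X - θ X ∈ hA.fourthPowerFixed hB := by
    have := (hA.fourthPowerFixed hB).lie_mem hwl h1
    rwa [lie_add, hX, h2, ← sub_eq_add_neg] at this
  have h4 : X ∈ hA.fourthPowerFixed hB := by
    have h5 := (hA.fourthPowerFixed hB).smul_mem (2⁻¹ : ℝ)
      ((hA.fourthPowerFixed hB).add_mem h1 h3)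
    have h6 : (2⁻¹ : ℝ) • (X + θ X + (X - θ X)) = X := by
      rw [add_add_sub_cancel, ← two_smul ℝ X, smul_smul]; norm_num
    rwa [h6] at h5
  exact h4

end IsCrownRotation

end CrownRotation

/-! ### Exponentials of operators: intertwining and eigenvectors. -/

section Exponential

variable {F : Type*} [NormedAddCommGroup F] [NormedSpace ℂ F] [CompleteSpace F]

theorem hasSum_exp_apply (D : F →L[ℂ] F) (Z : F) :
    HasSum (fun n : ℕ => ((n.factorial : ℝ)⁻¹) • (D ^ n) Z) (NormedSpace.exp D Z) := by
  have h := NormedSpace.exp_series_hasSum_exp' (𝕂 := ℝ) D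
  exact h.mapL (((ContinuousLinearMap.apply ℂ F Z).restrictScalars ℝ))

/-- `T` is only real linear, so that the antilinear conjugation is covered together with the
extension of `θ`. -/
theorem map_exp_apply {T : F →L[ℝ] F} {D D' : F →L[ℂ] F} (h : ∀ Z, T (D Z) = D' (T Z)) (Z : F) :
    T (NormedSpace.exp D Z) = NormedSpace.exp D' (T Z) := by
  have h1 := (hasSum_exp_apply D Z).mapL T
  refine h1.unique ?_
  have h2 : ∀ (n : ℕ) Z, T ((D ^ n) Z) = (D' ^ n) (T Z) := by
    intro n
    induction n with
    | zero => intro Z; simp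
    | succ n ih => intro Z; rw [pow_succ, pow_succ, mul_apply_eq_comp,
        mul_apply_eq_comp, ih, h]
  simp only [map_smul, h2]
  exact hasSum_exp_apply D' (T Z)

theorem exp_apply_of_eq_smul {D : F →L[ℂ] F} {μ : ℂ} {Z : F} (h : D Z = μ • Z) :
    NormedSpace.exp D Z = Complex.exp μ • Z := by
  have h2 : ∀ n : ℕ, (D ^ n) Z = μ ^ n • Z := by
    intro n
    induction n with
    | zero => simp
    | succ n ih => rw [pow_succ, mul_apply_eq_comp, h, map_smul, ih, smul_smul, pow_succ']
  refine (hasSum_exp_apply D Z).unique ?_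
  have h3 := (NormedSpace.exp_series_hasSum_exp' (𝕂 := ℝ) μ).smul_const Z
  rw [← Complex.exp_eq_exp_ℂ] at h3
  simp only [h2, ← smul_assoc]
  exact h3

end Exponential

/-! ### `K_ℂ`, the stabilizer algebra and the boundary element under `Ad`. -/

section AdjointOfComplexification

variable {E : Type*} [NormedAddCommGroup E] [NormedSpace ℝ E]
  {G : Type*} [TopologicalSpace G] [ChartedSpace E G] [Group G]
  {F : Type*} [NormedAddCommGroup F] [NormedSpace ℂ F]
  {GC : Type*} [TopologicalSpace GC] [ChartedSpace F GC] [Group GC]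
  {ι : G →* GC}

variable (E F) in
/-- The differential of `ι`, with values in the model space of the complex group. -/
def realFormMap (ι : G →* GC) : GroupLieAlgebra 𝓘(ℝ, E) G →ₗ[ℝ] F := lieDifferential ι

theorem realFormMap_apply (ι : G →* GC) (Y : GroupLieAlgebra 𝓘(ℝ, E) G) :
    realFormMap E F ι Y = homDeriv E F ι Y := rfl

theorem IsComplexification.isRealForm (hι : IsComplexification (E := E) (F := F) ι) :
    IsRealForm (realFormMap E F ι) := hι.bijective

variable [CompleteSpace E] [LieGroup 𝓘(ℝ, E) ∞ G] [LieGroup 𝓘(ℂ, F) ω GC]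

theorem IsComplexification.bracket (hι : IsComplexification (E := E) (F := F) ι)
    (X Y : GroupLieAlgebra 𝓘(ℝ, E) G) :
    groupAdDeriv ℂ F GC (realFormMap E F ι X) (realFormMap E F ι Y) = realFormMap E F ι ⁅X, Y⁆ := by
  rw [realFormMap_apply, realFormMap_apply, realFormMap_apply, bracket_eq_groupAdDeriv]
  exact (homDeriv_groupAdDeriv hι.contMDiff X Y).symm

/-- The complexified fixed point algebra of `θ`, in the model space of the complex group. -/
abbrev fixedSpan (ι : G →* GC)
    (θ : GroupLieAlgebra 𝓘(ℝ, E) G ≃ₗ⁅ℝ⁆ GroupLieAlgebra 𝓘(ℝ, E) G) : Submodule ℂ F :=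
  Submodule.span ℂ (realFormMap E F ι '' (fixedSubalgebra θ : Set (GroupLieAlgebra 𝓘(ℝ, E) G)))

variable {θ : GroupLieAlgebra 𝓘(ℝ, E) G ≃ₗ⁅ℝ⁆ GroupLieAlgebra 𝓘(ℝ, E) G}

omit [LieGroup 𝓘(ℂ, F) ω GC] in
theorem complexK_eq : complexK (F := F) ι θ
    = Subgroup.closure (complexLieExp (F := F) '' (fixedSpan (F := F) ι θ : Set F)) := rfl

variable [FiniteDimensional ℂ F] [T2Space GC]

/-- For a generator `exp Z` with `Z` in `𝔨_ℂ`, `ad Z` commutes with `θ`, hence so does its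
exponential. -/
theorem IsComplexification.extendAut_groupAd (hι : IsComplexification (E := E) (F := F) ι)
    {g : GC} (hg : g ∈ complexK (F := F) ι θ) (W : F) :
    hι.isRealForm.extendAut θ (groupAd ℂ F g W) = groupAd ℂ F g (hι.isRealForm.extendAut θ W) := by
  have := FiniteDimensional.complete ℂ F
  have : FiniteDimensional ℝ F := FiniteDimensional.complexToReal F
  rw [complexK_eq] at hg
  induction hg using Subgroup.closure_induction generalizing W with
  | mem x hx =>
    obtain ⟨Z, hZ, rfl⟩ := hx
    change F at Z
    have hZ' : hι.isRealForm.extendAut θ Z = Z := hι.isRealForm.mem_span_fixed_iff.1 hZ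
    have e : groupAd ℂ F (complexLieExp (F := F) (GC := GC) Z)
        = NormedSpace.exp (groupAdDeriv ℂ F GC Z) := groupAd_complexLieExp Z
    rw [e]
    refine map_exp_apply (T := LinearMap.toContinuousLinearMap
      ((hι.isRealForm.extendAut θ).restrictScalars ℝ)) (fun V => ?_) W
    refine (hι.isRealForm.extendAut_bracket hι.bracket Z V).trans ?_
    rw [hZ']
    rfl
  | one => simp [groupAd_one]
  | mul x y _ _ hx hy =>
    rw [groupAd_mul ω (by simp), ContinuousLinearMap.comp_apply, ContinuousLinearMap.comp_apply,
      hx, hy]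
  | inv x _ hx =>
    have h1 : ∀ V, groupAd ℂ F x (groupAd ℂ F x⁻¹ V) = V := fun V =>
      DFunLike.congr_fun (groupAd_mul_inv_cancel x) V
    have h2 : ∀ V, groupAd ℂ F x⁻¹ (groupAd ℂ F x V) = V := fun V =>
      DFunLike.congr_fun (groupAd_inv_mul_cancel x) V
    rw [← h2 (hι.isRealForm.extendAut θ (groupAd ℂ F x⁻¹ W)), ← hx, h1]

omit [FiniteDimensional ℂ F] [T2Space GC] in
/-- An endomorphism of the adjoint action which commutes with the automorphism `S` fixes the
generator. -/
theorem IsComplexification.eq_of_commute (hι : IsComplexification (E := E) (F := F) ι)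
    (hθ : IsCartanInvolution θ) {S : F →ₗ[ℂ] F} (hSS : Function.Surjective S)
    (hS : ∀ Z W, S (groupAdDeriv ℂ F GC Z W) = groupAdDeriv ℂ F GC (S Z) (S W)) {Z : F}
    (h : ∀ W, S (groupAdDeriv ℂ F GC Z W) = groupAdDeriv ℂ F GC Z (S W)) : S Z = Z := by
  rw [← sub_eq_zero]
  apply hι.isRealForm.eq_zero_of_bracket_eq_zero hι.bracket hθ
  ext V
  obtain ⟨W, rfl⟩ := hSS V
  rw [map_sub, sub_apply, ← hS, h]
  simp

/-- This does not need `K_ℂ` to be closed. If `γ` stays in `K_ℂ`, then `Ad(γ t)` commutes with `θ`;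
differentiating, `ad Z` commutes with `θ`, so `ad(θZ) = ad Z`, and `ad` is injective. -/
theorem IsOneParameterSubgroup.forall_mem_complexK_iff (hι : IsComplexification (E := E) (F := F) ι)
    (hθ : IsCartanInvolution θ) {γ : ℝ → GC} {Z : F} (h : IsOneParameterSubgroup (E := F) γ Z) :
    (∀ t, γ t ∈ complexK (F := F) ι θ) ↔ Z ∈ fixedSpan (F := F) ι θ := by
  have := FiniteDimensional.complete ℂ F
  have : FiniteDimensional ℝ F := FiniteDimensional.complexToReal F
  constructor
  · intro hK
    rw [hι.isRealForm.mem_span_fixed_iff]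
    refine hι.eq_of_commute hθ
      (fun V => ⟨_, hι.isRealForm.extendAut_involutive hθ.1 V⟩)
      (hι.isRealForm.extendAut_bracket hι.bracket) (fun W => ?_)
    let T : F →L[ℝ] F := LinearMap.toContinuousLinearMap
      ((hι.isRealForm.extendAut θ).restrictScalars ℝ)
    have h0 := h.hasDerivAt_groupAd_zero
    have h1 : ∀ V : F, HasDerivAt (fun t => groupAd ℂ F (γ t) V) (groupAdDeriv ℂ F GC Z V) 0 :=
      fun V => ((ContinuousLinearMap.apply ℂ F V).restrictScalars ℝ).hasFDerivAt.comp_hasDerivAt 0 h0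
    have h2 : HasDerivAt (fun t => T (groupAd ℂ F (γ t) W)) (T (groupAdDeriv ℂ F GC Z W)) 0 :=
      T.hasFDerivAt.comp_hasDerivAt 0 (h1 W)
    refine h2.unique ((h1 (T W)).congr_of_eventuallyEq (Filter.Eventually.of_forall fun t => ?_))
    exact hι.extendAut_groupAd (hK t) W
  · intro hZ t
    rw [← h.complexLieExp_smul t, complexK_eq]
    refine Subgroup.subset_closure ⟨t • Z, ?_, rfl⟩
    rw [← Complex.coe_smul]
    exact Submodule.smul_mem _ _ hZ

variable [T2Space G]

theorem IsComplexification.mem_stabilizerAlgebra_iff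
    (hι : IsComplexification (E := E) (F := F) ι) (hθ : IsCartanInvolution θ) (z : GC)
    (Y : GroupLieAlgebra 𝓘(ℝ, E) G) :
    Y ∈ stabilizerAlgebra (E := E) ι (z : GC ⧸ complexK (F := F) ι θ) ↔
      groupAd ℂ F z⁻¹ (realFormMap E F ι Y) ∈ fixedSpan (F := F) ι θ := by
  have hset : ∀ Y : GroupLieAlgebra 𝓘(ℝ, E) G,
      (∀ t : ℝ, lieExp (t • Y) ∈
        (MulAction.stabilizer GC (z : GC ⧸ complexK (F := F) ι θ)).comap ι) ↔
      groupAd ℂ F z⁻¹ (realFormMap E F ι Y) ∈ fixedSpan (F := F) ι θ := by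
    intro Y
    obtain ⟨γ, hγ⟩ := exists_isOneParameterSubgroup (G := G) Y
    have h1 := (hγ.map hι.contMDiff).conj z⁻¹
    have h2 := h1.forall_mem_complexK_iff hι hθ
    refine Iff.trans ?_ h2
    refine forall_congr' fun t => ?_
    rw [hγ.lieExp_smul, Subgroup.mem_comap, MulAction.mem_stabilizer_iff, eq_comm,
      MulAction.Quotient.smul_coe, QuotientGroup.eq, smul_eq_mul, inv_inv, mul_assoc]
  -- The defining set of the stabilizer algebra is already a subalgebra, so passing to the generated
  -- one adds nothing.
  let K : LieSubalgebra ℝ (GroupLieAlgebra 𝓘(ℝ, E) G) :=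
    { carrier := {Y | groupAd ℂ F z⁻¹ (realFormMap E F ι Y) ∈ fixedSpan (F := F) ι θ}
      add_mem' := fun {a b} ha hb => by
        change groupAd ℂ F z⁻¹ (realFormMap E F ι (a + b)) ∈ fixedSpan (F := F) ι θ
        rw [map_add, map_add]; exact add_mem ha hb
      zero_mem' := by
        change groupAd ℂ F z⁻¹ (realFormMap E F ι 0) ∈ fixedSpan (F := F) ι θ
        rw [map_zero, map_zero]; exact zero_mem _
      smul_mem' := fun c X hX => by
        change groupAd ℂ F z⁻¹ (realFormMap E F ι (c • X)) ∈ fixedSpan (F := F) ι θ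
        rw [map_smul, ← Complex.coe_smul, map_smul]; exact Submodule.smul_mem _ _ hX
      lie_mem' := fun {X Y} hX hY => by
        change groupAd ℂ F z⁻¹ (realFormMap E F ι ⁅X, Y⁆) ∈ fixedSpan (F := F) ι θ
        rw [← hι.bracket, groupAd_groupAdDeriv_apply, hι.isRealForm.mem_span_fixed_iff,
          hι.isRealForm.extendAut_bracket hι.bracket, hι.isRealForm.mem_span_fixed_iff.1 hX,
          hι.isRealForm.mem_span_fixed_iff.1 hY] }
  have : stabilizerAlgebra (E := E) ι (z : GC ⧸ complexK (F := F) ι θ) = K := by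
    refine le_antisymm (LieSubalgebra.lieSpan_le.2 fun Y hY => (hset Y).1 hY) fun Y hY => ?_
    exact LieSubalgebra.subset_lieSpan ((hset Y).2 hY)
  rw [this]
  rfl

section BoundaryElement

variable {w : GroupLieAlgebra 𝓘(ℝ, E) G} {k : ℕ}

omit [CompleteSpace E] [LieGroup 𝓘(ℝ, E) ∞ G] [T2Space G] in
theorem groupAd_boundaryElement : groupAd ℂ F (boundaryElement (F := F) ι w k)
    = NormedSpace.exp (groupAdDeriv ℂ F GC
        ((Complex.I * (Real.pi / (2 * k) : ℝ)) • realFormMap E F ι w)) := by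
  have := FiniteDimensional.complete ℂ F
  exact groupAd_complexLieExp _

omit [CompleteSpace E] [LieGroup 𝓘(ℝ, E) ∞ G] [T2Space G] in
theorem groupAd_boundaryElement_inv : groupAd ℂ F (boundaryElement (F := F) ι w k)⁻¹
    = NormedSpace.exp (-groupAdDeriv ℂ F GC
        ((Complex.I * (Real.pi / (2 * k) : ℝ)) • realFormMap E F ι w)) := by
  have := FiniteDimensional.complete ℂ F
  obtain ⟨γ, h⟩ := exists_isOneParameterSubgroup_complex (GC := GC)
    ((Complex.I * (Real.pi / (2 * k) : ℝ)) • realFormMap E F ι w)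
  have h1 : boundaryElement (F := F) ι w k = γ 1 := h.complexLieExp_eq
  rw [h1, ← h.map_neg, h.groupAd_eq_exp, neg_one_smul]

omit [T2Space G] in
-- Both `θ` and the conjugation negate `i w`, hence carry the exponential of its adjoint action to
-- the inverse.
theorem IsComplexification.isCrownRotation (hι : IsComplexification (E := E) (F := F) ι)
    (hw : θ w = -w) :
    IsCrownRotation hι.isRealForm (groupAdDeriv ℂ F GC) θ
      (groupAd ℂ F (boundaryElement (F := F) ι w k))
      (groupAd ℂ F (boundaryElement (F := F) ι w k)⁻¹) where
  apply_inv Z := DFunLike.congr_fun (groupAd_mul_inv_cancel _) Z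
  inv_apply Z := DFunLike.congr_fun (groupAd_inv_mul_cancel _) Z
  bracket := groupAd_groupAdDeriv_apply _
  extendAut Z := by
    have := FiniteDimensional.complete ℂ F
    have : FiniteDimensional ℝ F := FiniteDimensional.complexToReal F
    rw [groupAd_boundaryElement, groupAd_boundaryElement_inv]
    refine map_exp_apply (T := LinearMap.toContinuousLinearMap
      ((hι.isRealForm.extendAut θ).restrictScalars ℝ)) (fun V => ?_) Z
    refine (hι.isRealForm.extendAut_bracket hι.bracket _ V).trans ?_
    rw [map_smul, hι.isRealForm.extendAut_real, hw, map_neg, smul_neg, map_neg]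
    rfl
  conj Z := by
    have := FiniteDimensional.complete ℂ F
    have : FiniteDimensional ℝ F := FiniteDimensional.complexToReal F
    rw [groupAd_boundaryElement, groupAd_boundaryElement_inv]
    refine map_exp_apply (T := LinearMap.toContinuousLinearMap hι.isRealForm.conj) (fun V => ?_) Z
    refine (hι.isRealForm.conj_bracket hι.bracket _ V).trans ?_
    rw [mul_smul, hι.isRealForm.conj_I_smul, Complex.coe_smul, map_smul,
      hι.isRealForm.conj_real, map_neg]
    rfl

omit [T2Space G] in
theorem IsComplexification.groupAd_boundaryElement_apply
    (hι : IsComplexification (E := E) (F := F) ι) {X : GroupLieAlgebra 𝓘(ℝ, E) G} {m : ℝ}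
    (hX : ⁅w, X⁆ = m • X) :
    groupAd ℂ F (boundaryElement (F := F) ι w k) (realFormMap E F ι X)
      = Complex.exp (Complex.I * (Real.pi / (2 * k) : ℝ) * m) • realFormMap E F ι X := by
  have := FiniteDimensional.complete ℂ F
  rw [groupAd_boundaryElement]
  apply exp_apply_of_eq_smul
  rw [map_smul, smul_apply, hι.bracket, hX, map_smul, ← Complex.coe_smul, smul_smul]

end BoundaryElement

end AdjointOfComplexification

/-! ### Submersions and the quotient `X_ℂ`. -/

section
open scoped Topology

section LocalSections

variable {𝕜 : Type*} [RCLike 𝕜] {A B C : Type*} [NormedAddCommGroup A] [NormedSpace 𝕜 A]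
  [NormedAddCommGroup B] [NormedSpace 𝕜 B] [CompleteSpace B] [FiniteDimensional 𝕜 B]
  [NormedAddCommGroup C] [NormedSpace 𝕜 C]
  {N X V : Type*} [TopologicalSpace N] [ChartedSpace A N] [TopologicalSpace X] [ChartedSpace B X]
  [TopologicalSpace V] [ChartedSpace C V]
  {n : WithTop ℕ∞} [IsManifold 𝓘(𝕜, A) n N] {p : N → X} {y : N}

/-- Submersions have local sections. -/
theorem ContMDiffAt.exists_local_section (hn : n ≠ 0) (hp : ContMDiffAt 𝓘(𝕜, A) 𝓘(𝕜, B) n p y)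
    (hs : Function.Surjective (mfderiv 𝓘(𝕜, A) 𝓘(𝕜, B) p y)) :
    ∃ σ : X → N, ContMDiffAt 𝓘(𝕜, B) 𝓘(𝕜, A) n σ (p y) ∧ σ (p y) = y ∧
      ∀ᶠ q in 𝓝 (p y), p (σ q) = q := by
  set e := extChartAt 𝓘(𝕜, A) y with he
  set e' := extChartAt 𝓘(𝕜, B) (p y) with he'
  have hP := (contMDiffAt_iff.1 hp).2
  rw [modelWithCornersSelf_coe, Set.range_id, contDiffWithinAt_univ, ← he, ← he'] at hP
  set P : A → B := e' ∘ p ∘ e.symm with hPdef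
  obtain ⟨D, hD, hDs⟩ : ∃ D : A →L[𝕜] B, HasFDerivAt P D (e y) ∧ Function.Surjective D := by
    refine ⟨mfderiv 𝓘(𝕜, A) 𝓘(𝕜, B) p y, ?_, hs⟩
    have h1 : HasFDerivWithinAt P (mfderiv 𝓘(𝕜, A) 𝓘(𝕜, B) p y : A →L[𝕜] B) (Set.range (id : A → A))
      (e y) := (hp.mdifferentiableAt hn).hasMFDerivAt.2
    rw [Set.range_id] at h1
    exact hasFDerivWithinAt_univ.1 h1
  obtain ⟨R, hR⟩ := D.exists_rightInverse_of_surjective (LinearMap.range_eq_top.2 hDs)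
  -- An affine slice transverse to the kernel: on it `P` has derivative `D ∘ R = id`, so the inverse
  -- function theorem applies.
  set T : B → A := fun v => e y + R v with hTdef
  have hT : ContDiff 𝕜 n T := contDiff_const.add R.contDiff
  have hT0 : T 0 = e y := by simp [hTdef]
  have hQ : ContDiffAt 𝕜 n (P ∘ T) 0 := by
    refine ContDiffAt.comp 0 ?_ hT.contDiffAt
    rw [hT0]; exact hP
  have hQ' : HasFDerivAt (P ∘ T) ((ContinuousLinearEquiv.refl 𝕜 B : B ≃L[𝕜] B) : B →L[𝕜] B) 0 := by
    have h1 : HasFDerivAt T R 0 := R.hasFDerivAt.const_add (e y)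
    rw [← hT0] at hD
    have h2 := hD.comp 0 h1
    rw [hR] at h2
    exact h2
  set ψ := hQ.localInverse hQ' hn with hψ
  have hPy : P (e y) = e' (p y) := by
    simp [hPdef, he]
  have hQ0 : (P ∘ T) 0 = e' (p y) := by rw [Function.comp_apply, hT0, hPy]
  have hψ1 : ContDiffAt 𝕜 n ψ (e' (p y)) := by
    rw [← hQ0]; exact hQ.to_localInverse hQ' hn
  have hψ0 : ψ (e' (p y)) = 0 := by
    rw [← hQ0]; exact hQ.localInverse_apply_image hQ' hn
  have hψ2 : ∀ᶠ x in 𝓝 (e' (p y)), (P ∘ T) (ψ x) = x := by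
    rw [← hQ0]; exact (hQ.hasStrictFDerivAt' hQ' hn).eventually_right_inverse
  have hσ0 : e.symm (T (ψ (e' (p y)))) = y := by rw [hψ0, hT0]; simp [he]
  have hσ : ContMDiffAt 𝓘(𝕜, B) 𝓘(𝕜, A) n (fun q => e.symm (T (ψ (e' q)))) (p y) := by
    have h1 : ContMDiffAt 𝓘(𝕜, B) 𝓘(𝕜, A) n (fun q => T (ψ (e' q))) (p y) :=
      ((hT.contDiffAt.comp _ hψ1).contMDiffAt).comp (p y) contMDiffAt_extChartAt
    have h2 : ContMDiffAt 𝓘(𝕜, A) 𝓘(𝕜, A) n e.symm (T (ψ (e' (p y)))) := by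
      rw [hψ0, hT0]
      exact (contMDiffOn_extChartAt_symm y).contMDiffAt (extChartAt_target_mem_nhds y)
    exact h2.comp (p y) h1
  refine ⟨fun q => e.symm (T (ψ (e' q))), hσ, hσ0, ?_⟩
  have hc : ContinuousAt (fun q => p (e.symm (T (ψ (e' q))))) (p y) :=
    ContinuousAt.comp (g := p) (by rw [hσ0]; exact hp.continuousAt) hσ.continuousAt
  have h1 : ∀ᶠ q in 𝓝 (p y), p (e.symm (T (ψ (e' q)))) ∈ e'.source := by
    refine hc ?_
    simp only [hσ0]
    exact extChartAt_source_mem_nhds (p y)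
  have h2 : ∀ᶠ q in 𝓝 (p y), (P ∘ T) (ψ (e' q)) = e' q :=
    (continuousAt_extChartAt (I := 𝓘(𝕜, B)) (p y)).eventually hψ2
  filter_upwards [h1, h2, extChartAt_source_mem_nhds (I := 𝓘(𝕜, B)) (p y)] with q h1 h2 h3
  exact e'.injOn h1 h3 h2

theorem ContMDiffAt.of_comp_submersion (hn : n ≠ 0) (hp : ContMDiffAt 𝓘(𝕜, A) 𝓘(𝕜, B) n p y)
    (hs : Function.Surjective (mfderiv 𝓘(𝕜, A) 𝓘(𝕜, B) p y)) {h : X → V}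
    (hh : ContMDiffAt 𝓘(𝕜, A) 𝓘(𝕜, C) n (h ∘ p) y) : ContMDiffAt 𝓘(𝕜, B) 𝓘(𝕜, C) n h (p y) := by
  obtain ⟨σ, hσ, hσ0, hσ1⟩ := hp.exists_local_section hn hs
  rw [← hσ0] at hh
  refine (hh.comp (p y) hσ).congr_of_eventuallyEq ?_
  filter_upwards [hσ1] with q hq
  simp [hq]

end LocalSections

section Quotient

variable {F : Type*} [NormedAddCommGroup F] [NormedSpace ℂ F]
  {GC : Type*} [TopologicalSpace GC] [ChartedSpace F GC] [Group GC] [LieGroup 𝓘(ℂ, F) ω GC]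
  {H : Subgroup GC}
  {M : Type*} [NormedAddCommGroup M] [NormedSpace ℂ M] [FiniteDimensional ℂ M]
  [ChartedSpace M (GC ⧸ H)]

theorem IsQuotientManifold.contMDiff_of_comp (hX : IsQuotientManifold (F := F) H M)
    {V : Type*} [NormedAddCommGroup V] [NormedSpace ℂ V] {h : GC ⧸ H → V}
    (hh : ContMDiff 𝓘(ℂ, F) 𝓘(ℂ, V) ω (fun g : GC => h (g : GC ⧸ H))) :
    ContMDiff 𝓘(ℂ, M) 𝓘(ℂ, V) ω h := by
  have := FiniteDimensional.complete ℂ M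
  intro q
  obtain ⟨y, rfl⟩ := QuotientGroup.mk_surjective q
  exact (hX.contMDiff y).of_comp_submersion (by simp) (hX.submersion y) (hh y)

variable (F M H) in
/-- The differential at `1` of the orbit map `g ↦ g y H`. -/
def orbitDeriv (y : GC) : F →L[ℂ] M :=
  mfderiv 𝓘(ℂ, F) 𝓘(ℂ, M) (fun g : GC => ((g * y : GC) : GC ⧸ H)) 1

omit [FiniteDimensional ℂ M] in
theorem IsQuotientManifold.hasMFDerivAt_orbit (hX : IsQuotientManifold (F := F) H M) (y : GC) :
    HasMFDerivAt 𝓘(ℂ, F) 𝓘(ℂ, M) (fun g : GC => ((g * y : GC) : GC ⧸ H)) 1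
      (orbitDeriv F H M y) :=
  ((hX.contMDiff.comp (contMDiff_mul_right (I := 𝓘(ℂ, F)) (a := y))).mdifferentiableAt
    (by simp)).hasMFDerivAt

omit [FiniteDimensional ℂ M] in
theorem IsQuotientManifold.orbitDeriv_surjective (hX : IsQuotientManifold (F := F) H M) (y : GC) :
    Function.Surjective (orbitDeriv F H M y) := by
  have hR : ∀ a b : GC, MDifferentiableAt 𝓘(ℂ, F) 𝓘(ℂ, F) (fun g : GC => g * a) b := fun a b =>
    (contMDiff_mul_right (I := 𝓘(ℂ, F)) (n := ω) (a := a)).mdifferentiableAt (by simp)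
  have h1 : HasMFDerivAt 𝓘(ℂ, F) 𝓘(ℂ, M) (fun g : GC => (g : GC ⧸ H)) (1 * y)
      (mfderiv 𝓘(ℂ, F) 𝓘(ℂ, M) (fun g : GC => (g : GC ⧸ H)) (1 * y)) :=
    (hX.contMDiff.mdifferentiableAt (by simp)).hasMFDerivAt
  have h2 := (HasMFDerivAt.comp (1 : GC) (f := fun g : GC => g * y) h1
    (hR y 1).hasMFDerivAt).mfderiv
  intro v
  obtain ⟨u, rfl⟩ := hX.submersion (1 * y) v
  have h3 : HasMFDerivAt 𝓘(ℂ, F) 𝓘(ℂ, F) (fun g : GC => g * y) ((1 * y) * y⁻¹)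
      (mfderiv 𝓘(ℂ, F) 𝓘(ℂ, F) (fun g : GC => g * y) 1) := by
    rw [one_mul, mul_inv_cancel]; exact (hR y 1).hasMFDerivAt
  have h4 := (HasMFDerivAt.comp (1 * y) (f := fun g : GC => g * y⁻¹) h3
    (hR y⁻¹ (1 * y)).hasMFDerivAt).mfderiv
  have e : (fun g : GC => g * y) ∘ (fun g : GC => g * y⁻¹) = id := by funext g; simp
  rw [e, mfderiv_id] at h4
  refine ⟨mfderiv 𝓘(ℂ, F) 𝓘(ℂ, F) (fun g : GC => g * y⁻¹) (1 * y) u, ?_⟩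
  refine (DFunLike.congr_fun h2 _).trans ?_
  exact congrArg (mfderiv 𝓘(ℂ, F) 𝓘(ℂ, M) (fun g : GC => (g : GC ⧸ H)) (1 * y))
    (DFunLike.congr_fun h4 u).symm

omit [FiniteDimensional ℂ M] in
/-- The velocity of the curve `γ t y H`, for a one-parameter subgroup `γ`. -/
theorem IsQuotientManifold.hasMFDerivAt_curve (hX : IsQuotientManifold (F := F) H M) (y : GC)
    {γ : ℝ → GC} {Z : F} (h : IsOneParameterSubgroup (E := F) γ Z) :
    HasMFDerivAt 𝓘(ℝ, ℝ) 𝓘(ℝ, M) (fun t => ((γ t * y : GC) : GC ⧸ H)) 0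
      (ContinuousLinearMap.toSpanSingleton ℝ (orbitDeriv F H M y Z) : ℝ →L[ℝ] M) := by
  have h1 := (hX.hasMFDerivAt_orbit y).complexToReal (I' := 𝓘(ℝ, F)) rfl rfl
  rw [← h.map_zero] at h1
  refine (HasMFDerivAt.comp (0 : ℝ) h1 h.2).congr_mfderiv (ContinuousLinearMap.ext fun (r : ℝ) => ?_)
  exact ((orbitDeriv F H M y).restrictScalars ℝ).map_smul r Z

omit [FiniteDimensional ℂ M] in
theorem IsQuotientManifold.hasDerivAt_comp_curve (hX : IsQuotientManifold (F := F) H M) {y : GC}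
    {γ : ℝ → GC} {Z : F} (h : IsOneParameterSubgroup (E := F) γ Z)
    {V : Type*} [NormedAddCommGroup V] [NormedSpace ℝ V] {f : GC ⧸ H → V} {f' : M →L[ℝ] V}
    (hf : HasMFDerivAt 𝓘(ℝ, M) 𝓘(ℝ, V) f (y : GC ⧸ H) f') :
    HasDerivAt (fun t => f ((γ t * y : GC) : GC ⧸ H)) (f' (orbitDeriv F H M y Z)) 0 := by
  have e : ((γ 0 * y : GC) : GC ⧸ H) = y := by rw [h.map_zero, one_mul]
  rw [← e] at hf
  have h1 : HasFDerivAt (fun t => f ((γ t * y : GC) : GC ⧸ H))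
      (f'.comp (ContinuousLinearMap.toSpanSingleton ℝ (orbitDeriv F H M y Z))) 0 :=
    (HasMFDerivAt.comp (0 : ℝ) hf (hX.hasMFDerivAt_curve y h)).hasFDerivAt
  simpa using h1.hasDerivAt

end Quotient

/-! ### The map from points of `X_ℂ` to symmetries of the Lie algebra. -/

section SymmetricSpace

variable {E : Type*} [NormedAddCommGroup E] [NormedSpace ℝ E] [CompleteSpace E]
  {G : Type*} [TopologicalSpace G] [ChartedSpace E G] [Group G] [LieGroup 𝓘(ℝ, E) ∞ G]
  {F : Type*} [NormedAddCommGroup F] [NormedSpace ℂ F] [FiniteDimensional ℂ F]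
  {GC : Type*} [TopologicalSpace GC] [ChartedSpace F GC] [Group GC] [LieGroup 𝓘(ℂ, F) ω GC]
  [T2Space GC] {ι : G →* GC}
  {θ : GroupLieAlgebra 𝓘(ℝ, E) G ≃ₗ⁅ℝ⁆ GroupLieAlgebra 𝓘(ℝ, E) G}

variable (θ) in
/-- The complex extension of `θ` as a continuous linear map. -/
def IsComplexification.extendCLM (hι : IsComplexification (E := E) (F := F) ι) : F →L[ℂ] F :=
  LinearMap.toContinuousLinearMap (hι.isRealForm.extendAut θ)

variable (θ) in
/-- The symmetry of the Lie algebra at the point `q` of the complex symmetric space. -/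
def IsComplexification.symmetryAt (hι : IsComplexification (E := E) (F := F) ι)
    (q : GC ⧸ complexK (F := F) ι θ) : F →L[ℂ] F :=
  groupAd ℂ F q.out * (hι.extendCLM θ * groupAd ℂ F q.out⁻¹)

/-- Independence of the representative: `Ad(K_ℂ)` commutes with `θ`. -/
theorem IsComplexification.symmetryAt_mk (hι : IsComplexification (E := E) (F := F) ι) (y : GC) :
    hι.symmetryAt θ (y : GC ⧸ complexK (F := F) ι θ)
      = groupAd ℂ F y * (hι.extendCLM θ * groupAd ℂ F y⁻¹) := by
  obtain ⟨h, hh⟩ := QuotientGroup.mk_out_eq_mul (complexK (F := F) ι θ) y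
  have hm : ∀ a b : GC, groupAd ℂ F (a * b) = groupAd ℂ F a * groupAd ℂ F b :=
    fun a b => groupAd_mul ω (by simp) a b
  have hc : hι.extendCLM θ * groupAd ℂ F (h : GC) = groupAd ℂ F (h : GC) * hι.extendCLM θ :=
    ContinuousLinearMap.ext fun W => hι.extendAut_groupAd h.2 W
  have hi : groupAd ℂ F (h : GC) * groupAd ℂ F (h : GC)⁻¹ = 1 := groupAd_mul_inv_cancel _
  rw [symmetryAt, hh, mul_inv_rev, hm, hm, mul_assoc, ← mul_assoc (groupAd ℂ F (h : GC)), ← hc,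
    mul_assoc (hι.extendCLM θ), ← mul_assoc (groupAd ℂ F (h : GC)), hi, one_mul]

theorem IsComplexification.symmetryAt_smul (hι : IsComplexification (E := E) (F := F) ι) (g y : GC) :
    hι.symmetryAt θ ((g * y : GC) : GC ⧸ complexK (F := F) ι θ)
      = groupAd ℂ F g * (hι.symmetryAt θ (y : GC ⧸ complexK (F := F) ι θ) * groupAd ℂ F g⁻¹) := by
  have hm : ∀ a b : GC, groupAd ℂ F (a * b) = groupAd ℂ F a * groupAd ℂ F b :=
    fun a b => groupAd_mul ω (by simp) a b
  rw [hι.symmetryAt_mk, hι.symmetryAt_mk, mul_inv_rev, hm, hm]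
  simp only [mul_assoc]

theorem IsComplexification.symmetryAt_apply (hι : IsComplexification (E := E) (F := F) ι) (y : GC)
    (W : F) : hι.symmetryAt θ (y : GC ⧸ complexK (F := F) ι θ) W
      = groupAd ℂ F y (hι.isRealForm.extendAut θ (groupAd ℂ F y⁻¹ W)) := by
  rw [hι.symmetryAt_mk]; rfl

omit [T2Space GC] [FiniteDimensional ℂ F] in
theorem groupAd_inv_apply (y : GC) (W : F) : groupAd ℂ F y (groupAd ℂ F y⁻¹ W) = W :=
  DFunLike.congr_fun (groupAd_mul_inv_cancel y) W

omit [T2Space GC] [FiniteDimensional ℂ F] in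
theorem groupAd_apply_inv (y : GC) (W : F) : groupAd ℂ F y⁻¹ (groupAd ℂ F y W) = W :=
  DFunLike.congr_fun (groupAd_inv_mul_cancel y) W

theorem IsComplexification.symmetryAt_symmetryAt (hι : IsComplexification (E := E) (F := F) ι)
    (hθ : ∀ Y, θ (θ Y) = Y) (y : GC) (W : F) :
    hι.symmetryAt θ (y : GC ⧸ complexK (F := F) ι θ)
      (hι.symmetryAt θ (y : GC ⧸ complexK (F := F) ι θ) W) = W := by
  rw [hι.symmetryAt_apply, hι.symmetryAt_apply, groupAd_apply_inv,
    hι.isRealForm.extendAut_involutive hθ, groupAd_inv_apply]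

theorem IsComplexification.symmetryAt_bracket (hι : IsComplexification (E := E) (F := F) ι) (y : GC)
    (Z W : F) : hι.symmetryAt θ (y : GC ⧸ complexK (F := F) ι θ) (groupAdDeriv ℂ F GC Z W)
      = groupAdDeriv ℂ F GC (hι.symmetryAt θ (y : GC ⧸ complexK (F := F) ι θ) Z)
        (hι.symmetryAt θ (y : GC ⧸ complexK (F := F) ι θ) W) := by
  have := FiniteDimensional.complete ℂ F
  simp only [hι.symmetryAt_apply]
  rw [groupAd_groupAdDeriv_apply, hι.isRealForm.extendAut_bracket hι.bracket,
    groupAd_groupAdDeriv_apply]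

variable {M : Type*} [NormedAddCommGroup M] [NormedSpace ℂ M] [FiniteDimensional ℂ M]
  [ChartedSpace M (GC ⧸ complexK (F := F) ι θ)]

theorem IsQuotientManifold.contMDiff_symmetryAt
    (hX : IsQuotientManifold (F := F) (complexK (F := F) ι θ) M)
    (hι : IsComplexification (E := E) (F := F) ι) :
    ContMDiff 𝓘(ℂ, M) 𝓘(ℂ, F →L[ℂ] F) ω (hι.symmetryAt θ) := by
  apply hX.contMDiff_of_comp
  have h1 : ContMDiff 𝓘(ℂ, F) 𝓘(ℂ, F →L[ℂ] F) ω (groupAd ℂ F : GC → F →L[ℂ] F) :=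
    contMDiff_groupAd ω le_top
  have h2 : ContMDiff 𝓘(ℂ, F) 𝓘(ℂ, F →L[ℂ] F) ω (fun g : GC => groupAd ℂ F g⁻¹) :=
    h1.comp (contMDiff_inv 𝓘(ℂ, F) ω)
  have h3 := h1.clm_comp ((contMDiff_const (c := hι.extendCLM θ)).clm_comp h2)
  refine h3.congr fun g => ?_
  rw [hι.symmetryAt_mk]
  rfl

/-- Differentiating `Ad(γ t) S Ad(γ t)⁻¹` at `0` gives the commutator of `ad Z` and `S`. -/
theorem IsQuotientManifold.mfderiv_symmetryAt
    (hX : IsQuotientManifold (F := F) (complexK (F := F) ι θ) M)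
    (hι : IsComplexification (E := E) (F := F) ι) (y : GC) (Z : F) :
    (mfderiv 𝓘(ℂ, M) 𝓘(ℂ, F →L[ℂ] F) (hι.symmetryAt θ) (y : GC ⧸ complexK (F := F) ι θ) :
        M →L[ℂ] F →L[ℂ] F) (orbitDeriv F (complexK (F := F) ι θ) M y Z)
      = groupAdDeriv ℂ F GC Z * hι.symmetryAt θ (y : GC ⧸ complexK (F := F) ι θ)
        - hι.symmetryAt θ (y : GC ⧸ complexK (F := F) ι θ) * groupAdDeriv ℂ F GC Z := by
  have := FiniteDimensional.complete ℂ F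
  obtain ⟨γ, h⟩ := exists_isOneParameterSubgroup_complex (GC := GC) Z
  have h1 := (((hX.contMDiff_symmetryAt hι).mdifferentiableAt (x := (y : GC ⧸ complexK (F := F) ι θ))
    (by simp)).hasMFDerivAt).complexToReal (I' := 𝓘(ℝ, M)) rfl rfl
  have h2 := hX.hasDerivAt_comp_curve h h1
  refine h2.unique ?_
  have h3 : ∀ t, hι.symmetryAt θ ((γ t * y : GC) : GC ⧸ complexK (F := F) ι θ)
      = groupAd ℂ F (γ t) * (hι.symmetryAt θ (y : GC ⧸ complexK (F := F) ι θ)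
        * groupAd ℂ F (γ (-t))) := fun t => by rw [hι.symmetryAt_smul, h.map_neg]
  have h4 : HasDerivAt (fun t => groupAd ℂ F (γ (-t))) (-groupAdDeriv ℂ F GC Z) 0 := by
    have h5 := h.hasDerivAt_groupAd_zero
    rw [← neg_zero] at h5
    have h6 := HasDerivAt.scomp (0 : ℝ) h5 (hasDerivAt_neg 0)
    rw [neg_one_smul] at h6
    exact h6
  have h5 := h.hasDerivAt_groupAd_zero.mul
    (h4.const_mul (hι.symmetryAt θ (y : GC ⧸ complexK (F := F) ι θ)))
  have e0 : groupAd ℂ F (γ 0) = (1 : F →L[ℂ] F) := by rw [h.map_zero]; exact groupAd_one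
  simp only [neg_zero, e0, mul_one, one_mul, mul_neg, ← sub_eq_add_neg] at h5
  exact h5.congr_of_eventuallyEq (Filter.Eventually.of_forall h3)

omit [FiniteDimensional ℂ M] in
theorem IsQuotientManifold.orbitDeriv_eq_zero_of_mem
    (hX : IsQuotientManifold (F := F) (complexK (F := F) ι θ) M) {y : GC} {Z : F}
    (h : groupAd ℂ F y⁻¹ Z ∈ fixedSpan (F := F) ι θ) :
    orbitDeriv F (complexK (F := F) ι θ) M y Z = 0 := by
  have := FiniteDimensional.complete ℂ F
  obtain ⟨γ, hγ⟩ := exists_isOneParameterSubgroup_complex (GC := GC) (groupAd ℂ F y⁻¹ Z)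
  have h1 := hγ.conj y
  rw [groupAd_inv_apply] at h1
  have h2 := (hX.hasMFDerivAt_curve y h1).mfderiv
  have h3 : ∀ t, ((y * γ t * y⁻¹ * y : GC) : GC ⧸ complexK (F := F) ι θ) = y := by
    intro t
    rw [inv_mul_cancel_right, eq_comm, QuotientGroup.eq, inv_mul_cancel_left,
      ← hγ.complexLieExp_smul t, complexK_eq]
    refine Subgroup.subset_closure ⟨t • groupAd ℂ F y⁻¹ Z, ?_, rfl⟩
    rw [← Complex.coe_smul]
    exact Submodule.smul_mem _ _ h
  rw [funext h3, mfderiv_const] at h2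
  have h4 := DFunLike.congr_fun h2 (1 : ℝ)
  have h5 : (ContinuousLinearMap.toSpanSingleton ℝ (orbitDeriv F (complexK (F := F) ι θ) M y Z)
      : ℝ →L[ℝ] M) 1 = 0 := h4.symm
  simpa using h5

theorem IsComplexification.groupAd_inv_mem_of_commute
    (hι : IsComplexification (E := E) (F := F) ι) (hθ : IsCartanInvolution θ) {y : GC} {Z : F}
    (h : groupAdDeriv ℂ F GC Z * hι.symmetryAt θ (y : GC ⧸ complexK (F := F) ι θ)
        - hι.symmetryAt θ (y : GC ⧸ complexK (F := F) ι θ) * groupAdDeriv ℂ F GC Z = 0) :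
    groupAd ℂ F y⁻¹ Z ∈ fixedSpan (F := F) ι θ := by
  have h1 : hι.symmetryAt θ (y : GC ⧸ complexK (F := F) ι θ) Z = Z := by
    refine hι.eq_of_commute hθ
      (S := (hι.symmetryAt θ (y : GC ⧸ complexK (F := F) ι θ)).toLinearMap)
      (fun W => ⟨_, hι.symmetryAt_symmetryAt hθ.1 y W⟩) (hι.symmetryAt_bracket y) fun W => ?_
    exact (DFunLike.congr_fun (sub_eq_zero.1 h) W).symm
  rw [hι.isRealForm.mem_span_fixed_iff]
  rw [hι.symmetryAt_apply] at h1
  conv_rhs => rw [← h1]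
  rw [groupAd_apply_inv]

/-- It identifies the tangent space at `y x₀` with `𝔤_ℂ / Ad(y) 𝔨_ℂ`. That the kernel is no larger
is seen through `symmetryAt`: a zero velocity makes `ad Z` commute with the symmetry `S`, so `SZ =
Z`. -/
theorem IsQuotientManifold.orbitDeriv_eq_zero_iff
    (hX : IsQuotientManifold (F := F) (complexK (F := F) ι θ) M)
    (hι : IsComplexification (E := E) (F := F) ι) (hθ : IsCartanInvolution θ) {y : GC} {Z : F} :
    orbitDeriv F (complexK (F := F) ι θ) M y Z = 0 ↔ groupAd ℂ F y⁻¹ Z ∈ fixedSpan (F := F) ι θ := by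
  refine ⟨fun h => hι.groupAd_inv_mem_of_commute hθ ?_, hX.orbitDeriv_eq_zero_of_mem⟩
  rw [← hX.mfderiv_symmetryAt hι, h]
  exact (mfderiv 𝓘(ℂ, M) 𝓘(ℂ, F →L[ℂ] F) (hι.symmetryAt θ) (y : GC ⧸ complexK (F := F) ι θ) :
    M →L[ℂ] F →L[ℂ] F).map_zero

end SymmetricSpace

end

/-! ### Zero sets filled by images, and orbits known to be totally real. -/

section
open scoped Topology

section ZeroSets

variable {A B V : Type*} [NormedAddCommGroup A] [NormedSpace ℝ A] [CompleteSpace A]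
  [NormedAddCommGroup B] [NormedSpace ℝ B] [FiniteDimensional ℝ B]
  [NormedAddCommGroup V] [NormedSpace ℝ V] [FiniteDimensional ℝ V]

/-- If `f ∘ φ = 0`, the derivative of `f` is surjective and the image of the derivative of `φ` is the
kernel of that of `f`, then the image of `φ` contains the zeros of `f` near the base point. -/
theorem HasStrictFDerivAt.eventually_mem_image {f : B → V} {f' : B →L[ℝ] V} {φ : A → B}
    {φ' : A →L[ℝ] B} {a : A} (hf : HasStrictFDerivAt f f' (φ a)) (hφ : HasStrictFDerivAt φ φ' a)
    (hs : Function.Surjective f') (hr : ∀ v, f' v = 0 → ∃ u, φ' u = v)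
    (h0 : ∀ᶠ u in 𝓝 a, f (φ u) = 0) {s : Set A} (hsa : s ∈ 𝓝 a) :
    ∀ᶠ x in 𝓝 (φ a), f x = 0 → x ∈ φ '' s := by
  have := FiniteDimensional.complete ℝ B
  have := FiniteDimensional.complete ℝ V
  obtain ⟨R, hR⟩ := f'.exists_rightInverse_of_surjective (LinearMap.range_eq_top.2 hs)
  have hR' : ∀ v, f' (R v) = v := fun v => DFunLike.congr_fun hR v
  have hcomp : f'.comp φ' = 0 := by
    refine (hf.comp a hφ).hasFDerivAt.unique ?_
    exact (hasFDerivAt_const (0 : V) a).congr_of_eventuallyEq h0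
  -- Adding a complement `R` of the kernel makes `Φ` a submersion, so it covers a neighbourhood of
  -- `φ a`, while `f ∘ Φ` has derivative `(u, w) ↦ w`.
  set Φ : A × V → B := fun q => φ q.1 + R q.2 with hΦ
  set Φ' : A × V →L[ℝ] B :=
    φ'.comp (ContinuousLinearMap.fst ℝ A V) + R.comp (ContinuousLinearMap.snd ℝ A V) with hΦ'
  have hΦd : HasStrictFDerivAt Φ Φ' (a, 0) := by
    refine HasStrictFDerivAt.add ?_ ?_
    · exact HasStrictFDerivAt.comp (a, (0 : V)) (f := Prod.fst) hφ hasStrictFDerivAt_fst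
    · exact R.hasStrictFDerivAt.comp (a, (0 : V)) hasStrictFDerivAt_snd
  have hΦa : Φ (a, 0) = φ a := by simp [hΦ]
  have hsurj : (Φ' : A × V →ₗ[ℝ] B).range = ⊤ := by
    rw [LinearMap.range_eq_top]
    intro v
    obtain ⟨u, hu⟩ := hr (v - R (f' v)) (by rw [map_sub, hR', sub_self])
    exact ⟨(u, f' v), by simp [hΦ', hu]⟩
  have hmap := hΦd.map_nhds_eq_of_surj hsurj
  rw [hΦa] at hmap
  have hg : HasStrictFDerivAt (fun q => f (Φ q)) (f'.comp Φ') (a, 0) := by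
    rw [← hΦa] at hf
    exact hf.comp (a, (0 : V)) hΦd
  have hg' : ∀ u w, (f'.comp Φ') (u, w) = w := by
    intro u w
    have : f' (φ' u) = 0 := DFunLike.congr_fun hcomp u
    simp [hΦ', this, hR']
  -- Strict differentiability compares the zeros `(u, w)` and `(u, 0)` of `f ∘ Φ`: it gives `‖w‖ ≤
  -- ‖w‖ / 2`, so `w = 0` and the point is `φ u`.
  have h1 := (hasStrictFDerivAt_iff_isLittleO.1 hg).bound (c := 1 / 2) (by norm_num)
  have hlim : Filter.Tendsto (fun q : A × V => (q, ((q.1, 0) : A × V))) (𝓝 (a, 0))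
      (𝓝 ((a, 0), (a, 0))) := by
    have : Continuous (fun q : A × V => (q, ((q.1, 0) : A × V))) := by fun_prop
    exact this.tendsto (a, 0)
  have h2 := hlim.eventually h1
  have hfst : Filter.Tendsto (Prod.fst : A × V → A) (𝓝 (a, 0)) (𝓝 a) := continuous_fst.tendsto (a, 0)
  have h3 : ∀ᶠ q : A × V in 𝓝 (a, 0), f (Φ q) = 0 → Φ q ∈ φ '' s := by
    filter_upwards [h2, hfst.eventually h0, hfst.eventually hsa] with q hq h0q hqs hfq
    have e1 : f (Φ (q.1, 0)) = 0 := by simp only [hΦ, map_zero, add_zero]; exact h0q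
    have e2 : q - (q.1, 0) = (0, q.2) := by ext <;> simp
    rw [e2, hg', e1, hfq] at hq
    have e3 : ‖((0 : A), q.2)‖ = ‖q.2‖ := by simp [Prod.norm_def]
    rw [e3, sub_zero, zero_sub, norm_neg] at hq
    have e4 : q.2 = 0 := by
      rw [← norm_le_zero_iff]; linarith
    refine ⟨q.1, hqs, ?_⟩
    simp [hΦ, e4]
  rw [← hmap]
  exact h3

variable {N X : Type*} [TopologicalSpace N] [ChartedSpace A N] [TopologicalSpace X]
  [ChartedSpace B X]

theorem HasMFDerivAt.eventually_mem_range {f : X → V} {f' : B →L[ℝ] V} {φ : N → X}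
    {φ' : A →L[ℝ] B} {a : N} (hf : HasMFDerivAt 𝓘(ℝ, B) 𝓘(ℝ, V) f (φ a) f')
    (hφ : HasMFDerivAt 𝓘(ℝ, A) 𝓘(ℝ, B) φ a φ')
    (hfc : ContMDiffAt 𝓘(ℝ, B) 𝓘(ℝ, V) 1 f (φ a)) (hφc : ContMDiffAt 𝓘(ℝ, A) 𝓘(ℝ, B) 1 φ a)
    (hs : Function.Surjective f') (hr : ∀ v, f' v = 0 → ∃ u, φ' u = v)
    (h0 : ∀ g, f (φ g) = 0) : ∀ᶠ q in 𝓝 (φ a), f q = 0 → q ∈ Set.range φ := by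
  set e := extChartAt 𝓘(ℝ, A) a with he
  set e' := extChartAt 𝓘(ℝ, B) (φ a) with he'
  have h1 : HasStrictFDerivAt (f ∘ e'.symm) f' (e' (φ a)) := by
    have c1 : ContDiffWithinAt ℝ 1 (f ∘ e'.symm) (Set.range (id : B → B)) (e' (φ a)) :=
      (contMDiffAt_iff.1 hfc).2
    have c2 : HasFDerivWithinAt (f ∘ e'.symm) f' (Set.range (id : B → B)) (e' (φ a)) := hf.2
    rw [Set.range_id] at c1 c2
    exact (contDiffWithinAt_univ.1 c1).hasStrictFDerivAt' (hasFDerivWithinAt_univ.1 c2) (by simp)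
  have h2 : HasStrictFDerivAt (e' ∘ φ ∘ e.symm) φ' (e a) := by
    have c1 : ContDiffWithinAt ℝ 1 (e' ∘ φ ∘ e.symm) (Set.range (id : A → A)) (e a) :=
      (contMDiffAt_iff.1 hφc).2
    have c2 : HasFDerivWithinAt (e' ∘ φ ∘ e.symm) φ' (Set.range (id : A → A)) (e a) := hφ.2
    rw [Set.range_id] at c1 c2
    exact (contDiffWithinAt_univ.1 c1).hasStrictFDerivAt' (hasFDerivWithinAt_univ.1 c2) (by simp)
  have hea : e.symm (e a) = a := extChartAt_to_inv a
  have hφa : (e' ∘ φ ∘ e.symm) (e a) = e' (φ a) := by simp only [Function.comp_apply, hea]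
  have hsrc : {u | φ (e.symm u) ∈ e'.source} ∈ 𝓝 (e a) := by
    have hc : ContinuousAt (φ ∘ e.symm) (e a) :=
      ContinuousAt.comp (by rw [hea]; exact hφ.1) (continuousAt_extChartAt_symm a)
    refine hc ?_
    rw [Function.comp_apply, hea]
    exact extChartAt_source_mem_nhds (φ a)
  rw [← hφa] at h1
  have h3 := h1.eventually_mem_image h2 hs hr (by
    filter_upwards [hsrc] with u hu
    have : e'.symm (e' (φ (e.symm u))) = φ (e.symm u) := e'.left_inv hu
    simp only [Function.comp_apply, this, h0]) hsrc
  rw [hφa] at h3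
  filter_upwards [(continuousAt_extChartAt (I := 𝓘(ℝ, B)) (φ a)).eventually h3,
    extChartAt_source_mem_nhds (I := 𝓘(ℝ, B)) (φ a)] with q hq hqs hfq
  have e1 : e'.symm (e' q) = q := e'.left_inv hqs
  obtain ⟨u, hu, hu'⟩ := hq (by change f (e'.symm (e' q)) = 0; rw [e1, hfq])
  exact ⟨e.symm u, e'.injOn hu hqs hu'⟩

end ZeroSets

section LinearAlgebra

variable {M V : Type*} [NormedAddCommGroup M] [NormedSpace ℂ M] [FiniteDimensional ℂ M]
  [AddCommGroup V] [Module ℝ V]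

/-- The hypotheses say that `ker N` is a real form of `M`, so `N` has rank `dim_ℂ M`. Composing with
an identification of its range with `ℝ^d`, `d = dim_ℂ M`, makes it surjective without enlarging the
kernel, as a defining function requires. -/
theorem exists_linearMap_of_ker_isRealForm (N : M →ₗ[ℝ] V)
    (h1 : ∀ v, N v = 0 → N (Complex.I • v) = 0 → v = 0)
    (h2 : ∀ v, ∃ a b, N a = 0 ∧ N b = 0 ∧ v = a + Complex.I • b) :
    ∃ P : V →ₗ[ℝ] EuclideanSpace ℝ (Fin (Module.finrank ℂ M)),
      Function.Surjective (P ∘ₗ N) ∧ ∀ v, P (N v) = 0 → N v = 0 := by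
  have : FiniteDimensional ℝ M := FiniteDimensional.complexToReal M
  have hr : IsRealForm N.ker.subtype := by
    constructor
    · rintro ⟨⟨a, ha⟩, ⟨b, hb⟩⟩ ⟨⟨a', ha'⟩, ⟨b', hb'⟩⟩ h
      rw [LinearMap.mem_ker] at ha hb ha' hb'
      replace h : a + Complex.I • b = a' + Complex.I • b' := h
      have h3 : a - a' = Complex.I • (b' - b) := by
        rw [smul_sub, sub_eq_sub_iff_add_eq_add, h, add_comm]
      have h4 : b' - b = 0 := h1 _ (by rw [map_sub, hb, hb', sub_zero])
        (by rw [← h3, map_sub, ha, ha', sub_zero])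
      rw [h4, smul_zero, sub_eq_zero] at h3
      rw [sub_eq_zero] at h4
      subst h3 h4; rfl
    · intro v
      obtain ⟨a, b, ha, hb, rfl⟩ := h2 v
      exact ⟨(⟨a, ha⟩, ⟨b, hb⟩), rfl⟩
  have hd : Module.finrank ℝ N.range = Module.finrank ℂ M := by
    have d1 := hr.equivProd.finrank_eq
    rw [Module.finrank_prod] at d1
    have d2 := N.finrank_range_add_finrank_ker
    have d3 := finrank_real_of_complex M
    omega
  have e : N.range ≃ₗ[ℝ] EuclideanSpace ℝ (Fin (Module.finrank ℂ M)) :=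
    LinearEquiv.ofFinrankEq _ _ (by rw [hd, finrank_euclideanSpace_fin])
  obtain ⟨g, hg⟩ := N.range.subtype.exists_leftInverse_of_injective (Submodule.ker_subtype _)
  have hg' : ∀ v, g (N v) = ⟨N v, v, rfl⟩ := fun v =>
    DFunLike.congr_fun hg (⟨N v, v, rfl⟩ : N.range)
  refine ⟨e.toLinearMap ∘ₗ g, fun x => ?_, fun v hv => ?_⟩
  · obtain ⟨⟨_, v, rfl⟩, rfl⟩ := e.surjective x
    exact ⟨v, congrArg e (hg' v)⟩
  · rw [LinearMap.comp_apply, hg', LinearEquiv.coe_coe, e.map_eq_zero_iff] at hv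
    exact congrArg Subtype.val hv

end LinearAlgebra

section Orbits

variable {E : Type*} [NormedAddCommGroup E] [NormedSpace ℝ E] [CompleteSpace E]
  {G : Type*} [TopologicalSpace G] [ChartedSpace E G] [Group G] [LieGroup 𝓘(ℝ, E) ∞ G]
  {F : Type*} [NormedAddCommGroup F] [NormedSpace ℂ F] [FiniteDimensional ℂ F]
  {GC : Type*} [TopologicalSpace GC] [ChartedSpace F GC] [Group GC] [LieGroup 𝓘(ℂ, F) ω GC]
  [T2Space GC] {ι : G →* GC}
  {θ : GroupLieAlgebra 𝓘(ℝ, E) G ≃ₗ⁅ℝ⁆ GroupLieAlgebra 𝓘(ℝ, E) G}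
  {M : Type*} [NormedAddCommGroup M] [NormedSpace ℂ M] [FiniteDimensional ℂ M]
  [ChartedSpace M (GC ⧸ complexK (F := F) ι θ)]

/-- For `W` in `𝔨_ℂ` write `Ad(z)W = Y + iY'`. Its velocity at `z x₀` vanishes, so those of `Y` and
`Y'` differ by a factor `-i`; both are tangent to the orbit, hence both are zero, and `Y`, `Y'` lie
in the stabilizer algebra. -/
theorem IsQuotientManifold.apply_mem_span_of_isTotallyReal [T2Space G]
    (hX : IsQuotientManifold (F := F) (complexK (F := F) ι θ) M)
    (hι : IsComplexification (E := E) (F := F) ι) (hθ : IsCartanInvolution θ) {z : GC} {d : ℕ}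
    (hS : IsTotallyRealSubmanifold (M := M)
      (MulAction.orbit ι.range (z : GC ⧸ complexK (F := F) ι θ)) d)
    {W : F} (hW : W ∈ fixedSpan (F := F) ι θ) :
    groupAd ℂ F z W ∈ Submodule.span ℂ (realFormMap E F ι ''
      (stabilizerAlgebra (E := E) ι (z : GC ⧸ complexK (F := F) ι θ) :
        Set (GroupLieAlgebra 𝓘(ℝ, E) G))) := by
  obtain ⟨c, U, f, -, hU, hzU, hfU, hUS, -, hreal⟩ :=
    hS (z : GC ⧸ complexK (F := F) ι θ) (MulAction.mem_orbit_self _)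
  have hf := ((hfU.contMDiffAt (hU.mem_nhds hzU)).mdifferentiableAt (by simp)).hasMFDerivAt
  have hj : ∀ Y : GroupLieAlgebra 𝓘(ℝ, E) G,
      mfderiv 𝓘(ℝ, M) 𝓘(ℝ, EuclideanSpace ℝ (Fin c)) f (z : GC ⧸ complexK (F := F) ι θ)
        (orbitDeriv F (complexK (F := F) ι θ) M z (realFormMap E F ι Y)) = 0 := by
    intro Y
    obtain ⟨γ, hγ⟩ := exists_isOneParameterSubgroup (G := G) Y
    have h1 := hγ.map hι.contMDiff
    -- The curve `γ t z x₀` stays in the orbit, where `f` vanishes.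
    refine (hX.hasDerivAt_comp_curve h1 hf).unique ?_
    have hc := (hX.hasMFDerivAt_curve z h1).1
    have h2 : ∀ᶠ t in 𝓝 (0 : ℝ), ((ι (γ t) * z : GC) : GC ⧸ complexK (F := F) ι θ) ∈ U := by
      refine hc (hU.mem_nhds ?_)
      beta_reduce
      rw [hγ.map_zero, map_one, one_mul]
      exact hzU
    refine (hasDerivAt_const (0 : ℝ) (0 : EuclideanSpace ℝ (Fin c))).congr_of_eventuallyEq ?_
    filter_upwards [h2] with t ht
    exact (hUS _ ht).1 ⟨⟨ι (γ t), γ t, rfl⟩, rfl⟩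
  obtain ⟨Y, Y', hY⟩ := hι.isRealForm.exists_eq (groupAd ℂ F z W)
  have h0 : orbitDeriv F (complexK (F := F) ι θ) M z (realFormMap E F ι Y)
      + Complex.I • orbitDeriv F (complexK (F := F) ι θ) M z (realFormMap E F ι Y') = 0 := by
    rw [← map_smul, ← map_add, ← hY, hX.orbitDeriv_eq_zero_iff hι hθ, groupAd_apply_inv]
    exact hW
  have h1 : Complex.I • orbitDeriv F (complexK (F := F) ι θ) M z (realFormMap E F ι Y)
      = orbitDeriv F (complexK (F := F) ι θ) M z (realFormMap E F ι Y') := by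
    rw [eq_neg_of_add_eq_zero_left h0, smul_neg, smul_smul, Complex.I_mul_I, neg_one_smul, neg_neg]
  have h2 : orbitDeriv F (complexK (F := F) ι θ) M z (realFormMap E F ι Y) = 0 := by
    refine hreal _ (hj Y) ?_
    have := hj Y'
    rw [← h1] at this
    exact this
  rw [h2, smul_zero] at h1
  rw [hY]
  refine add_mem (Submodule.subset_span ⟨Y, ?_, rfl⟩)
    (Submodule.smul_mem _ _ (Submodule.subset_span ⟨Y', ?_, rfl⟩))
  · exact (hι.mem_stabilizerAlgebra_iff hθ z Y).2 ((hX.orbitDeriv_eq_zero_iff hι hθ).1 h2)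
  · exact (hι.mem_stabilizerAlgebra_iff hθ z Y').2 ((hX.orbitDeriv_eq_zero_iff hι hθ).1 h1.symm)

end Orbits

end

/-! ### Points whose symmetry is real have totally real orbits. -/

section
open scoped Topology

section TotallyRealOrbits

variable {E : Type*} [NormedAddCommGroup E] [NormedSpace ℝ E] [CompleteSpace E]
  {G : Type*} [TopologicalSpace G] [ChartedSpace E G] [Group G] [LieGroup 𝓘(ℝ, E) ∞ G]
  {F : Type*} [NormedAddCommGroup F] [NormedSpace ℂ F] [FiniteDimensional ℂ F]
  {GC : Type*} [TopologicalSpace GC] [ChartedSpace F GC] [Group GC] [LieGroup 𝓘(ℂ, F) ω GC]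
  [T2Space GC] {ι : G →* GC}
  {θ : GroupLieAlgebra 𝓘(ℝ, E) G ≃ₗ⁅ℝ⁆ GroupLieAlgebra 𝓘(ℝ, E) G}
  {M : Type*} [NormedAddCommGroup M] [NormedSpace ℂ M] [FiniteDimensional ℂ M]
  [ChartedSpace M (GC ⧸ complexK (F := F) ι θ)]

omit [CompleteSpace E] [FiniteDimensional ℂ F] [T2Space GC] in
theorem IsComplexification.conj_groupAd (hι : IsComplexification (E := E) (F := F) ι) (g : G)
    (W : F) :
    hι.isRealForm.conj (groupAd ℂ F (ι g) W) = groupAd ℂ F (ι g) (hι.isRealForm.conj W) := by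
  have h : ∀ X : GroupLieAlgebra 𝓘(ℝ, E) G, groupAd ℂ F (ι g) (realFormMap E F ι X)
      = realFormMap E F ι (groupAd ℝ E g X) := fun X => (homDeriv_groupAd hι.contMDiff g X).symm
  obtain ⟨U, V, rfl⟩ := hι.isRealForm.exists_eq W
  rw [hι.isRealForm.conj_apply, map_add, map_sub, map_smul, h, h]
  exact hι.isRealForm.conj_apply _ _

/-- The real linear map that vanishes on endomorphisms commuting with the conjugation. -/
def IsComplexification.antiInvariant (hι : IsComplexification (E := E) (F := F) ι) :
    (F →L[ℂ] F) →ₗ[ℝ] (F →ₗ[ℝ] F) where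
  toFun S := S.toLinearMap.restrictScalars ℝ
    - hι.isRealForm.conj ∘ₗ (S.toLinearMap.restrictScalars ℝ) ∘ₗ hι.isRealForm.conj
  map_add' S T := by ext W; simp; abel
  map_smul' c S := by ext W; simp [smul_sub]

omit [CompleteSpace E] [LieGroup 𝓘(ℝ, E) ∞ G] [FiniteDimensional ℂ F] [LieGroup 𝓘(ℂ, F) ω GC]
  [T2Space GC] in
theorem IsComplexification.antiInvariant_eq_zero_iff
    (hι : IsComplexification (E := E) (F := F) ι) {S : F →L[ℂ] F} :
    hι.antiInvariant S = 0 ↔ ∀ W, hι.isRealForm.conj (S W) = S (hι.isRealForm.conj W) := by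
  constructor
  · intro h W
    have h1 := DFunLike.congr_fun h (hι.isRealForm.conj W)
    have h2 : S (hι.isRealForm.conj W)
      - hι.isRealForm.conj (S (hι.isRealForm.conj (hι.isRealForm.conj W))) = 0 := h1
    rw [hι.isRealForm.conj_conj] at h2
    exact (sub_eq_zero.1 h2).symm
  · intro h
    ext W
    change S W - hι.isRealForm.conj (S (hι.isRealForm.conj W)) = 0
    rw [h, hι.isRealForm.conj_conj, sub_self]

/-- Orbits of the real group through points whose symmetry commutes with the conjugation are totally
real of maximal dimension. -/
theorem IsQuotientManifold.isTotallyRealSubmanifold_orbit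
    (hX : IsQuotientManifold (F := F) (complexK (F := F) ι θ) M)
    (hι : IsComplexification (E := E) (F := F) ι) (hθ : IsCartanInvolution θ) {z : GC}
    (hz : ∀ W, hι.isRealForm.conj (hι.symmetryAt θ (z : GC ⧸ complexK (F := F) ι θ) W)
      = hι.symmetryAt θ (z : GC ⧸ complexK (F := F) ι θ) (hι.isRealForm.conj W)) :
    IsTotallyRealSubmanifold (M := M)
      (MulAction.orbit ι.range (z : GC ⧸ complexK (F := F) ι θ)) (Module.finrank ℂ M) := by
  have hzg : ∀ (g : G) (W : F), hι.isRealForm.conj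
      (hι.symmetryAt θ ((ι g * z : GC) : GC ⧸ complexK (F := F) ι θ) W)
      = hι.symmetryAt θ ((ι g * z : GC) : GC ⧸ complexK (F := F) ι θ) (hι.isRealForm.conj W) := by
    intro g W
    have : ∀ W, hι.symmetryAt θ ((ι g * z : GC) : GC ⧸ complexK (F := F) ι θ) W
        = groupAd ℂ F (ι g) (hι.symmetryAt θ (z : GC ⧸ complexK (F := F) ι θ)
          (groupAd ℂ F (ι g⁻¹) W)) := by
      intro W; rw [hι.symmetryAt_smul, map_inv]; rfl
    rw [this, this, hι.conj_groupAd, hz, hι.conj_groupAd]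
  rintro p ⟨⟨_, g, rfl⟩, rfl⟩
  set y : GC := ι g * z with hy
  change ∃ (c : ℕ) (U : Set (GC ⧸ complexK (F := F) ι θ))
    (f : GC ⧸ complexK (F := F) ι θ → EuclideanSpace ℝ (Fin c)),
    Module.finrank ℂ M + c = Module.finrank ℝ M ∧ IsOpen U ∧ (y : GC ⧸ complexK (F := F) ι θ) ∈ U ∧
    ContMDiffOn 𝓘(ℝ, M) 𝓘(ℝ, EuclideanSpace ℝ (Fin c)) ∞ f U ∧
    (∀ q ∈ U, q ∈ MulAction.orbit ι.range (z : GC ⧸ complexK (F := F) ι θ) ↔ f q = 0) ∧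
    Function.Surjective (mfderiv 𝓘(ℝ, M) 𝓘(ℝ, EuclideanSpace ℝ (Fin c)) f
      (y : GC ⧸ complexK (F := F) ι θ)) ∧
    ∀ v : M,
      (mfderiv 𝓘(ℝ, M) 𝓘(ℝ, EuclideanSpace ℝ (Fin c)) f (y : GC ⧸ complexK (F := F) ι θ) :
        M →L[ℝ] EuclideanSpace ℝ (Fin c)) v = 0 →
      (mfderiv 𝓘(ℝ, M) 𝓘(ℝ, EuclideanSpace ℝ (Fin c)) f (y : GC ⧸ complexK (F := F) ι θ) :
        M →L[ℝ] EuclideanSpace ℝ (Fin c)) (Complex.I • v) = 0 → v = 0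
  have hsm := hX.contMDiff_symmetryAt hι
  obtain ⟨D, hD, hDT⟩ : ∃ D : M →L[ℂ] F →L[ℂ] F,
      HasMFDerivAt 𝓘(ℂ, M) 𝓘(ℂ, F →L[ℂ] F) (hι.symmetryAt θ) (y : GC ⧸ complexK (F := F) ι θ) D ∧
      ∀ Z, D (orbitDeriv F (complexK (F := F) ι θ) M y Z)
      = groupAdDeriv ℂ F GC Z * hι.symmetryAt θ (y : GC ⧸ complexK (F := F) ι θ)
        - hι.symmetryAt θ (y : GC ⧸ complexK (F := F) ι θ) * groupAdDeriv ℂ F GC Z :=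
    ⟨_, (hsm.mdifferentiableAt (by simp)).hasMFDerivAt, hX.mfderiv_symmetryAt hι y⟩
  set T := orbitDeriv F (complexK (F := F) ι θ) M y with hT
  have hTs : Function.Surjective T := hX.orbitDeriv_surjective y
  -- `N` is the derivative at `y` of `S_q - σ S_q σ`. Its kernel will be the space of velocities of
  -- real generators, a real form of the tangent space.
  set N : M →ₗ[ℝ] (F →ₗ[ℝ] F) := hι.antiInvariant ∘ₗ (D.toLinearMap.restrictScalars ℝ) with hN
  have hNa : ∀ v, N v = hι.antiInvariant (D v) := fun _ => rfl
  have hcomm : ∀ (Y : GroupLieAlgebra 𝓘(ℝ, E) G) (W : F),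
      hι.isRealForm.conj (D (T (realFormMap E F ι Y)) W)
        = D (T (realFormMap E F ι Y)) (hι.isRealForm.conj W) := by
    intro Y W
    have h1 : ∀ W, D (T (realFormMap E F ι Y)) W
        = groupAdDeriv ℂ F GC (realFormMap E F ι Y)
            (hι.symmetryAt θ (y : GC ⧸ complexK (F := F) ι θ) W)
          - hι.symmetryAt θ (y : GC ⧸ complexK (F := F) ι θ)
            (groupAdDeriv ℂ F GC (realFormMap E F ι Y) W) := by
      intro W; rw [hDT]; rfl
    have h2 : ∀ W, hι.isRealForm.conj (groupAdDeriv ℂ F GC (realFormMap E F ι Y) W)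
        = groupAdDeriv ℂ F GC (realFormMap E F ι Y) (hι.isRealForm.conj W) := by
      intro W
      rw [hι.isRealForm.conj_bracket hι.bracket, hι.isRealForm.conj_real]
    rw [h1, h1, map_sub, h2, hzg, hzg, h2]
  have hN0 : ∀ Y, N (T (realFormMap E F ι Y)) = 0 := fun Y =>
    hι.antiInvariant_eq_zero_iff.2 (hcomm Y)
  -- If both `D(TY)` and `i D(TY)` commute with the antilinear conjugation, then `D(TY) = 0`;
  -- injectivity of the differential of the symmetry map gives `TY = 0`.
  have hN1 : ∀ Y, N (Complex.I • T (realFormMap E F ι Y)) = 0 → T (realFormMap E F ι Y) = 0 := by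
    intro Y hY
    rw [hNa, hι.antiInvariant_eq_zero_iff] at hY
    have h1 : D (T (realFormMap E F ι Y)) = 0 := by
      ext W
      have h2 := hY (hι.isRealForm.conj W)
      rw [map_smul, smul_apply, hι.isRealForm.conj_I_smul, hcomm, hι.isRealForm.conj_conj,
        smul_apply, neg_eq_iff_add_eq_zero, ← two_smul ℂ, smul_smul] at h2
      simpa using h2
    rw [hT, hX.orbitDeriv_eq_zero_iff hι hθ]
    apply hι.groupAd_inv_mem_of_commute hθ
    rw [← hDT, h1]
  have hM : ∀ v, ∃ Y Y', v = T (realFormMap E F ι Y) + Complex.I • T (realFormMap E F ι Y') := by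
    intro v
    obtain ⟨Z, rfl⟩ := hTs v
    obtain ⟨Y, Y', rfl⟩ := hι.isRealForm.exists_eq Z
    exact ⟨Y, Y', by rw [map_add, map_smul]⟩
  have hker : ∀ v, N v = 0 → ∃ Y, v = T (realFormMap E F ι Y) := by
    intro v hv
    obtain ⟨Y, Y', rfl⟩ := hM v
    rw [map_add, hN0, zero_add] at hv
    exact ⟨Y, by rw [hN1 Y' hv, smul_zero, add_zero]⟩
  have hreal : ∀ v, N v = 0 → N (Complex.I • v) = 0 → v = 0 := by
    intro v hv hv'
    obtain ⟨Y, rfl⟩ := hker v hv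
    exact hN1 Y hv'
  obtain ⟨P, hPs, hP⟩ := exists_linearMap_of_ker_isRealForm N hreal fun v => by
    obtain ⟨Y, Y', rfl⟩ := hM v
    exact ⟨_, _, hN0 Y, hN0 Y', rfl⟩
  have : FiniteDimensional ℝ M := FiniteDimensional.complexToReal M
  have : FiniteDimensional ℝ (F →L[ℂ] F) := FiniteDimensional.complexToReal _
  set Q : (F →L[ℂ] F) →L[ℝ] EuclideanSpace ℝ (Fin (Module.finrank ℂ M)) :=
    LinearMap.toContinuousLinearMap (P ∘ₗ hι.antiInvariant) with hQ
  set f : GC ⧸ complexK (F := F) ι θ → EuclideanSpace ℝ (Fin (Module.finrank ℂ M)) :=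
    fun q => Q (hι.symmetryAt θ q) with hf
  have hfs : ContMDiff 𝓘(ℝ, M) 𝓘(ℝ, EuclideanSpace ℝ (Fin (Module.finrank ℂ M))) ω f :=
    fun q => Q.contMDiff.contMDiffAt.comp q
      ((hsm q).complexToReal (I' := 𝓘(ℝ, M)) rfl rfl)
  set f' : M →L[ℝ] EuclideanSpace ℝ (Fin (Module.finrank ℂ M)) :=
    Q.comp (D.restrictScalars ℝ) with hf'
  have hfd : HasMFDerivAt 𝓘(ℝ, M) 𝓘(ℝ, EuclideanSpace ℝ (Fin (Module.finrank ℂ M))) f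
      (y : GC ⧸ complexK (F := F) ι θ) f' :=
    HasMFDerivAt.comp (y : GC ⧸ complexK (F := F) ι θ) Q.hasMFDerivAt
      (hD.complexToReal (I' := 𝓘(ℝ, M)) rfl rfl)
  have hf'N : ∀ v, f' v = P (N v) := fun _ => rfl
  have hforb : ∀ g : G, f ((ι g * z : GC) : GC ⧸ complexK (F := F) ι θ) = 0 := by
    intro g
    change P (hι.antiInvariant (hι.symmetryAt θ _)) = 0
    rw [hι.antiInvariant_eq_zero_iff.2 (hzg g), map_zero]
  -- The orbit map has image of its derivative equal to `ker f'`, and `f` vanishes on the orbit, so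
  -- the orbit fills the zero set near `y`. This gives embeddedness.
  have hev : ∀ᶠ q in 𝓝 (y : GC ⧸ complexK (F := F) ι θ), f q = 0 →
      q ∈ Set.range (fun h : G => ((ι h * y : GC) : GC ⧸ complexK (F := F) ι θ)) := by
    have e1 : ((ι 1 * y : GC) : GC ⧸ complexK (F := F) ι θ) = y := by rw [map_one, one_mul]
    have o1 : HasMFDerivAt 𝓘(ℝ, E) 𝓘(ℝ, M)
        (fun h : G => ((ι h * y : GC) : GC ⧸ complexK (F := F) ι θ)) 1
        ((T.restrictScalars ℝ).comp (homDeriv E F ι)) := by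
      have h1 := (hX.hasMFDerivAt_orbit y).complexToReal (I' := 𝓘(ℝ, F)) rfl rfl
      rw [← map_one ι] at h1
      exact HasMFDerivAt.comp (1 : G)
        (g := fun g : GC => ((g * y : GC) : GC ⧸ complexK (F := F) ι θ)) h1 (hasMFDerivAt_homDeriv (E := E) (F := F) hι.contMDiff)
    have o2 : ContMDiffAt 𝓘(ℝ, E) 𝓘(ℝ, M) 1
        (fun h : G => ((ι h * y : GC) : GC ⧸ complexK (F := F) ι θ)) 1 := by
      have h1 := (hX.contMDiff.comp (contMDiff_mul_right (I := 𝓘(ℂ, F)) (a := y))) (ι 1)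
      have h2 := (h1.complexToReal (I' := 𝓘(ℝ, F)) rfl rfl).of_le (m := 1) (by simp)
      exact h2.comp (1 : G) (hι.contMDiff.contMDiffAt.of_le (by simp))
    have := HasMFDerivAt.eventually_mem_range (f' := f') (by rw [e1]; exact hfd) o1
      ((hfs _).of_le (by simp)) o2 hPs (fun v hv => ?_) (fun h => ?_)
    · rw [e1] at this
      exact this
    · obtain ⟨Y, rfl⟩ := hker v (hP v hv)
      exact ⟨Y, rfl⟩
    · rw [hy, ← mul_assoc, ← map_mul]; exact hforb _
  obtain ⟨U, hU, hUo, hyU⟩ := eventually_nhds_iff.1 hev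
  refine ⟨Module.finrank ℂ M, U, f, by rw [finrank_real_of_complex]; ring, hUo, hyU,
    (hfs.of_le (by simp)).contMDiffOn, fun q hq => ⟨?_, fun hfq => ?_⟩, ?_, ?_⟩
  · rintro ⟨⟨_, h, rfl⟩, rfl⟩
    exact hforb h
  · obtain ⟨h, rfl⟩ := hU q hq hfq
    refine ⟨⟨ι (h * g), h * g, rfl⟩, ?_⟩
    change ((ι (h * g) * z : GC) : GC ⧸ complexK (F := F) ι θ)
      = ((ι h * (ι g * z) : GC) : GC ⧸ complexK (F := F) ι θ)
    rw [← mul_assoc, ← map_mul]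
  · rw [hfd.mfderiv]; exact hPs
  · rw [hfd.mfderiv]
    exact fun v hv hv' => hreal v (hP v hv) (hP _ hv')

end TotallyRealOrbits

end

/-! ### Values of the roots on the dual basis. -/

section RestrictedRoots

variable {L : Type*} [LieRing L] [LieAlgebra ℝ L] {𝔞 : Submodule ℝ L} {n : ℕ}
  {α : Fin n → Module.Dual ℝ 𝔞} {w : Fin n → 𝔞} {k : Fin n → ℕ}

theorem IsDualBasis.sum_nsmul_apply (hw : IsDualBasis 𝔞 α w) (c : Fin n → ℕ) (j : Fin n) :
    (∑ i, c i • α i) (w j) = c j := by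
  simp [hw j]

theorem IsDualBasis.exists_int (hw : IsDualBasis 𝔞 α w) (hα : IsRootBasis 𝔞 α) (j : Fin n)
    (γ : Module.Dual ℝ 𝔞) (hγ : IsRestrictedRoot 𝔞 γ) : ∃ m : ℤ, γ (w j) = m := by
  obtain ⟨c, rfl | rfl⟩ := hα.nonneg_or_nonpos γ hγ
  · exact ⟨c j, by rw [hw.sum_nsmul_apply]; simp⟩
  · exact ⟨-c j, by rw [LinearMap.neg_apply, hw.sum_nsmul_apply]; simp⟩

theorem IsHighestRootCoeff.one_le (hk : IsHighestRootCoeff 𝔞 α k) (hw : IsDualBasis 𝔞 α w)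
    (hα : IsRootBasis 𝔞 α) (j : Fin n) : 1 ≤ k j := by
  obtain ⟨c, hc⟩ := hk.highest (α j) (hα.isRoot j)
  have h := DFunLike.congr_fun hc (w j)
  rw [LinearMap.sub_apply, hw.sum_nsmul_apply, hw.sum_nsmul_apply, hw j j, if_pos rfl] at h
  have h1 : (k j : ℝ) = c j + 1 := by linarith
  have h2 : k j = c j + 1 := by exact_mod_cast h1
  omega

theorem IsDualBasis.exists_lie_eq_self (hw : IsDualBasis 𝔞 α w) (hα : IsRootBasis 𝔞 α)
    (j : Fin n) : ∃ X : L, X ≠ 0 ∧ ⁅(w j : L), X⁆ = X := by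
  obtain ⟨-, X, hX0, hX⟩ := hα.isRoot j
  exact ⟨X, hX0, by rw [hX (w j), hw j j, if_pos rfl, one_smul]⟩

theorem IsDualBasis.coe_ne_zero (hw : IsDualBasis 𝔞 α w) (j : Fin n) : (w j : L) ≠ 0 := by
  intro h
  have h1 := hw j j
  rw [ZeroMemClass.coe_eq_zero.1 h, map_zero, if_pos rfl] at h1
  exact zero_ne_one h1

end RestrictedRoots

/-! ### `Ad(z)⁴ = 1` exactly when `k = 1`. -/

section FourthPower

theorem exp_quarter_mul_int_pow_four (m : ℤ) :
    Complex.exp (Complex.I * (Real.pi / (2 * (1 : ℕ)) : ℝ) * ((m : ℝ) : ℂ)) ^ 4 = 1 := by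
  rw [← Complex.exp_nat_mul, Complex.exp_eq_one_iff]
  exact ⟨m, by push_cast; ring⟩

theorem eq_one_of_exp_quarter_pow_four {k : ℕ} (hk : 1 ≤ k)
    (h : Complex.exp (Complex.I * (Real.pi / (2 * k) : ℝ)) ^ 4 = 1) : k = 1 := by
  rw [← Complex.exp_nat_mul, Complex.exp_eq_one_iff] at h
  obtain ⟨m, hm⟩ := h
  have hk0 : (k : ℂ) ≠ 0 := by exact_mod_cast (by omega : k ≠ 0)
  have hpi : (Real.pi : ℂ) ≠ 0 := by exact_mod_cast Real.pi_ne_zero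
  have h1 : (m : ℂ) * k = 1 := by
    push_cast at hm
    field_simp at hm
    linear_combination (-1 / 4 : ℂ) * hm
  have h2 : m * (k : ℤ) = 1 := by exact_mod_cast h1
  exact Nat.dvd_one.1 (by exact_mod_cast Dvd.intro_left m h2)

variable {E : Type*} [NormedAddCommGroup E] [NormedSpace ℝ E] [CompleteSpace E]
  {G : Type*} [TopologicalSpace G] [ChartedSpace E G] [Group G] [LieGroup 𝓘(ℝ, E) ∞ G]
  {F : Type*} [NormedAddCommGroup F] [NormedSpace ℂ F] [FiniteDimensional ℂ F]
  {GC : Type*} [TopologicalSpace GC] [ChartedSpace F GC] [Group GC] [LieGroup 𝓘(ℂ, F) ω GC]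
  [T2Space GC] {ι : G →* GC} {w X : GroupLieAlgebra 𝓘(ℝ, E) G}

theorem IsComplexification.fourthPower_boundaryElement_apply
    (hι : IsComplexification (E := E) (F := F) ι) {k : ℕ} {m : ℝ} (hX : ⁅w, X⁆ = m • X) {z : GC}
    (hz : z = boundaryElement (F := F) ι w k) :
    groupAd ℂ F z (groupAd ℂ F z (groupAd ℂ F z (groupAd ℂ F z (realFormMap E F ι X))))
      = Complex.exp (Complex.I * (Real.pi / (2 * k) : ℝ) * m) ^ 4 • realFormMap E F ι X := by
  subst hz
  have h := hι.groupAd_boundaryElement_apply (k := k) hX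
  simp only [h, map_smul, smul_smul]
  congr 1
  ring

/-- On the `m`-eigenspace of `ad w` the fourth power is `exp(2πi m / k)`. The second assertion
records that a single eigenvector with `m = 1` already detects `k = 1`. -/
theorem IsComplexification.fourthPower_boundaryElement_iff
    (hι : IsComplexification (E := E) (F := F) ι)
    (hw : ⨆ m : ℤ, Module.End.eigenspace (LieAlgebra.ad ℝ _ w) (m : ℝ) = ⊤)
    {k : ℕ} (hk : 1 ≤ k) (hX0 : X ≠ 0) (hX : ⁅w, X⁆ = X) {z : GC}
    (hz : z = boundaryElement (F := F) ι w k) :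
    ((∀ Y, groupAd ℂ F z (groupAd ℂ F z (groupAd ℂ F z (groupAd ℂ F z (realFormMap E F ι Y))))
      = realFormMap E F ι Y) ↔ k = 1) ∧
    (groupAd ℂ F z (groupAd ℂ F z (groupAd ℂ F z (groupAd ℂ F z (realFormMap E F ι X))))
      = realFormMap E F ι X → k = 1) := by
  have h1 : groupAd ℂ F z (groupAd ℂ F z (groupAd ℂ F z (groupAd ℂ F z (realFormMap E F ι X))))
      = realFormMap E F ι X → k = 1 := by
    intro h
    rw [hι.fourthPower_boundaryElement_apply (m := 1) (by rw [hX, one_smul]) hz] at h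
    have h2 : (Complex.exp (Complex.I * (Real.pi / (2 * k) : ℝ) * ((1 : ℝ) : ℂ)) ^ 4 - 1)
        • realFormMap E F ι X = 0 := by rw [sub_smul, h, one_smul, sub_self]
    rcases smul_eq_zero.1 h2 with h3 | h3
    · rw [Complex.ofReal_one, mul_one, sub_eq_zero] at h3
      exact eq_one_of_exp_quarter_pow_four hk h3
    · exact absurd (hι.isRealForm.injective (h3.trans (map_zero _).symm)) hX0
  refine ⟨⟨fun h => h1 (h X), ?_⟩, h1⟩
  rintro rfl Y
  have hY : Y ∈ ⨆ m : ℤ, Module.End.eigenspace (LieAlgebra.ad ℝ _ w) (m : ℝ) := hw ▸ trivial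
  induction hY using Submodule.iSup_induction' with
  | mem m Y hY =>
    rw [hι.fourthPower_boundaryElement_apply (m := m) (Module.End.mem_eigenspace_iff.1 hY) hz,
      exp_quarter_mul_int_pow_four, one_smul]
  | zero => simp
  | add Y Y' _ _ h h' => simp only [map_add, h, h']

end FourthPower

end

/-! ### The equivalences. -/

theorem mainTheorem2
    {E : Type*} [NormedAddCommGroup E] [NormedSpace ℝ E] [FiniteDimensional ℝ E] [CompleteSpace E]
    {G : Type*} [TopologicalSpace G] [ChartedSpace E G] [Group G] [LieGroup 𝓘(ℝ, E) ∞ G]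
    [T2Space G] [ConnectedSpace G]
    [LieAlgebra.IsSimple ℝ (GroupLieAlgebra 𝓘(ℝ, E) G)]
    {F : Type*} [NormedAddCommGroup F] [NormedSpace ℂ F] [FiniteDimensional ℂ F]
    {GC : Type*} [TopologicalSpace GC] [ChartedSpace F GC] [Group GC] [LieGroup 𝓘(ℂ, F) ω GC]
    [T2Space GC]
    (ι : G →* GC) (hι : IsComplexification (E := E) (F := F) ι)
    (θ : GroupLieAlgebra 𝓘(ℝ, E) G ≃ₗ⁅ℝ⁆ GroupLieAlgebra 𝓘(ℝ, E) G) (hθ : IsCartanInvolution θ)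
    (𝔞 : Submodule ℝ (GroupLieAlgebra 𝓘(ℝ, E) G)) (h𝔞 : IsMaximalAbelianIn (cartanP θ) 𝔞)
    {M : Type*} [NormedAddCommGroup M] [NormedSpace ℂ M] [FiniteDimensional ℂ M]
    [ChartedSpace M (GC ⧸ complexK (F := F) ι θ)]
    (hX : IsQuotientManifold (F := F) (complexK (F := F) ι θ) M)
    {n : ℕ} (α : Fin n → Module.Dual ℝ 𝔞) (hα : IsRootBasis 𝔞 α)
    (k : Fin n → ℕ) (hk : IsHighestRootCoeff 𝔞 α k)
    (w : Fin n → 𝔞) (hw : IsDualBasis 𝔞 α w) (j : Fin n)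
    (z : GC) (hz : z = boundaryElement (F := F) ι (w j : GroupLieAlgebra 𝓘(ℝ, E) G) (k j))
    (zX : GC ⧸ complexK (F := F) ι θ) (hzX : zX = z)
    (𝔥 : LieSubalgebra ℝ (GroupLieAlgebra 𝓘(ℝ, E) G)) (h𝔥 : 𝔥 = stabilizerAlgebra ι zX) :
    List.TFAE [
      k j = 1,
      Module.finrank ℝ 𝔥 = Module.finrank ℝ (cartanK θ),
      (complexSpan (F := F) ι 𝔥.toSubmodule).map (complexAd z⁻¹).toLinearMap
        = complexSpan (F := F) ι (cartanK θ).toSubmodule,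
      IsSymmetricSubalgebra 𝔥,
      ∃ d : ℕ, IsTotallyRealSubmanifold (M := M) (MulAction.orbit ι.range zX) d,
      IsTotallyRealSubmanifold (M := M) (MulAction.orbit ι.range zX) (Module.finrank ℂ M)] := by
  have : FiniteDimensional ℝ (GroupLieAlgebra 𝓘(ℝ, E) G) := inferInstanceAs (FiniteDimensional ℝ E)
  subst hzX
  have h𝔞P : 𝔞 ≤ cartanP θ := h𝔞.prop.1
  have hwP : θ (w j : GroupLieAlgebra 𝓘(ℝ, E) G) = -(w j : GroupLieAlgebra 𝓘(ℝ, E) G) :=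
    mem_cartanP.1 (h𝔞P (w j).2)
  have hB := hι.bracket
  have hA : IsCrownRotation hι.isRealForm (groupAdDeriv ℂ F GC) θ (groupAd ℂ F z)
      (groupAd ℂ F z⁻¹) := by
    rw [hz]; exact hι.isCrownRotation hwP
  have h𝔥' : ∀ Y, Y ∈ 𝔥 ↔ groupAd ℂ F z⁻¹ (realFormMap E F ι Y) ∈ fixedSpan (F := F) ι θ := by
    intro Y; rw [h𝔥]; exact hι.mem_stabilizerAlgebra_iff hθ z Y
  obtain ⟨X, hX0, hXw⟩ := hw.exists_lie_eq_self hα j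
  obtain ⟨hP, hPX⟩ := hι.fourthPower_boundaryElement_iff
    (hθ.iSup_eigenspace_ad_int h𝔞P h𝔞.prop.2 (hw.exists_int hα j)) (hk.one_le hw hα j) hX0 hXw hz
  have hAw : groupAd ℂ F z (realFormMap E F ι (w j)) = realFormMap E F ι (w j) := by
    rw [hz, hι.groupAd_boundaryElement_apply (m := 0) (by rw [lie_self, zero_smul])]
    simp
  -- This inclusion holds for every `k j`, so equality is equivalent to equality of dimensions.
  have hle : (Submodule.span ℂ (realFormMap E F ι '' (𝔥 : Set _))).map
      (groupAd ℂ F z⁻¹).toLinearMap ≤ fixedSpan (F := F) ι θ := by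
    rw [Submodule.map_span_le]
    rintro _ ⟨Y, hY, rfl⟩
    exact (h𝔥' Y).1 hY
  have hinj : Function.Injective (groupAd ℂ F z⁻¹).toLinearMap :=
    Function.LeftInverse.injective (g := groupAd ℂ F z) (groupAd_inv_apply z)
  have hdim : Module.finrank ℂ ((Submodule.span ℂ (realFormMap E F ι '' (𝔥 : Set _))).map
      (groupAd ℂ F z⁻¹).toLinearMap) = Module.finrank ℝ 𝔥 :=
    ((Submodule.equivMapOfInjective _ hinj _).finrank_eq.symm).trans
      (hι.isRealForm.finrank_span 𝔥.toSubmodule)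
  have hdimK : Module.finrank ℂ (fixedSpan (F := F) ι θ) = Module.finrank ℝ (cartanK θ) :=
    hι.isRealForm.finrank_span (cartanK θ).toSubmodule
  have item3 : ((complexSpan (F := F) ι 𝔥.toSubmodule).map (complexAd z⁻¹).toLinearMap
      = complexSpan (F := F) ι (cartanK θ).toSubmodule) ↔
      (Submodule.span ℂ (realFormMap E F ι '' (𝔥 : Set _))).map (groupAd ℂ F z⁻¹).toLinearMap
        = fixedSpan (F := F) ι θ := Iff.rfl
  rw [item3]
  tfae_have 1 → 3 := fun h => hA.map_span_eq hB hθ.1 h𝔥' (hP.2 h)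
  tfae_have 3 → 2 := fun h => by rw [← hdim, ← hdimK, h]
  tfae_have 2 → 3 := fun h => Submodule.eq_of_le_of_finrank_eq hle (by rw [hdim, hdimK, h])
  tfae_have 3 → 1 := fun h => by
    refine hPX (hA.fourthPower_eq_of_span_le hθ.1 hB h𝔥' hwP hAw (fun Z hZ => ?_) hXw)
    obtain ⟨V, hV, rfl⟩ := h.ge hZ
    exact (groupAd_inv_apply z V).symm ▸ hV
  tfae_have 1 → 4 := fun h => hA.isSymmetricSubalgebra hB hθ.1 h𝔥' (hP.2 h)
  tfae_have 4 → 1 := fun h => hP.1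
    (hA.fourthPower_eq_of_isSymmetricSubalgebra hθ hB h𝔥' hwP (hw.coe_ne_zero j) hAw h)
  -- The symmetry at `z` is `A²θ`; conjugation turns it into `A⁻²θ`, which is the same because `A⁴ =
  -- 1`.
  tfae_have 1 → 6 := fun h => hX.isTotallyRealSubmanifold_orbit hι hθ fun W => by
    have h4 : ∀ Z, groupAd ℂ F z (groupAd ℂ F z (groupAd ℂ F z (groupAd ℂ F z Z))) = Z := by
      intro Z
      obtain ⟨U, V, rfl⟩ := hι.isRealForm.exists_eq Z
      simp only [map_add, map_smul, hP.2 h]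
    have h2 : ∀ Z, groupAd ℂ F z⁻¹ (groupAd ℂ F z⁻¹ Z) = groupAd ℂ F z (groupAd ℂ F z Z) := by
      intro Z
      conv_lhs => rw [← h4 Z]
      rw [groupAd_apply_inv, groupAd_apply_inv]
    rw [hι.symmetryAt_apply, hι.symmetryAt_apply, hA.extendAut', hA.extendAut', hA.conj, hA.conj, h2,
      hι.isRealForm.extendAut_conj]
  tfae_have 6 → 5 := fun h => ⟨_, h⟩
  tfae_have 5 → 3 := fun ⟨d, hd⟩ => by
    refine le_antisymm hle fun W hW => ⟨groupAd ℂ F z W, ?_, groupAd_apply_inv z W⟩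
    have h1 := hX.apply_mem_span_of_isTotallyReal hι hθ hd hW
    rw [← h𝔥] at h1
    exact h1
  tfae_finish
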